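/- Let $\Omega\subset\mathbb{R}^2$ be a nonempty bounded open set, let $K>1$ and $S_1,S_2\in[1/K,K]$, and put $\sigma_1=\operatorname{diag}(1/K,1/S_1)$, $\sigma_2=\operatorname{diag}(K,S_2)$. For $1\le p<\infty$ let $L^p_{\rm weak}(\Omega;\mathbb{R}^2)$ be the set of measurable $f:\Omega\to\mathbb{R}^2$ with $\sup_{t>0}t^p\,|\{x\in\Omega:|f(x)|>t\}|<\infty$. Then there exist coefficients $\sigma_n\in L^\infty(\Omega;\{\sigma_1,\sigma_2\})$ (measurable, with values in $\{\sigma_1,\sigma_2\}$ almost everywhere), exponents $p_n\in\left[1,\frac{2K}{K+1}\right]$ and functions $u_n\in W^{1,1}(\Omega;\mathbb{R})$, $n\in\mathbb{N}$, such that for every $n$ $$\operatorname{div}(\sigma_n\nabla u_n)=0\ \text{ in }\Omega\text{ in the sense of distributions},\qquad u_n=x_1\ \text{ on }\partial\Omega,\ \text{ i.e. } u_n-x_1\in W^{1,1}_0(\Omega),$$ $$\nabla u_n\in L^{p_n}_{\rm weak}(\Omega;\mathbb{R}^2),\qquad \nabla u_n\notin L^{\frac{2K}{K+1}}(\Omega;\mathbb{R}^2),$$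 and $p_n\to\frac{2K}{K+1}$ as $n\to\infty$. In particular $u_n\in W^{1,q}(\Omega;\mathbb{R})$ for every $1\le q<p_n$, but $\int_\Omega|\nabla u_n|^{\frac{2K}{K+1}}\,dx=\infty$. (Here $W^{1,1}_0(\Omega)$ is the closure of $C_c^\infty(\Omega)$ in $W^{1,1}(\Omega)$.) -/

import Mathlib

open MeasureTheory Filter Topology
open scoped ENNReal

noncomputable section

namespace TwoPhase

/-- The Euclidean plane. -/
abbrev Plane : Type := EuclideanSpace ℝ (Fin 2)

/-- The test functions `C_c^∞(Ω)`. -/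
def IsTestFunction (Ω : Set Plane) (φ : Plane → ℝ) : Prop :=
  ContDiff ℝ ((⊤ : ℕ∞) : WithTop ℕ∞) φ ∧ HasCompactSupport φ ∧ tsupport φ ⊆ Ω

/-- `g` is the weak (distributional) gradient of `u` in the open set `Ω`; both are locally
integrable functions in `Ω`. Values outside `Ω` play no role. -/
def HasWeakGradient (Ω : Set Plane) (u : Plane → ℝ) (g : Plane → Plane) : Prop :=
  LocallyIntegrableOn u Ω volume ∧ LocallyIntegrableOn g Ω volume ∧
    ∀ φ : Plane → ℝ, IsTestFunction Ω φ →
      ∫ x in Ω, u x • gradient φ x = - ∫ x in Ω, φ x • g x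

/-- `u ∈ W^{1,q}(Ω)`, for `1 ≤ q`. -/
def MemW1 (Ω : Set Plane) (q : ℝ) (u : Plane → ℝ) : Prop :=
  MemLp u (ENNReal.ofReal q) (volume.restrict Ω) ∧
    ∃ g : Plane → Plane, HasWeakGradient Ω u g ∧ MemLp g (ENNReal.ofReal q) (volume.restrict Ω)

/-- `w ∈ W^{1,1}_0(Ω)`: `w` is a limit of test functions in the norm of `W^{1,1}(Ω)`. -/
def MemW11Zero (Ω : Set Plane) (w : Plane → ℝ) : Prop :=
  MemW1 Ω 1 w ∧
    ∃ h : Plane → Plane, HasWeakGradient Ω w h ∧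
      ∃ φ : ℕ → Plane → ℝ, (∀ k, IsTestFunction Ω (φ k)) ∧
        Tendsto (fun k => eLpNorm (fun x => w x - φ k x) 1 (volume.restrict Ω)) atTop (𝓝 0) ∧
        Tendsto (fun k => eLpNorm (fun x => h x - gradient (φ k) x) 1 (volume.restrict Ω))
          atTop (𝓝 0)

/-- The coefficient `σ` belongs to `L^∞(Ω; {σ₁, σ₂})`. -/
def IsTwoPhase (Ω : Set Plane) (σ₁ σ₂ : Matrix (Fin 2) (Fin 2) ℝ)
    (σ : Plane → Matrix (Fin 2) (Fin 2) ℝ) : Prop :=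
  (∀ i j, AEMeasurable (fun x => σ x i j) (volume.restrict Ω)) ∧
    ∀ᵐ x ∂(volume.restrict Ω), σ x = σ₁ ∨ σ x = σ₂

/-- `u ∈ W^{1,1}(Ω)` solves `div (σ ∇u) = 0` in `Ω` in the sense of distributions. -/
def IsDistributionalSolution (Ω : Set Plane) (σ : Plane → Matrix (Fin 2) (Fin 2) ℝ)
    (u : Plane → ℝ) : Prop :=
  MemW1 Ω 1 u ∧
    ∃ g : Plane → Plane, HasWeakGradient Ω u g ∧
      ∀ φ : Plane → ℝ, IsTestFunction Ω φ →
        Integrable (fun x => inner ℝ (Matrix.toEuclideanLin (σ x) (g x)) (gradient φ x))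
          (volume.restrict Ω) ∧
        ∫ x in Ω, inner ℝ (Matrix.toEuclideanLin (σ x) (g x)) (gradient φ x) = 0

/-- The quasinorm `[f]_p = (sup_{t > 0} t ^ p |{x ∈ Ω : |f x| > t}|) ^ (1 / p)`. -/
def weakLpQuasinorm (Ω : Set Plane) (p : ℝ) (f : Plane → Plane) : ℝ≥0∞ :=
  (⨆ t : Set.Ioi (0 : ℝ),
    ENNReal.ofReal ((t : ℝ) ^ p) * volume.restrict Ω {x | (t : ℝ) < ‖f x‖}) ^ (1 / p)

/-- `f ∈ L^p_weak(Ω; ℝ²)`. -/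
def MemWeakLp (Ω : Set Plane) (p : ℝ) (f : Plane → Plane) : Prop :=
  AEStronglyMeasurable f (volume.restrict Ω) ∧ weakLpQuasinorm Ω p f < ∞

end TwoPhase

end

/-! If `w` is smooth and `u = ∂₀w`, then the field `(-S₂ ∂₁∂₁w, S₂ ∂₀∂₁w)` is divergence free. So
one looks for a limit `w` of smooth functions whose second derivatives lie almost everywhere in
the set of matrices for which this field is `σ₂∇u`, or is `σ₁∇u` with `∂₀∂₁w = 0`.

Start from a quadratic polynomial and split its second derivative along rank one lines, with small
perturbations localized in balls, into a matrix of that set and one on a staircase of diagonal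
matrices. Each splitting multiplies the norm on the staircase by `ρ > 1` and keeps a volume fraction
`keep K ρ`, so the average of `‖A‖ ^ s` is multiplied by `keep K ρ * ρ ^ s`, where `log (keep K ρ *
ρ ^ s) ≈ (s - 2K/(K+1)) (ρ - 1)` near `ρ = 1`. For `p < 2K/(K+1)` a suitable `ρ` makes the
`p`-averages decay geometrically, hence the second derivatives converge in `L^p`, while the averages
for the critical exponent `q = 2K/(K+1)` still grow geometrically. The small errors in the
splittings move matrices off the staircase; the functional `cost` pays for bringing them back.

The blow-up survives in the limit because of convexity: the energy of `∂₀u` can decrease only by the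
product of the uniform size of the perturbation of `u` with a constant depending on the preceding
approximation, and this product is made small in every step. -/

noncomputable section

namespace TwoPhase

/-- Smooth real functions on the plane. -/
abbrev Smooth (f : Plane → ℝ) : Prop := ContDiff ℝ ((⊤ : ℕ∞) : WithTop ℕ∞) f

/-- The `i`-th partial derivative. -/
def pd (i : Fin 2) (f : Plane → ℝ) (x : Plane) : ℝ := fderiv ℝ f x (EuclideanSpace.single i 1)

lemma Smooth.differentiable {f : Plane → ℝ} (hf : Smooth f) : Differentiable ℝ f :=
  ContDiff.differentiable hf (by simp)

lemma Smooth.pd {f : Plane → ℝ} (hf : Smooth f) (i : Fin 2) : Smooth (pd i f) :=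
  (ContDiff.fderiv_right hf (m := ((⊤ : ℕ∞) : WithTop ℕ∞)) (by simp)).clm_apply contDiff_const

lemma pd_add {f g : Plane → ℝ} (hf : Differentiable ℝ f) (hg : Differentiable ℝ g) (i : Fin 2) :
    pd i (fun x => f x + g x) = fun x => pd i f x + pd i g x := by
  ext x
  simp [pd, fderiv_fun_add (hf x) (hg x)]

lemma pd_sub {f g : Plane → ℝ} (hf : Differentiable ℝ f) (hg : Differentiable ℝ g) (i : Fin 2) :
    pd i (fun x => f x - g x) = fun x => pd i f x - pd i g x := by
  ext x
  simp [pd, fderiv_fun_sub (hf x) (hg x)]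

lemma pd_mul {f g : Plane → ℝ} (hf : Differentiable ℝ f) (hg : Differentiable ℝ g) (i : Fin 2) :
    pd i (fun x => f x * g x) = fun x => pd i f x * g x + f x * pd i g x := by
  ext x
  simp [pd, fderiv_fun_mul (hf x) (hg x)]
  ring

lemma pd_const (c : ℝ) (i : Fin 2) : pd i (fun _ => c) = fun _ => 0 := by
  ext x
  simp [pd]

lemma pd_sum {ι : Type*} (s : Finset ι) {f : ι → Plane → ℝ} (hf : ∀ k ∈ s, Differentiable ℝ (f k))
    (i : Fin 2) : pd i (fun x => ∑ k ∈ s, f k x) = fun x => ∑ k ∈ s, pd i (f k) x := by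
  ext x
  simp [pd, fderiv_fun_sum fun k hk => hf k hk x]

lemma pd_pd_apply {f : Plane → ℝ} (hf : Smooth f) (i j : Fin 2) (x : Plane) :
    pd i (pd j f) x =
      fderiv ℝ (fderiv ℝ f) x (EuclideanSpace.single i 1) (EuclideanSpace.single j 1) := by
  have hd : DifferentiableAt ℝ (fderiv ℝ f) x :=
    (hf.fderiv_right (m := ((⊤ : ℕ∞) : WithTop ℕ∞)) (by simp)).differentiable (by simp) x
  change fderiv ℝ (fun y => fderiv ℝ f y (EuclideanSpace.single j 1)) x _ = _
  simp [fderiv_clm_apply hd (differentiableAt_const _)]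

lemma pd_comm {f : Plane → ℝ} (hf : Smooth f) (i j : Fin 2) : pd i (pd j f) = pd j (pd i f) := by
  ext x
  rw [pd_pd_apply hf, pd_pd_apply hf]
  exact (hf.contDiffAt.isSymmSndFDerivAt (by
    rw [minSmoothness_of_isRCLikeNormedField]
    exact WithTop.coe_le_coe.2 le_top)).eq _ _

lemma gradient_apply (f : Plane → ℝ) (x : Plane) (i : Fin 2) : gradient f x i = pd i f x := by
  have h : inner ℝ (gradient f x) (EuclideanSpace.single i (1 : ℝ)) = pd i f x := by
    simp only [gradient, pd, InnerProductSpace.toDual_symm_apply]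
  rw [← h, EuclideanSpace.inner_single_right]
  simp

lemma gradient_sub {f g : Plane → ℝ} (hf : Differentiable ℝ f) (hg : Differentiable ℝ g) :
    gradient (f - g) = gradient f - gradient g := by
  ext x i
  have hpd : pd i (f - g) x = pd i f x - pd i g x := congrFun (pd_sub hf hg i) x
  rw [Pi.sub_apply, PiLp.sub_apply, gradient_apply, gradient_apply, gradient_apply, hpd]

lemma abs_apply_le_norm (x : Plane) (i : Fin 2) : |x i| ≤ ‖x‖ := by
  simpa using PiLp.norm_apply_le x i

lemma fderiv_apply_eq (f : Plane → ℝ) (x v : Plane) :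
    fderiv ℝ f x v = v 0 * pd 0 f x + v 1 * pd 1 f x := by
  have hv : v = v 0 • EuclideanSpace.single (0 : Fin 2) (1 : ℝ) +
      v 1 • EuclideanSpace.single (1 : Fin 2) (1 : ℝ) := by
    ext i
    fin_cases i <;> simp
  conv_lhs => rw [hv]
  simp [pd]

lemma norm_fderiv_le (f : Plane → ℝ) (x : Plane) : ‖fderiv ℝ f x‖ ≤ |pd 0 f x| + |pd 1 f x| := by
  refine ContinuousLinearMap.opNorm_le_bound _ (by positivity) fun v => ?_
  calc ‖fderiv ℝ f x v‖ ≤ |v 0| * |pd 0 f x| + |v 1| * |pd 1 f x| := by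
        rw [fderiv_apply_eq, Real.norm_eq_abs, ← abs_mul, ← abs_mul]
        exact abs_add_le _ _
    _ ≤ ‖v‖ * |pd 0 f x| + ‖v‖ * |pd 1 f x| := by gcongr <;> exact abs_apply_le_norm v _
    _ = (|pd 0 f x| + |pd 1 f x|) * ‖v‖ := by ring

lemma pd_eq_zero_of_notMem {f : Plane → ℝ} {x : Plane} (h : x ∉ tsupport f) (i : Fin 2) :
    pd i f x = 0 := by
  simp [pd, fderiv_of_notMem_tsupport ℝ h]

lemma tsupport_pd_subset (f : Plane → ℝ) (i : Fin 2) : tsupport (pd i f) ⊆ tsupport f :=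
  closure_minimal (fun _ hx => by_contra fun h => hx (pd_eq_zero_of_notMem h i))
    (isClosed_tsupport f)

lemma hasCompactSupport_pd {f : Plane → ℝ} (hf : HasCompactSupport f) (i : Fin 2) :
    HasCompactSupport (pd i f) :=
  hf.mono' ((subset_tsupport _).trans (tsupport_pd_subset f i))

lemma IsTestFunction.pd {Ω : Set Plane} {f : Plane → ℝ} (hf : IsTestFunction Ω f) (i : Fin 2) :
    IsTestFunction Ω (pd i f) :=
  ⟨Smooth.pd hf.1 i, hasCompactSupport_pd hf.2.1 i, (tsupport_pd_subset f i).trans hf.2.2⟩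

lemma IsTestFunction.zero (Ω : Set Plane) : IsTestFunction Ω (fun _ => 0) :=
  ⟨contDiff_const, HasCompactSupport.zero, by simp [tsupport]⟩

lemma IsTestFunction.add {Ω : Set Plane} {f g : Plane → ℝ} (hf : IsTestFunction Ω f)
    (hg : IsTestFunction Ω g) : IsTestFunction Ω (fun x => f x + g x) :=
  ⟨hf.1.add hg.1, hf.2.1.add hg.2.1, (tsupport_add f g).trans (Set.union_subset hf.2.2 hg.2.2)⟩

lemma IsTestFunction.sum {Ω : Set Plane} {ι : Type*} (s : Finset ι) {f : ι → Plane → ℝ}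
    (hf : ∀ k ∈ s, IsTestFunction Ω (f k)) : IsTestFunction Ω (fun x => ∑ k ∈ s, f k x) := by
  classical
  induction s using Finset.induction_on with
  | empty => simpa using IsTestFunction.zero Ω
  | insert a s ha ih =>
    simp only [Finset.sum_insert ha]
    exact (hf a (by simp)).add (ih fun k hk => hf k (by simp [hk]))

lemma integral_mul_pd {f g : Plane → ℝ} (hf : ContDiff ℝ 1 f) (hg : ContDiff ℝ 1 g)
    (hc : HasCompactSupport g) (i : Fin 2) :
    ∫ x, f x * pd i g x = - ∫ x, pd i f x * g x := by
  have cf : Continuous (pd i f) := (hf.continuous_fderiv (by simp)).clm_apply continuous_const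
  have cg : Continuous (pd i g) := (hg.continuous_fderiv (by simp)).clm_apply continuous_const
  refine integral_mul_fderiv_eq_neg_fderiv_mul_of_integrable ?_ ?_ ?_ ?_ ?_
  · exact (cf.mul hg.continuous).integrable_of_hasCompactSupport hc.mul_left
  · exact (hf.continuous.mul cg).integrable_of_hasCompactSupport
      (hasCompactSupport_pd hc i).mul_left
  · exact (hf.continuous.mul hg.continuous).integrable_of_hasCompactSupport hc.mul_left
  · exact fun x _ => hf.differentiable (by simp) x
  · exact fun x _ => hg.differentiable (by simp) x

lemma integral_pd_eq_zero {g : Plane → ℝ} (hg : ContDiff ℝ 1 g) (hc : HasCompactSupport g)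
    (i : Fin 2) : ∫ x, pd i g x = 0 := by
  simpa [pd_const] using integral_mul_pd (f := fun _ => 1) contDiff_const hg hc i

lemma hasFDerivAt_coord (i : Fin 2) (x : Plane) :
    HasFDerivAt (fun y : Plane => y i) (EuclideanSpace.proj i : Plane →L[ℝ] ℝ) x :=
  (EuclideanSpace.proj i : Plane →L[ℝ] ℝ).hasFDerivAt

lemma pd_comp_inner {g : ℝ → ℝ} (hg : Differentiable ℝ g) (n c : Plane) (i : Fin 2) :
    pd i (fun x => g (inner ℝ n (x - c))) = fun x => n i * deriv g (inner ℝ n (x - c)) := by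
  ext x
  have hinner : HasFDerivAt (fun x : Plane => inner ℝ n (x - c)) (innerSL ℝ n) x := by
    simpa [inner_sub_right] using (innerSL ℝ n).hasFDerivAt.sub_const (inner ℝ n c)
  have hcomp : HasFDerivAt (fun x : Plane => g (inner ℝ n (x - c)))
      (deriv g (inner ℝ n (x - c)) • innerSL ℝ n) x :=
    (hg (inner ℝ n (x - c))).hasDerivAt.comp_hasFDerivAt x hinner
  simp [pd, hcomp.fderiv, EuclideanSpace.inner_single_right, mul_comm]

lemma pd_comp_scale {g : Plane → ℝ} (hg : Differentiable ℝ g) (s : ℝ) (x₀ : Plane) (i : Fin 2) :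
    pd i (fun x => g (s • (x - x₀))) = fun x => s * pd i g (s • (x - x₀)) := by
  ext x
  have hscale :
      HasFDerivAt (fun x : Plane => s • (x - x₀)) (s • ContinuousLinearMap.id ℝ Plane) x :=
    ((hasFDerivAt_id x).sub_const _).const_smul s
  have hcomp : HasFDerivAt (fun x => g (s • (x - x₀)))
      ((fderiv ℝ g (s • (x - x₀))).comp (s • ContinuousLinearMap.id ℝ Plane)) x :=
    (hg (s • (x - x₀))).hasFDerivAt.comp x hscale
  simp [pd, hcomp.fderiv]

/-- The quadratic polynomial with value `e`, gradient `(c₀, c₁)` and second derivatives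
`a = ∂₀∂₀`, `b = ∂₀∂₁`, `d = ∂₁∂₁` at `x₀`. -/
def quad (x₀ : Plane) (e c₀ c₁ a b d : ℝ) (x : Plane) : ℝ :=
  e + c₀ * (x 0 - x₀ 0) + c₁ * (x 1 - x₀ 1) + a / 2 * (x 0 - x₀ 0) ^ 2
    + b * ((x 0 - x₀ 0) * (x 1 - x₀ 1)) + d / 2 * (x 1 - x₀ 1) ^ 2

lemma hasFDerivAt_quad (x₀ : Plane) (e c₀ c₁ a b d : ℝ) (x : Plane) :
    HasFDerivAt (quad x₀ e c₀ c₁ a b d)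
      ((c₀ + a * (x 0 - x₀ 0) + b * (x 1 - x₀ 1)) • (EuclideanSpace.proj 0 : Plane →L[ℝ] ℝ)
       + (c₁ + b * (x 0 - x₀ 0) + d * (x 1 - x₀ 1)) • (EuclideanSpace.proj 1 : Plane →L[ℝ] ℝ))
      x := by
  have h0 := (hasFDerivAt_coord 0 x).sub_const (x₀ 0)
  have h1 := (hasFDerivAt_coord 1 x).sub_const (x₀ 1)
  have h := (((((h0.const_mul c₀).const_add e).add (h1.const_mul c₁)).add
    ((h0.pow 2).const_mul (a / 2))).add ((h0.mul h1).const_mul b)).add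
    ((h1.pow 2).const_mul (d / 2))
  refine h.congr_fderiv ?_
  ext v
  simp
  ring

lemma smooth_quad (x₀ : Plane) (e c₀ c₁ a b d : ℝ) : Smooth (quad x₀ e c₀ c₁ a b d) := by
  have hcoord (i : Fin 2) : Smooth (fun y => y i) :=
    (EuclideanSpace.proj i : Plane →L[ℝ] ℝ).contDiff
  have hsub (i : Fin 2) : Smooth (fun y => y i - x₀ i) := (hcoord i).sub contDiff_const
  exact (((((contDiff_const.add (contDiff_const.mul (hsub 0))).add
    (contDiff_const.mul (hsub 1))).add (contDiff_const.mul ((hsub 0).pow 2))).add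
    (contDiff_const.mul ((hsub 0).mul (hsub 1)))).add (contDiff_const.mul ((hsub 1).pow 2)))

lemma pd_zero_quad (x₀ : Plane) (e c₀ c₁ a b d : ℝ) :
    pd 0 (quad x₀ e c₀ c₁ a b d) = quad x₀ c₀ a b 0 0 0 := by
  ext x
  simp [pd, (hasFDerivAt_quad x₀ e c₀ c₁ a b d x).fderiv, quad]

lemma pd_one_quad (x₀ : Plane) (e c₀ c₁ a b d : ℝ) :
    pd 1 (quad x₀ e c₀ c₁ a b d) = quad x₀ c₁ b d 0 0 0 := by
  ext x
  simp [pd, (hasFDerivAt_quad x₀ e c₀ c₁ a b d x).fderiv, quad]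

/-- The second derivatives `(∂₀∂₀w, ∂₀∂₁w, m ∂₁∂₁w)`. With `u = ∂₀w`, the first two entries are
`∇u`, and the last two give the divergence free field `(-m ∂₁∂₁w, m ∂₀∂₁w)`. -/
def hess (m : ℝ) (w : Plane → ℝ) (x : Plane) : ℝ × ℝ × ℝ :=
  (pd 0 (pd 0 w) x, pd 1 (pd 0 w) x, m * pd 1 (pd 1 w) x)

lemma continuous_hess {m : ℝ} {w : Plane → ℝ} (hw : Smooth w) : Continuous (hess m w) :=
  ((hw.pd 0).pd 0).continuous.prodMk
    (((hw.pd 0).pd 1).continuous.prodMk (continuous_const.mul ((hw.pd 1).pd 1).continuous))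

lemma hess_add {m : ℝ} {f g : Plane → ℝ} (hf : Smooth f) (hg : Smooth g) :
    hess m (fun x => f x + g x) = fun x => hess m f x + hess m g x := by
  ext1 x
  simp only [hess, pd_add hf.differentiable hg.differentiable,
    pd_add (hf.pd 0).differentiable (hg.pd 0).differentiable,
    pd_add (hf.pd 1).differentiable (hg.pd 1).differentiable, Prod.mk_add_mk, mul_add]

lemma hess_sum {m : ℝ} {ι : Type*} (s : Finset ι) {f : ι → Plane → ℝ}
    (hf : ∀ k ∈ s, Smooth (f k)) :
    hess m (fun x => ∑ k ∈ s, f k x) = fun x => ∑ k ∈ s, hess m (f k) x := by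
  ext1 x
  simp only [hess, pd_sum s fun k hk => (hf k hk).differentiable,
    pd_sum s fun k hk => ((hf k hk).pd 0).differentiable,
    pd_sum s fun k hk => ((hf k hk).pd 1).differentiable]
  refine Prod.ext ?_ (Prod.ext ?_ ?_) <;> simp [Prod.fst_sum, Prod.snd_sum, Finset.mul_sum]

lemma hess_quad (m : ℝ) (x₀ : Plane) (e c₀ c₁ a b d : ℝ) (x : Plane) :
    hess m (quad x₀ e c₀ c₁ a b d) x = (a, b, m * d) := by
  simp [hess, pd_zero_quad, pd_one_quad, quad]

lemma hess_const (m c : ℝ) (x : Plane) : hess m (fun _ => c) x = 0 := by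
  simp [hess, pd_const]

lemma hess_eq_zero_of_notMem {m : ℝ} {f : Plane → ℝ} {x : Plane} (h : x ∉ tsupport f) :
    hess m f x = 0 := by
  have hpd : ∀ i, x ∉ tsupport (pd i f) := fun i hx => h (tsupport_pd_subset f i hx)
  simp [hess, pd_eq_zero_of_notMem (hpd 0), pd_eq_zero_of_notMem (hpd 1)]

/-- A smooth approximation, of sharpness `j`, of the indicator of `{v | 0 < v}`. -/
def softStep (j : ℕ) (v : ℝ) : ℝ := Real.smoothTransition (v * (j + 1))

lemma contDiff_softStep (j : ℕ) : ContDiff ℝ ((⊤ : ℕ∞) : WithTop ℕ∞) (softStep j) :=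
  Real.smoothTransition.contDiff.comp (contDiff_id.mul contDiff_const)

lemma softStep_eventually_eq (v : ℝ) : ∀ᶠ j in atTop, softStep j v = if 0 < v then 1 else 0 := by
  split_ifs with hv
  · filter_upwards [eventually_ge_atTop ⌈v⁻¹⌉₊] with j hj
    refine Real.smoothTransition.one_of_one_le ?_
    calc (1 : ℝ) = v * v⁻¹ := (mul_inv_cancel₀ hv.ne').symm
      _ ≤ v * (j + 1) := by gcongr; linarith [Nat.ceil_le.1 hj]
  · exact Eventually.of_forall fun j => Real.smoothTransition.zero_of_nonpos
      (mul_nonpos_of_nonpos_of_nonneg (not_lt.1 hv) (by positivity))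

/-- A smooth `1`-periodic profile which is close, for large `j`, to the indicator of
`|s| < l / 2` on `|s| ≤ 1 / 2`. -/
def pulse (l : ℝ) (j : ℕ) (s : ℝ) : ℝ :=
  softStep j (Real.cos (2 * Real.pi * s) - Real.cos (Real.pi * l))

lemma contDiff_pulse (l : ℝ) (j : ℕ) : ContDiff ℝ ((⊤ : ℕ∞) : WithTop ℕ∞) (pulse l j) :=
  (contDiff_softStep j).comp
    ((Real.contDiff_cos.comp (contDiff_const.mul contDiff_id)).sub contDiff_const)

lemma pulse_nonneg (l : ℝ) (j : ℕ) (s : ℝ) : 0 ≤ pulse l j s := Real.smoothTransition.nonneg _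

lemma pulse_le_one (l : ℝ) (j : ℕ) (s : ℝ) : pulse l j s ≤ 1 := Real.smoothTransition.le_one _

lemma pulse_periodic (l : ℝ) (j : ℕ) : Function.Periodic (pulse l j) 1 := by
  intro s
  simp [pulse, mul_add]

lemma cos_lt_cos_iff_abs {l s : ℝ} (hl : 0 < l) (hl1 : l < 1) (hs : |s| ≤ 1 / 2) :
    Real.cos (Real.pi * l) < Real.cos (2 * Real.pi * s) ↔ |s| < l / 2 := by
  have hpi := Real.pi_pos
  have habs : Real.cos (2 * Real.pi * s) = Real.cos (2 * Real.pi * |s|) := by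
    rw [← Real.cos_abs, abs_mul, abs_of_pos (by positivity : 0 < 2 * Real.pi)]
  rw [habs, Real.strictAntiOn_cos.lt_iff_gt ⟨by positivity, by nlinarith⟩
    ⟨by positivity, by nlinarith⟩]
  constructor <;> intro h <;> nlinarith

lemma pulse_eventually_eq_indicator {l s : ℝ} (hl : 0 < l) (hl1 : l < 1) (hs : |s| ≤ 1 / 2) :
    ∀ᶠ j in atTop, pulse l j s = (Set.Ioo (-(l / 2)) (l / 2)).indicator (fun _ => (1 : ℝ)) s := by
  filter_upwards [softStep_eventually_eq (Real.cos (2 * Real.pi * s) - Real.cos (Real.pi * l))]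
    with j hj
  simp only [pulse, hj, sub_pos, cos_lt_cos_iff_abs hl hl1 hs, abs_lt, Set.indicator_apply,
    Set.mem_Ioo]

lemma tendsto_integral_pulse {l : ℝ} (hl : 0 < l) (hl1 : l < 1) :
    Tendsto (fun j => ∫ s in (0 : ℝ)..1, pulse l j s) atTop (𝓝 l) := by
  have hshift (j : ℕ) :
      ∫ s in (0 : ℝ)..1, pulse l j s = ∫ s in (-(1 / 2) : ℝ)..(1 / 2), pulse l j s := by
    convert (pulse_periodic l j).intervalIntegral_add_eq 0 (-(1 / 2)) using 2 <;> norm_num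
  have hlimit : ∫ s in (-(1 / 2) : ℝ)..(1 / 2),
      (Set.Ioo (-(l / 2)) (l / 2)).indicator (fun _ => (1 : ℝ)) s = l := by
    rw [intervalIntegral.integral_of_le (by norm_num), integral_indicator measurableSet_Ioo,
      Measure.restrict_restrict measurableSet_Ioo, Set.inter_eq_left.2]
    · simp [hl.le]
    · exact fun s hs => ⟨by linarith [hs.1], by linarith [hs.2]⟩
  simp_rw [hshift]
  refine Tendsto.mono_right ?_ (congrArg 𝓝 hlimit).le
  refine intervalIntegral.tendsto_integral_filter_of_dominated_convergence (fun _ => 1) ?_ ?_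
    (by simp) ?_
  · exact Eventually.of_forall fun j => (contDiff_pulse l j).continuous.aestronglyMeasurable
  · refine Eventually.of_forall fun j => Eventually.of_forall fun s _ => ?_
    rw [Real.norm_eq_abs, abs_of_nonneg (pulse_nonneg l j s)]
    exact pulse_le_one l j s
  · refine Eventually.of_forall fun s hs => ?_
    rw [Set.uIoc_of_le (by norm_num)] at hs
    exact tendsto_nhds_of_eventually_eq
      (pulse_eventually_eq_indicator hl hl1 (abs_le.2 ⟨hs.1.le, hs.2⟩))

lemma tendsto_measure_pulse_transition (ν : Measure ℝ) [IsFiniteMeasure ν] (l τ : ℝ) :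
    Tendsto (fun j => ν {t | pulse l j (t / τ) ≠ 1 ∧ pulse l j (t / τ) ≠ 0}) atTop (𝓝 0) := by
  rw [← measure_empty (μ := ν)]
  refine tendsto_measure_of_tendsto_indicator_of_isFiniteMeasure atTop ν (fun j => ?_)
    fun t => ?_
  · have hcont : Continuous fun t => pulse l j (t / τ) :=
      (contDiff_pulse l j).continuous.comp (continuous_id.div_const τ)
    exact (isOpen_ne_fun hcont continuous_const).measurableSet.inter
      (isOpen_ne_fun hcont continuous_const).measurableSet
  · filter_upwards [softStep_eventually_eq
      (Real.cos (2 * Real.pi * (t / τ)) - Real.cos (Real.pi * l))] with j hj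
    simp only [pulse, hj, Set.mem_empty_iff_false, iff_false]
    split_ifs <;> simp

lemma abs_integral_le_of_periodic {f : ℝ → ℝ} {C : ℝ} (hf : Continuous f)
    (hper : Function.Periodic f 1) (hC : ∀ s, |f s| ≤ C) (hmean : ∫ s in (0 : ℝ)..1, f s = 0)
    (t : ℝ) : |∫ s in (0 : ℝ)..t, f s| ≤ C := by
  have hfract : ∫ s in (0 : ℝ)..t, f s = ∫ s in (0 : ℝ)..(Int.fract t), f s := by
    have hperiods := hper.intervalIntegral_add_zsmul_eq ⌊t⌋ (Int.fract t)
      fun a b => hf.intervalIntegrable a b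
    rw [hper.intervalIntegral_add_eq (Int.fract t) 0, zero_add, hmean, smul_zero, zsmul_one,
      Int.fract_add_floor] at hperiods
    rw [← intervalIntegral.integral_add_adjacent_intervals (hf.intervalIntegrable 0 (Int.fract t))
      (hf.intervalIntegrable _ t), hperiods, add_zero]
  have hbound := intervalIntegral.norm_integral_le_of_norm_le_const (a := 0) (b := Int.fract t)
    (f := f) fun s _ => hC s
  rw [sub_zero, abs_of_nonneg (Int.fract_nonneg t)] at hbound
  rw [hfract]
  exact hbound.trans (mul_le_of_le_one_right ((abs_nonneg _).trans (hC 0)) (Int.fract_lt_one t).le)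

lemma abs_integral_pulse_sub_mean_le (l : ℝ) (j : ℕ) (t : ℝ) :
    |∫ s in (0 : ℝ)..t, (pulse l j s - ∫ r in (0 : ℝ)..1, pulse l j r)| ≤ 1 := by
  have hcont : Continuous (pulse l j) := (contDiff_pulse l j).continuous
  have hint : IntervalIntegrable (pulse l j) volume 0 1 := hcont.intervalIntegrable 0 1
  have hmean0 : 0 ≤ ∫ r in (0 : ℝ)..1, pulse l j r :=
    intervalIntegral.integral_nonneg zero_le_one fun s _ => pulse_nonneg l j s
  have hmean1 : ∫ r in (0 : ℝ)..1, pulse l j r ≤ 1 := by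
    simpa using intervalIntegral.integral_mono_on zero_le_one hint
      (intervalIntegrable_const (c := (1 : ℝ))) fun s _ => pulse_le_one l j s
  refine abs_integral_le_of_periodic (f := fun s => pulse l j s - ∫ r in (0 : ℝ)..1, pulse l j r)
    (hcont.sub continuous_const) (fun s => by simp only [pulse_periodic l j s]) (fun s => ?_) ?_ t
  · rw [abs_le]
    constructor <;> linarith [pulse_nonneg l j s, pulse_le_one l j s]
  · rw [intervalIntegral.integral_sub hint intervalIntegrable_const]
    simp

lemma abs_mul_sub_le_max {x y z : ℝ} (hz : z ∈ Set.Icc 0 1) :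
    |z * x - (1 - z) * y| ≤ max |x| |y| := by
  have hz' : 0 ≤ 1 - z := sub_nonneg.2 hz.2
  calc |z * x - (1 - z) * y| ≤ |z * x| + |(1 - z) * y| := abs_sub _ _
    _ = z * |x| + (1 - z) * |y| := by rw [abs_mul, abs_mul, abs_of_nonneg hz.1, abs_of_nonneg hz']
    _ ≤ z * max |x| |y| + (1 - z) * max |x| |y| :=
        add_le_add (mul_le_mul_of_nonneg_left (le_max_left _ _) hz.1)
          (mul_le_mul_of_nonneg_left (le_max_right _ _) hz')
    _ = max |x| |y| := by ring

lemma add_ne_zero_of_mul_pos {x y : ℝ} (hxy : 0 < x * y) : x + y ≠ 0 := fun h => by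
  rw [eq_neg_of_add_eq_zero_left h] at hxy
  nlinarith [sq_nonneg y]

lemma div_add_mem_Ioo_of_mul_pos {x y : ℝ} (hxy : 0 < x * y) : y / (x + y) ∈ Set.Ioo 0 1 := by
  have hadd := add_ne_zero_of_mul_pos hxy
  have hleft : y / (x + y) = (x * y + y ^ 2) / (x + y) ^ 2 := by field_simp
  have hright : 1 - y / (x + y) = (x * y + x ^ 2) / (x + y) ^ 2 := by field_simp; ring
  refine ⟨hleft ▸ by positivity, sub_pos.1 (hright ▸ by positivity)⟩

lemma exists_contDiff_deriv_eq {G h : ℝ → ℝ} (hG : ∀ t, HasDerivAt G (h t) t)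
    (hh : ContDiff ℝ ((⊤ : ℕ∞) : WithTop ℕ∞) h) :
    ∃ g : ℝ → ℝ, ContDiff ℝ ((⊤ : ℕ∞) : WithTop ℕ∞) g ∧ g 0 = 0 ∧ deriv g = G ∧
      deriv (deriv g) = h := by
  have hdG : deriv G = h := funext fun t => (hG t).deriv
  have hcont : Continuous G := continuous_iff_continuousAt.2 fun t => (hG t).continuousAt
  have hg (t : ℝ) : HasDerivAt (fun t => ∫ s in (0 : ℝ)..t, G s) (G t) t :=
    (hcont.integral_hasStrictDerivAt 0 t).hasDerivAt
  have hdg : deriv (fun t => ∫ s in (0 : ℝ)..t, G s) = G := funext fun t => (hg t).deriv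
  refine ⟨fun t => ∫ s in (0 : ℝ)..t, G s, ?_, by simp, hdg, by rw [hdg, hdG]⟩
  rw [contDiff_infty_iff_deriv, hdg, contDiff_infty_iff_deriv, hdG]
  exact ⟨fun t => (hg t).differentiableAt, fun t => (hG t).differentiableAt, hh⟩

lemma abs_le_of_abs_deriv_le {g : ℝ → ℝ} {ε : ℝ} (hg : Differentiable ℝ g) (h0 : g 0 = 0)
    (hderiv : ∀ t, |t| ≤ 1 → |deriv g t| ≤ ε) {t : ℝ} (ht : |t| ≤ 1) : |g t| ≤ ε := by
  have hε : 0 ≤ ε := (abs_nonneg _).trans (hderiv t ht)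
  have hlip := (convex_Icc (-1 : ℝ) 1).norm_image_sub_le_of_norm_deriv_le
    (fun s _ => hg s) (fun s hs => hderiv s (abs_le.2 hs)) (x := 0) (y := t)
    ⟨by norm_num, by norm_num⟩ (abs_le.1 ht)
  rw [h0, sub_zero, sub_zero] at hlip
  exact hlip.trans (mul_le_of_le_one_right hε ht)

/-- `g` has size at most `ε` in `C¹([-1, 1])`, its second derivative is bounded by `max |x| |y|`,
and takes only the values `x` and `-y` outside a set of `ν`-measure `ε`. -/
structure IsOscillation (ν : Measure ℝ) (x y ε : ℝ) (g : ℝ → ℝ) : Prop where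
  contDiff : ContDiff ℝ ((⊤ : ℕ∞) : WithTop ℕ∞) g
  abs_le : ∀ t, |t| ≤ 1 → |g t| ≤ ε
  abs_deriv_le : ∀ t, |t| ≤ 1 → |deriv g t| ≤ ε
  abs_deriv_deriv_le : ∀ t, |deriv (deriv g) t| ≤ max |x| |y|
  measure_le : ν {t | deriv (deriv g) t ≠ x ∧ deriv (deriv g) t ≠ -y} ≤ ENNReal.ofReal ε

lemma hasDerivAt_pulse_primitive (l : ℝ) (j : ℕ) {τ : ℝ} (hτ : τ ≠ 0) (M β t : ℝ) :
    HasDerivAt (fun t => β * τ * (∫ s in (0 : ℝ)..(t / τ), (pulse l j s - M)) + β * (M - l) * t)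
      (β * (pulse l j (t / τ) - l)) t := by
  have hprim : HasDerivAt (fun t => ∫ s in (0 : ℝ)..t, (pulse l j s - M)) (pulse l j (t / τ) - M)
      (t / τ) :=
    (((contDiff_pulse l j).continuous.sub continuous_const).integral_hasStrictDerivAt
      0 (t / τ)).hasDerivAt
  have hscaled := ((hprim.comp t ((hasDerivAt_id t).div_const τ)).const_mul (β * τ)).add
    ((hasDerivAt_id t).const_mul (β * (M - l)))
  refine hscaled.congr_deriv ?_
  field_simp
  ring

-- `g''` is the affine image of a fast periodic pulse of mean about `l = y / (x + y)` which sends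
-- `1` to `x` and `0` to `-y`.
lemma exists_isOscillation (ν : Measure ℝ) [IsFiniteMeasure ν] {x y : ℝ} (hxy : 0 < x * y)
    {ε : ℝ} (hε : 0 < ε) : ∃ g : ℝ → ℝ, IsOscillation ν x y ε g := by
  set β := x + y with hβ
  set l := y / β with hl
  have hβ0 : β ≠ 0 := add_ne_zero_of_mul_pos hxy
  obtain ⟨hl0, hl1⟩ : l ∈ Set.Ioo 0 1 := div_add_mem_Ioo_of_mul_pos hxy
  have hvalue (z : ℝ) : β * (z - l) = z * x - (1 - z) * y := by
    rw [hl, mul_sub, mul_div_cancel₀ _ hβ0, hβ]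
    ring
  set τ := ε / (2 * |β|) with hτ
  have hτpos : 0 < τ := div_pos hε (mul_pos two_pos (abs_pos.2 hβ0))
  obtain ⟨j, hmean, htrans⟩ := ((((tendsto_integral_pulse hl0 hl1).eventually
    (Metric.ball_mem_nhds l hτpos))).and
    ((tendsto_measure_pulse_transition ν l τ).eventually_lt_const
      (by simpa using hε : 0 < ENNReal.ofReal ε))).exists
  rw [Real.dist_eq] at hmean
  set M := ∫ s in (0 : ℝ)..1, pulse l j s
  obtain ⟨g, hg, hg0, hdg, hddg⟩ := exists_contDiff_deriv_eq
    (hasDerivAt_pulse_primitive l j hτpos.ne' M β) (contDiff_const.mul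
      (((contDiff_pulse l j).comp (contDiff_id.div_const τ)).sub contDiff_const))
  have hderiv (t : ℝ) (ht : |t| ≤ 1) : |deriv g t| ≤ ε := by
    rw [hdg]
    calc _ ≤ |β| * τ * |∫ s in (0 : ℝ)..(t / τ), (pulse l j s - M)| + |β| * |M - l| * |t| := by
          rw [← abs_of_pos hτpos, ← abs_mul, ← abs_mul, ← abs_mul, ← abs_mul, abs_of_pos hτpos]
          exact abs_add_le _ _
      _ ≤ |β| * τ * 1 + |β| * τ * 1 := by
          gcongr
          exact abs_integral_pulse_sub_mean_le l j (t / τ)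
      _ = ε := by rw [hτ]; field_simp; ring
  refine ⟨g, hg, fun t => abs_le_of_abs_deriv_le (hg.differentiable (by simp)) hg0 hderiv, hderiv,
    fun t => ?_, (measure_mono fun t ht => ?_).trans htrans.le⟩
  · simp only [hddg, hvalue]
    exact abs_mul_sub_le_max ⟨pulse_nonneg .., pulse_le_one ..⟩
  · simp only [hddg, hvalue, Set.mem_ofPred_eq] at ht ⊢
    exact ⟨fun h => ht.1 (by simp [h]), fun h => ht.2 (by simp [h])⟩

/-- A cutoff function between the concentric balls of radii `s r` and `r`, whose derivatives are
bounded by a constant times the natural power of the outer radius. -/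
structure IsCutoff (x₀ : Plane) (s r C : ℝ) (χ : Plane → ℝ) : Prop where
  smooth : Smooth χ
  nonneg : ∀ z, 0 ≤ χ z
  le_one : ∀ z, χ z ≤ 1
  eq_one : ∀ z ∈ Metric.ball x₀ (s * r), χ z = 1
  tsupport_subset : tsupport χ ⊆ Metric.ball x₀ r
  abs_pd_le : ∀ i z, |pd i χ z| ≤ C / r
  abs_pd_pd_le : ∀ i j z, |pd i (pd j χ) z| ≤ C / r ^ 2

lemma exists_abs_pd_le {f : Plane → ℝ} (hf : Smooth f) (hc : HasCompactSupport f) :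
    ∃ C : ℝ, 0 ≤ C ∧ (∀ i z, |pd i f z| ≤ C) ∧ ∀ i j z, |pd i (pd j f) z| ≤ C := by
  let F : Plane → (Fin 2 → ℝ) × (Fin 2 → Fin 2 → ℝ) :=
    fun z => (fun i => pd i f z, fun i j => pd i (pd j f) z)
  have hF : Continuous F := (continuous_pi fun i => (hf.pd i).continuous).prodMk
    (continuous_pi fun i => continuous_pi fun j => ((hf.pd j).pd i).continuous)
  have hFc : HasCompactSupport F := by
    refine HasCompactSupport.intro hc.isCompact fun z hz => Prod.ext ?_ ?_
    · exact funext fun i => pd_eq_zero_of_notMem hz i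
    · exact funext fun i => funext fun j =>
        pd_eq_zero_of_notMem (fun h => hz (tsupport_pd_subset f j h)) i
  obtain ⟨C, hC⟩ := hF.bounded_above_of_compact_support hFc
  refine ⟨C, (norm_nonneg _).trans (hC 0), fun i z => ?_, fun i j z => ?_⟩
  · exact ((norm_le_pi_norm (F z).1 i).trans (norm_fst_le (F z))).trans (hC z)
  · exact (((norm_le_pi_norm ((F z).2 i) j).trans (norm_le_pi_norm (F z).2 i)).trans
      (norm_snd_le (F z))).trans (hC z)

lemma pd_pd_comp_scale {g : Plane → ℝ} (hg : Smooth g) (s : ℝ) (x₀ : Plane) (i j : Fin 2) :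
    pd i (pd j fun x => g (s • (x - x₀))) =
      fun x => s ^ 2 * pd i (pd j g) (s • (x - x₀)) := by
  have hcomp : Differentiable ℝ fun x => pd j g (s • (x - x₀)) :=
    (hg.pd j).differentiable.comp (by fun_prop)
  rw [pd_comp_scale hg.differentiable, pd_mul (differentiable_const _) hcomp, pd_const,
    pd_comp_scale (hg.pd j).differentiable]
  ext x
  simp only [zero_mul, zero_add]
  ring

lemma exists_isCutoff {s : ℝ} (hs : 0 < s) (hs1 : s < 1) :
    ∃ C : ℝ, 0 ≤ C ∧ ∀ (x₀ : Plane) (r : ℝ), 0 < r → ∃ χ : Plane → ℝ, IsCutoff x₀ s r C χ := by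
  let b : ContDiffBump (0 : Plane) := ⟨s, (s + 1) / 2, hs, by linarith⟩
  have hb : Smooth b := b.contDiff
  obtain ⟨C, hC0, hC1, hC2⟩ := exists_abs_pd_le hb b.hasCompactSupport
  refine ⟨C, hC0, fun x₀ r hr => ⟨fun x => b (r⁻¹ • (x - x₀)), ?_⟩⟩
  have hnorm (z : Plane) : ‖r⁻¹ • (z - x₀)‖ = dist z x₀ / r := by
    rw [norm_smul, norm_inv, Real.norm_of_nonneg hr.le, dist_eq_norm, inv_mul_eq_div]
  refine ⟨hb.comp ((contDiff_id.sub contDiff_const).const_smul _), fun z => b.nonneg,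
    fun z => b.le_one, fun z hz => ?_, ?_, fun i z => ?_, fun i j z => ?_⟩
  · refine b.one_of_mem_closedBall (mem_closedBall_zero_iff.2 ?_)
    rw [hnorm, div_le_iff₀ hr]
    exact hz.le
  · have hsupp : tsupport (fun x => b (r⁻¹ • (x - x₀))) ⊆
        Metric.closedBall x₀ ((s + 1) / 2 * r) := by
      refine closure_minimal (fun z hz => ?_) Metric.isClosed_closedBall
      have hz' : r⁻¹ • (z - x₀) ∈ Function.support b := hz
      rw [b.support_eq, mem_ball_zero_iff, hnorm, div_lt_iff₀ hr] at hz'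
      exact hz'.le
    exact hsupp.trans (Metric.closedBall_subset_ball (by nlinarith))
  · rw [pd_comp_scale hb.differentiable, abs_mul, abs_of_pos (inv_pos.2 hr), div_eq_inv_mul]
    gcongr
    exact hC1 i _
  · rw [pd_pd_comp_scale hb, abs_mul, abs_of_pos (by positivity), div_eq_inv_mul, inv_pow]
    gcongr
    exact hC2 i j _

/-- The bounds `|f| ≤ ε r ^ 2` and `|∇f| ≤ ε r` on the ball `B(x₀, r)`, which make the product of
`f` with a cutoff function have small second derivatives wherever those of `f` are small. -/
structure IsFlatOn (f : Plane → ℝ) (x₀ : Plane) (r ε : ℝ) : Prop where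
  abs_le : ∀ z ∈ Metric.ball x₀ r, |f z| ≤ ε * r ^ 2
  abs_pd_le : ∀ i, ∀ z ∈ Metric.ball x₀ r, |pd i f z| ≤ ε * r

lemma IsFlatOn.add {f g : Plane → ℝ} (hf : Smooth f) (hg : Smooth g) {x₀ : Plane} {r ε δ : ℝ}
    (hf' : IsFlatOn f x₀ r ε) (hg' : IsFlatOn g x₀ r δ) :
    IsFlatOn (fun z => f z + g z) x₀ r (ε + δ) where
  abs_le z hz := by
    rw [add_mul]
    exact (abs_add_le _ _).trans (add_le_add (hf'.abs_le z hz) (hg'.abs_le z hz))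
  abs_pd_le i z hz := by
    rw [pd_add hf.differentiable hg.differentiable, add_mul]
    exact (abs_add_le _ _).trans (add_le_add (hf'.abs_pd_le i z hz) (hg'.abs_pd_le i z hz))

lemma abs_le_of_abs_pd_le {f : Plane → ℝ} (hf : Differentiable ℝ f) {x₀ : Plane} {r c : ℝ}
    (h0 : f x₀ = 0) (hc : ∀ i, ∀ z ∈ Metric.ball x₀ r, |pd i f z| ≤ c) {z : Plane}
    (hz : z ∈ Metric.ball x₀ r) : |f z| ≤ 2 * c * r := by
  have hx : x₀ ∈ Metric.ball x₀ r := Metric.mem_ball_self (Metric.pos_of_mem_ball hz)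
  have hcn : 0 ≤ c := (abs_nonneg _).trans (hc 0 x₀ hx)
  have hmvt := (convex_ball x₀ r).norm_image_sub_le_of_norm_fderiv_le (𝕜 := ℝ) (C := 2 * c)
    (fun y _ => hf y)
    (fun y hy => (norm_fderiv_le f y).trans (by linarith [hc 0 y hy, hc 1 y hy])) hx hz
  rw [h0, sub_zero, Real.norm_eq_abs, ← dist_eq_norm] at hmvt
  have hdist : dist z x₀ ≤ r := (Metric.mem_ball.1 hz).le
  exact hmvt.trans (by gcongr)

lemma eventually_isFlatOn {f : Plane → ℝ} (hf : Smooth f) {x₀ : Plane} (h0 : f x₀ = 0)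
    (h1 : ∀ i, pd i f x₀ = 0) (h2 : ∀ i j, pd i (pd j f) x₀ = 0) {ε : ℝ} (hε : 0 < ε) :
    ∀ᶠ r in 𝓝[>] (0 : ℝ), IsFlatOn f x₀ r ε := by
  have hsmall : ∀ᶠ z in 𝓝 x₀, ∀ i j, |pd i (pd j f) z| < ε / 4 := by
    refine eventually_all.2 fun i => eventually_all.2 fun j => ?_
    have hcont : ContinuousAt (fun z => |pd i (pd j f) z|) x₀ :=
      ((hf.pd j).pd i).continuous.abs.continuousAt
    exact hcont.eventually_lt_const (by simp [h2, hε])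
  obtain ⟨r₀, hr₀, hball⟩ := Metric.eventually_nhds_iff_ball.1 hsmall
  filter_upwards [Ioo_mem_nhdsGT hr₀] with r hr
  have hgrad (i : Fin 2) : ∀ z ∈ Metric.ball x₀ r, |pd i f z| ≤ ε / 2 * r := fun z hz =>
    (abs_le_of_abs_pd_le (hf.pd i).differentiable (h1 i)
      (fun j y hy => (hball y (Metric.ball_subset_ball hr.2.le hy) j i).le) hz).trans_eq (by ring)
  refine ⟨fun z hz => ?_, fun i z hz => (hgrad i z hz).trans ?_⟩
  · exact (abs_le_of_abs_pd_le hf.differentiable h0 hgrad hz).trans_eq (by ring)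
  · exact mul_le_mul_of_nonneg_right (by linarith) hr.1.le

section Cutoff

variable {x₀ : Plane} {s r C ε : ℝ} {χ k : Plane → ℝ}

lemma IsCutoff.abs_pd_mul_le (hχ : IsCutoff x₀ s r C χ) (hr : 0 < r) (hk : Smooth k)
    (hflat : IsFlatOn k x₀ r ε) {z : Plane} (hz : z ∈ Metric.ball x₀ r) (i : Fin 2) :
    |pd i (fun z => χ z * k z) z| ≤ (C + 1) * ε * r := by
  have hC : 0 ≤ C / r := (abs_nonneg _).trans (hχ.abs_pd_le 0 z)
  rw [pd_mul hχ.smooth.differentiable hk.differentiable]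
  calc _ ≤ |pd i χ z| * |k z| + |χ z| * |pd i k z| := by
        simp only [← abs_mul]
        exact abs_add_le _ _
    _ ≤ C / r * (ε * r ^ 2) + 1 * (ε * r) := by
        gcongr
        · exact hχ.abs_pd_le i z
        · exact hflat.abs_le z hz
        · exact abs_le.2 ⟨by linarith [hχ.nonneg z], hχ.le_one z⟩
        · exact hflat.abs_pd_le i z hz
    _ = _ := by field_simp

lemma IsCutoff.abs_pd_pd_mul_sub_le (hχ : IsCutoff x₀ s r C χ) (hr : 0 < r) (hk : Smooth k)
    (hflat : IsFlatOn k x₀ r ε) {z : Plane} (hz : z ∈ Metric.ball x₀ r) (i j : Fin 2) :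
    |pd i (pd j (fun z => χ z * k z)) z - χ z * pd i (pd j k) z| ≤ 3 * C * ε := by
  have hχs := hχ.smooth
  have hleibniz : pd i (pd j (fun z => χ z * k z)) z - χ z * pd i (pd j k) z =
      pd i (pd j χ) z * k z + pd j χ z * pd i k z + pd i χ z * pd j k z := by
    rw [pd_mul hχs.differentiable hk.differentiable j,
      pd_add (Smooth.differentiable ((hχs.pd j).mul hk))
        (Smooth.differentiable (hχs.mul (hk.pd j))) i,
      pd_mul (hχs.pd j).differentiable hk.differentiable i,
      pd_mul hχs.differentiable (hk.pd j).differentiable i]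
    ring
  have hC : 0 ≤ C / r := (abs_nonneg _).trans (hχ.abs_pd_le 0 z)
  have hC2 : 0 ≤ C / r ^ 2 := (abs_nonneg _).trans (hχ.abs_pd_pd_le 0 0 z)
  rw [hleibniz]
  calc _ ≤ |pd i (pd j χ) z| * |k z| + |pd j χ z| * |pd i k z| + |pd i χ z| * |pd j k z| := by
        simp only [← abs_mul]
        exact (abs_add_le _ _).trans (add_le_add_left (abs_add_le _ _) _)
    _ ≤ C / r ^ 2 * (ε * r ^ 2) + C / r * (ε * r) + C / r * (ε * r) := by
        gcongr
        · exact hχ.abs_pd_pd_le i j z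
        · exact hflat.abs_le z hz
        · exact hχ.abs_pd_le j z
        · exact hflat.abs_pd_le i z hz
        · exact hχ.abs_pd_le i z
        · exact hflat.abs_pd_le j z hz
    _ = _ := by field_simp; ring

lemma IsCutoff.norm_hess_mul_sub_le (hχ : IsCutoff x₀ s r C χ) (hr : 0 < r) (hk : Smooth k)
    (hflat : IsFlatOn k x₀ r ε) (m : ℝ) {z : Plane} (hz : z ∈ Metric.ball x₀ r) :
    ‖hess m (fun z => χ z * k z) z - χ z • hess m k z‖ ≤ (1 + |m|) * (3 * C * ε) := by
  have key := hχ.abs_pd_pd_mul_sub_le hr hk hflat hz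
  have h0 : 0 ≤ 3 * C * ε := (abs_nonneg _).trans (key 0 0)
  have hle : 3 * C * ε ≤ (1 + |m|) * (3 * C * ε) :=
    le_mul_of_one_le_left h0 (le_add_of_nonneg_right (abs_nonneg m))
  refine norm_prod_le_iff.2 ⟨(key 0 0).trans hle, norm_prod_le_iff.2 ⟨(key 1 0).trans hle, ?_⟩⟩
  have hthird : (hess m (fun z => χ z * k z) z - χ z • hess m k z).2.2 =
      m * (pd 1 (pd 1 fun z => χ z * k z) z - χ z * pd 1 (pd 1 k) z) := by
    simp only [hess, Prod.snd_sub, Prod.smul_mk, smul_eq_mul]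
    ring
  rw [hthird, norm_mul, Real.norm_eq_abs]
  gcongr
  · linarith
  · exact key 1 1

lemma IsCutoff.norm_hess_mul_le (hχ : IsCutoff x₀ s r C χ) (hr : 0 < r) (hk : Smooth k)
    (hflat : IsFlatOn k x₀ r ε) {m B : ℝ} {z : Plane} (hz : z ∈ Metric.ball x₀ r)
    (hB : ‖hess m k z‖ ≤ B) :
    ‖hess m (fun z => χ z * k z) z‖ ≤ B + (1 + |m|) * (3 * C * ε) := by
  have hsmul : ‖χ z • hess m k z‖ ≤ B := by
    rw [norm_smul, Real.norm_of_nonneg (hχ.nonneg z)]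
    exact (mul_le_of_le_one_left (norm_nonneg _) (hχ.le_one z)).trans hB
  linarith [norm_sub_norm_le (hess m (fun z => χ z * k z) z) (χ z • hess m k z),
    hχ.norm_hess_mul_sub_le hr hk hflat m hz]

lemma pd_eventuallyEq {f g : Plane → ℝ} {z : Plane} (h : f =ᶠ[𝓝 z] g) (i : Fin 2) :
    pd i f =ᶠ[𝓝 z] pd i g := by
  filter_upwards [h.fderiv (𝕜 := ℝ)] with y hy
  simp only [pd, hy]

lemma IsCutoff.hess_mul_eq (hχ : IsCutoff x₀ s r C χ) (m : ℝ) {z : Plane}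
    (hz : z ∈ Metric.ball x₀ (s * r)) : hess m (fun z => χ z * k z) z = hess m k z := by
  have hev : (fun z => χ z * k z) =ᶠ[𝓝 z] k := by
    filter_upwards [Metric.isOpen_ball.mem_nhds hz] with y hy
    rw [hχ.eq_one y hy, one_mul]
  have hpd (i j : Fin 2) := (pd_eventuallyEq (pd_eventuallyEq hev j) i).eq_of_nhds
  simp only [hess, hpd]

end Cutoff

/-- The second order Taylor polynomial. -/
def taylor (w : Plane → ℝ) (x₀ : Plane) : Plane → ℝ :=
  quad x₀ (w x₀) (pd 0 w x₀) (pd 1 w x₀) (pd 0 (pd 0 w) x₀) (pd 1 (pd 0 w) x₀) (pd 1 (pd 1 w) x₀)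

lemma smooth_taylor (w : Plane → ℝ) (x₀ : Plane) : Smooth (taylor w x₀) :=
  smooth_quad _ _ _ _ _ _ _

lemma hess_taylor_sub {w : Plane → ℝ} (hw : Smooth w) (m : ℝ) (x₀ z : Plane) :
    hess m (fun z => taylor w x₀ z - w z) z = hess m w x₀ - hess m w z := by
  have hadd := congrFun (hess_add (m := m) ((smooth_taylor w x₀).sub hw) hw) z
  simp only [sub_add_cancel] at hadd
  rw [eq_sub_iff_add_eq, ← hadd]
  exact hess_quad ..

lemma eventually_isFlatOn_taylor_sub {w : Plane → ℝ} (hw : Smooth w) (x₀ : Plane) {ε : ℝ}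
    (hε : 0 < ε) : ∀ᶠ r in 𝓝[>] (0 : ℝ), IsFlatOn (fun z => taylor w x₀ z - w z) x₀ r ε := by
  have ht := smooth_taylor w x₀
  have hpd (i : Fin 2) := pd_sub ht.differentiable hw.differentiable i
  refine eventually_isFlatOn (ht.sub hw) ?_ (fun i => ?_) (fun i j => ?_) hε
  · simp [taylor, quad]
  · rw [hpd i]
    fin_cases i <;> simp [taylor, pd_zero_quad, pd_one_quad, quad]
  · rw [hpd j, pd_sub (ht.pd j).differentiable (hw.pd j).differentiable i]
    have hcomm := congrFun (pd_comm hw 0 1) x₀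
    fin_cases i <;> fin_cases j <;> simp [taylor, pd_zero_quad, pd_one_quad, quad, hcomm]

section TwoValues

variable {α : Type*} [MeasurableSpace α] {μ : Measure α} {Q A B : Set α}

lemma measureReal_add_add_sdiff_union (hA : MeasurableSet A) (hB : MeasurableSet B) (hAQ : A ⊆ Q)
    (hBQ : B ⊆ Q) (hd : Disjoint A B) (hfin : μ Q ≠ ∞) :
    μ.real A + μ.real B + μ.real (Q \ (A ∪ B)) = μ.real Q := by
  have hsdiff := measureReal_sdiff_add_inter (μ := μ) (s := Q) (hA.union hB) hfin
  rw [Set.inter_eq_right.2 (Set.union_subset hAQ hBQ), measureReal_union hd hB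
    (measure_ne_top_of_subset hAQ hfin) (measure_ne_top_of_subset hBQ hfin)] at hsdiff
  linarith

lemma norm_setIntegral_sub_measureReal_smul_le {E : Type*} [NormedAddCommGroup E]
    [NormedSpace ℝ E] [CompleteSpace E] {F : α → E} (hfin : μ A ≠ ∞)
    (hF : IntegrableOn F A μ) {a : E} {ε : ℝ} (ha : ∀ z ∈ A, ‖F z - a‖ ≤ ε) :
    ‖(∫ z in A, F z ∂μ) - μ.real A • a‖ ≤ ε * μ.real A := by
  rw [← setIntegral_const, ← integral_sub hF (integrableOn_const hfin)]
  exact norm_setIntegral_le_of_norm_le_const hfin.lt_top ha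

lemma norm_setIntegral_sub_two_values_le {E : Type*} [NormedAddCommGroup E] [NormedSpace ℝ E]
    [CompleteSpace E] {F : α → E} (hQ : MeasurableSet Q) (hA : MeasurableSet A)
    (hB : MeasurableSet B) (hAQ : A ⊆ Q) (hBQ : B ⊆ Q) (hd : Disjoint A B) (hfin : μ Q ≠ ∞)
    (hF : IntegrableOn F Q μ) {a b : E} {ε L : ℝ} (ha : ∀ z ∈ A, ‖F z - a‖ ≤ ε)
    (hb : ∀ z ∈ B, ‖F z - b‖ ≤ ε) (hL : ∀ z ∈ Q, ‖F z‖ ≤ L) :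
    ‖(∫ z in Q, F z ∂μ) - (μ.real A • a + μ.real B • b)‖ ≤
      ε * (μ.real A + μ.real B) + L * μ.real (Q \ (A ∪ B)) := by
  have hAB : A ∪ B ⊆ Q := Set.union_subset hAQ hBQ
  have hsplit : ∫ z in Q, F z ∂μ =
      (∫ z in A, F z ∂μ) + (∫ z in B, F z ∂μ) + ∫ z in Q \ (A ∪ B), F z ∂μ := by
    rw [← setIntegral_union hd hB (hF.mono_set hAQ) (hF.mono_set hBQ),
      ← setIntegral_union Set.disjoint_sdiff_right (hQ.diff (hA.union hB)) (hF.mono_set hAB)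
        (hF.mono_set Set.sdiff_subset), Set.union_sdiff_cancel hAB]
  have hintA := norm_setIntegral_sub_measureReal_smul_le (measure_ne_top_of_subset hAQ hfin)
    (hF.mono_set hAQ) ha
  have hintB := norm_setIntegral_sub_measureReal_smul_le (measure_ne_top_of_subset hBQ hfin)
    (hF.mono_set hBQ) hb
  have hrest : ‖∫ z in Q \ (A ∪ B), F z ∂μ‖ ≤ L * μ.real (Q \ (A ∪ B)) :=
    norm_setIntegral_le_of_norm_le_const
      (measure_ne_top_of_subset Set.sdiff_subset hfin).lt_top fun z hz => hL z hz.1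
  calc _ = ‖((∫ z in A, F z ∂μ) - μ.real A • a) + ((∫ z in B, F z ∂μ) - μ.real B • b)
          + ∫ z in Q \ (A ∪ B), F z ∂μ‖ := by rw [hsplit]; congr 1; abel
    _ ≤ ε * μ.real A + ε * μ.real B + L * μ.real (Q \ (A ∪ B)) :=
        (norm_add_le _ _).trans
          (add_le_add ((norm_add_le _ _).trans (add_le_add hintA hintB)) hrest)
    _ = _ := by rw [mul_add]

/-- Testing the mean value against the direction `q` recovers the volume fraction. -/
lemma fraction_le_of_setIntegral_eq_zero {E : Type*} [NormedAddCommGroup E] [NormedSpace ℝ E]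
    [CompleteSpace E] {F : α → E} (hQ : MeasurableSet Q) (hA : MeasurableSet A)
    (hB : MeasurableSet B) (hAQ : A ⊆ Q) (hBQ : B ⊆ Q) (hd : Disjoint A B) (hfin : μ Q ≠ ∞)
    (hF : IntegrableOn F Q μ) (h0 : ∫ z in Q, F z ∂μ = 0) {x y : ℝ} (hxy : 0 < x * y) {q : E}
    (hq : q ≠ 0) {ε L δ : ℝ} (hε : 0 ≤ ε) (hL0 : 0 ≤ L) (ha : ∀ z ∈ A, ‖F z - x • q‖ ≤ ε)
    (hb : ∀ z ∈ B, ‖F z + y • q‖ ≤ ε) (hL : ∀ z ∈ Q, ‖F z‖ ≤ L)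
    (hδ : μ.real (Q \ (A ∪ B)) ≤ δ * μ.real Q) :
    (y / (x + y) - (δ + (ε + L * δ) / (‖q‖ * |x + y|))) * μ.real Q ≤ μ.real A := by
  have hne : x + y ≠ 0 := add_ne_zero_of_mul_pos hxy
  have hfrac : y / (x + y) ≤ 1 := (div_add_mem_Ioo_of_mul_pos hxy).2.le
  have hpart := measureReal_add_add_sdiff_union hA hB hAQ hBQ hd hfin
  have hmean := norm_setIntegral_sub_two_values_le hQ hA hB hAQ hBQ hd hfin hF ha
    (b := -(y • q)) (by simpa only [sub_neg_eq_add] using hb) hL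
  set V := μ.real Q
  set a := μ.real A
  set b := μ.real B
  set R := μ.real (Q \ (A ∪ B))
  have hR : 0 ≤ R := measureReal_nonneg
  have hbalance : |a * x - b * y| * ‖q‖ ≤ (ε + L * δ) * V := by
    have hvec : a • x • q + b • -(y • q) = (a * x - b * y) • q := by
      rw [smul_neg, smul_smul, smul_smul, sub_smul, sub_eq_add_neg]
    rw [h0, zero_sub, norm_neg, hvec, norm_smul, Real.norm_eq_abs] at hmean
    nlinarith [mul_le_mul_of_nonneg_left hδ hL0, mul_nonneg hε hR]
  have hsolve : a = y / (x + y) * V - y / (x + y) * R + (a * x - b * y) / (x + y) := by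
    rw [← hpart]
    field_simp
    ring
  have hdefect : -((ε + L * δ) / (‖q‖ * |x + y|) * V) ≤ (a * x - b * y) / (x + y) := by
    refine neg_le_of_abs_le ?_
    rw [abs_div, div_mul_eq_mul_div, mul_comm ‖q‖, ← div_div, div_right_comm]
    gcongr
    rwa [le_div_iff₀ (norm_pos_iff.2 hq)]
  have hrest : y / (x + y) * R ≤ δ * V :=
    (mul_le_of_le_one_left hR hfrac).trans hδ
  linarith

lemma abs_setIntegral_sub_average_le {f : α → ℝ} (hQ : MeasurableSet Q) (hA : MeasurableSet A)
    (hB : MeasurableSet B) (hAQ : A ⊆ Q) (hBQ : B ⊆ Q) (hd : Disjoint A B) (hfin : μ Q ≠ ∞)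
    (hf : IntegrableOn f Q μ) {u v b : ℝ} (hfu : ∀ z ∈ A, f z = u) (hfv : ∀ z ∈ B, f z = v)
    (hfb : ∀ z ∈ Q, |f z| ≤ b) (hu : |u| ≤ b) (hv : |v| ≤ b) {s t η : ℝ} (hst : s + t = 1)
    (hs : (s - η) * μ.real Q ≤ μ.real A) (ht : (t - η) * μ.real Q ≤ μ.real B) :
    |(∫ z in Q, f z ∂μ) - (s * u + t * v) * μ.real Q| ≤ 4 * η * b * μ.real Q := by
  have hpart := measureReal_add_add_sdiff_union hA hB hAQ hBQ hd hfin
  have hmean := norm_setIntegral_sub_two_values_le hQ hA hB hAQ hBQ hd hfin hf (a := u) (b := v)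
    (ε := 0) (fun z hz => by simp [hfu z hz]) (fun z hz => by simp [hfv z hz]) hfb
  rw [zero_mul, zero_add, Real.norm_eq_abs, smul_eq_mul, smul_eq_mul] at hmean
  set V := μ.real Q
  have hR : 0 ≤ μ.real (Q \ (A ∪ B)) := measureReal_nonneg
  have hb : 0 ≤ b := (abs_nonneg u).trans hu
  obtain rfl : t = 1 - s := by linarith
  have hAV : |μ.real A - s * V| ≤ η * V := abs_le.2 ⟨by linarith, by linarith⟩
  have hBV : |μ.real B - (1 - s) * V| ≤ η * V := abs_le.2 ⟨by linarith, by linarith⟩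
  have hRV : μ.real (Q \ (A ∪ B)) ≤ 2 * (η * V) := by linarith
  calc _ = |((∫ z in Q, f z ∂μ) - (μ.real A * u + μ.real B * v))
          + (μ.real A - s * V) * u + (μ.real B - (1 - s) * V) * v| := by ring_nf
    _ ≤ b * (2 * (η * V)) + η * V * b + η * V * b := by
        refine (abs_add_three _ _ _).trans ?_
        rw [abs_mul, abs_mul]
        have hηV : 0 ≤ η * V := (abs_nonneg _).trans hAV
        gcongr
        exact hmean.trans (mul_le_mul_of_nonneg_left hRV hb)
    _ = _ := by ring

end TwoValues

section Tame

/-- Measurable functions that are bounded on compact sets: the functionals of the second derivatives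
whose integrals are controlled along the construction. -/
structure IsTame {α : Type*} [TopologicalSpace α] [MeasurableSpace α] (f : α → ℝ) : Prop where
  measurable : Measurable f
  exists_bound : ∀ s, IsCompact s → ∃ b, ∀ a ∈ s, |f a| ≤ b

variable {α β : Type*} [TopologicalSpace α] [MeasurableSpace α] [TopologicalSpace β]
  [MeasurableSpace β] {f : β → ℝ} {g : α → β}

lemma isTame_of_abs_le (hf : Measurable f) {F : β → ℝ} (hF : Continuous F)
    (h : ∀ x, |f x| ≤ F x) : IsTame f where
  measurable := hf
  exists_bound _ hs := by
    obtain ⟨b, hb⟩ := (hs.image hF).bddAbove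
    exact ⟨b, fun x hx => (h x).trans (hb (Set.mem_image_of_mem F hx))⟩

lemma isTame_of_continuous [OpensMeasurableSpace β] (hf : Continuous f) : IsTame f :=
  isTame_of_abs_le hf.measurable hf.abs fun _ => le_rfl

lemma IsTame.const_mul (hf : IsTame f) (c : ℝ) : IsTame fun x => c * f x where
  measurable := hf.measurable.const_mul c
  exists_bound s hs := by
    obtain ⟨b, hb⟩ := hf.exists_bound s hs
    refine ⟨|c| * b, fun x hx => ?_⟩
    rw [abs_mul]
    exact mul_le_mul_of_nonneg_left (hb x hx) (abs_nonneg c)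

lemma IsTame.sub {f' : β → ℝ} (hf : IsTame f) (hf' : IsTame f') : IsTame fun x => f x - f' x where
  measurable := hf.measurable.sub hf'.measurable
  exists_bound s hs := by
    obtain ⟨b, hb⟩ := hf.exists_bound s hs
    obtain ⟨b', hb'⟩ := hf'.exists_bound s hs
    exact ⟨b + b', fun x hx => (abs_sub _ _).trans (add_le_add (hb x hx) (hb' x hx))⟩

lemma IsTame.neg (hf : IsTame f) : IsTame fun x => -f x := by
  simpa only [neg_one_mul] using hf.const_mul (-1)

lemma IsTame.comp [OpensMeasurableSpace α] [BorelSpace β] (hf : IsTame f) (hg : Continuous g) :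
    IsTame fun x => f (g x) where
  measurable := hf.measurable.comp hg.measurable
  exists_bound s hs := by
    obtain ⟨b, hb⟩ := hf.exists_bound _ (hs.image hg)
    exact ⟨b, fun x hx => hb _ (Set.mem_image_of_mem g hx)⟩

lemma exists_forall_abs_le {ι : Type*} [Finite ι] {f : ι → α → ℝ} (hf : ∀ i, IsTame (f i))
    {s : Set α} (hs : IsCompact s) : ∃ b, 0 ≤ b ∧ ∀ i, ∀ a ∈ s, |f i a| ≤ b := by
  choose b hb using fun i => (hf i).exists_bound s hs
  obtain ⟨M, hM⟩ := (Set.finite_range b).bddAbove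
  exact ⟨max 0 M, le_max_left _ _, fun i a ha =>
    (hb i a ha).trans ((hM (Set.mem_range_self i)).trans (le_max_right _ _))⟩

lemma IsTame.integrableOn_isCompact [T2Space α] [OpensMeasurableSpace α] {μ : Measure α}
    [IsFiniteMeasureOnCompacts μ] {f : α → ℝ} (hf : IsTame f) {s : Set α} (hs : IsCompact s) :
    IntegrableOn f s μ := by
  obtain ⟨b, hb⟩ := hf.exists_bound s hs
  exact Measure.integrableOn_of_bounded hs.measure_lt_top.ne hf.measurable.aestronglyMeasurable
    (ae_restrict_of_forall_mem hs.measurableSet hb)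

lemma IsTame.integrableOn_isBounded {α : Type*} [PseudoMetricSpace α] [ProperSpace α] [T2Space α]
    [MeasurableSpace α] [OpensMeasurableSpace α] {μ : Measure α} [IsFiniteMeasureOnCompacts μ]
    {f : α → ℝ} (hf : IsTame f) {s : Set α} (hs : Bornology.IsBounded s) : IntegrableOn f s μ :=
  (hf.integrableOn_isCompact hs.isCompact_closure).mono_set subset_closure

lemma IsTame.locallyIntegrable [T2Space α] [WeaklyLocallyCompactSpace α] [OpensMeasurableSpace α]
    {μ : Measure α} [IsFiniteMeasureOnCompacts μ] {f : α → ℝ} (hf : IsTame f) :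
    LocallyIntegrable f μ := fun x =>
  let ⟨_, hs, hx⟩ := exists_compact_mem_nhds x
  ⟨_, hx, hf.integrableOn_isCompact hs⟩

end Tame

lemma one_sub_finrank_mul_measureReal_closedBall_le {E : Type*} [NormedAddCommGroup E]
    [NormedSpace ℝ E] [Nontrivial E] [FiniteDimensional ℝ E] [MeasurableSpace E] [BorelSpace E]
    (μ : Measure E) [μ.IsAddHaarMeasure] (x : E) (r : ℝ) {s : ℝ} (hs : s < 1) :
    (1 - Module.finrank ℝ E * s) * μ.real (Metric.closedBall x r) ≤
      μ.real (Metric.ball x ((1 - s) * r)) := by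
  have hscale : μ.real (Metric.ball x ((1 - s) * r)) =
      (1 - s) ^ Module.finrank ℝ E * μ.real (Metric.closedBall x r) := by
    rw [Measure.real, Measure.addHaar_ball_mul_of_pos μ x (sub_pos.2 hs), ENNReal.toReal_mul,
      ENNReal.toReal_ofReal (pow_nonneg (sub_pos.2 hs).le _), Measure.real,
      Measure.addHaar_closedBall_eq_addHaar_ball, Measure.addHaar_ball_center μ x r]
  rw [hscale]
  gcongr
  simpa [mul_neg, ← sub_eq_add_neg] using
    one_add_mul_le_pow (by linarith : -2 ≤ -s) (Module.finrank ℝ E)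

lemma integral_hess_eq_zero {m : ℝ} {h : Plane → ℝ} (hh : Smooth h) (hc : HasCompactSupport h) :
    ∫ z, hess m h z = 0 := by
  have hzero (i j : Fin 2) : ∫ z, pd i (pd j h) z = 0 :=
    integral_pd_eq_zero ((hh.pd j).of_le (by exact_mod_cast le_top)) (hasCompactSupport_pd hc j) i
  have hint (i j : Fin 2) : Integrable (pd i (pd j h)) :=
    ((hh.pd j).pd i).continuous.integrable_of_hasCompactSupport
      (hasCompactSupport_pd (hasCompactSupport_pd hc j) i)
  simp only [hess]
  rw [integral_pair (hint 0 0) ((hint 1 0).prodMk ((hint 1 1).const_mul m)),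
    integral_pair (hint 1 0) ((hint 1 1).const_mul m), integral_const_mul]
  simp [hzero]

lemma eventually_norm_hess_sub_le {w : Plane → ℝ} (hw : Smooth w) (m : ℝ) (x₀ : Plane) {ε : ℝ}
    (hε : 0 < ε) :
    ∀ᶠ r in 𝓝[>] (0 : ℝ), ∀ z ∈ Metric.closedBall x₀ r, ‖hess m w x₀ - hess m w z‖ ≤ ε := by
  obtain ⟨r₀, hr₀, hball⟩ := Metric.continuousAt_iff.1
    (continuous_hess (m := m) hw).continuousAt ε hε
  filter_upwards [Ioo_mem_nhdsGT hr₀] with r hr z hz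
  rw [← dist_eq_norm, dist_comm]
  exact (hball ((Metric.mem_closedBall.1 hz).trans_lt hr.2)).le

/-- The triple `hess m` of a function `g ⟨n, ·⟩` with `g'' = 1`: the direction of a plane wave. -/
def rankOne (m : ℝ) (n : Plane) : ℝ × ℝ × ℝ := (n 0 ^ 2, n 0 * n 1, m * n 1 ^ 2)

section PlaneWave

variable {g : ℝ → ℝ} (n x₀ : Plane)

lemma smooth_comp_inner (hg : ContDiff ℝ ((⊤ : ℕ∞) : WithTop ℕ∞) g) :
    Smooth fun z => g (inner ℝ n (z - x₀)) :=
  hg.comp (contDiff_const.inner ℝ (contDiff_id.sub contDiff_const))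

lemma hess_comp_inner (hg : ContDiff ℝ ((⊤ : ℕ∞) : WithTop ℕ∞) g) (m : ℝ) (z : Plane) :
    hess m (fun z => g (inner ℝ n (z - x₀))) z =
      deriv (deriv g) (inner ℝ n (z - x₀)) • rankOne m n := by
  obtain ⟨hg0, hg'⟩ := contDiff_infty_iff_deriv.1 hg
  have hcomp := (smooth_comp_inner n x₀ hg').differentiable
  have hpd (i j : Fin 2) : pd i (pd j fun z => g (inner ℝ n (z - x₀))) =
      fun z => n j * (n i * deriv (deriv g) (inner ℝ n (z - x₀))) := by
    rw [pd_comp_inner hg0, pd_mul (differentiable_const _) hcomp, pd_const,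
      pd_comp_inner (contDiff_infty_iff_deriv.1 hg').1]
    ext x
    simp only [zero_mul, zero_add]
  simp only [hess, hpd, rankOne, Prod.smul_mk, smul_eq_mul]
  refine Prod.ext ?_ (Prod.ext ?_ ?_) <;> ring

lemma IsOscillation.isFlatOn_comp_inner {ν : Measure ℝ} {x y ε r : ℝ}
    (hg : IsOscillation ν x y (ε * r ^ 2) g) (hε : 0 ≤ ε) (hr : 0 ≤ r) (hnr : ‖n‖ * r ≤ 1) :
    IsFlatOn (fun z => g (inner ℝ n (z - x₀))) x₀ r ε := by
  have hinner : ∀ z ∈ Metric.ball x₀ r, |(inner ℝ n (z - x₀) : ℝ)| ≤ 1 := fun z hz =>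
    ((abs_real_inner_le_norm _ _).trans (by
      gcongr
      exact (mem_ball_iff_norm.1 hz).le)).trans hnr
  refine ⟨fun z hz => hg.abs_le _ (hinner z hz), fun i z hz => ?_⟩
  rw [pd_comp_inner (contDiff_infty_iff_deriv.1 hg.contDiff).1, abs_mul]
  calc _ ≤ ‖n‖ * (ε * r ^ 2) :=
        mul_le_mul (abs_apply_le_norm n i) (hg.abs_deriv_le _ (hinner z hz)) (abs_nonneg _)
          (norm_nonneg _)
    _ = ‖n‖ * r * (ε * r) := by ring
    _ ≤ ε * r := mul_le_of_le_one_left (by positivity) hnr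

end PlaneWave

/-- The part of the ball `B(x₀, r)` where the perturbation `h` moves the second derivatives of `w`
to the point `A + t q` of the rank one line through `A = hess m w x₀`. -/
def layer (m : ℝ) (w h : Plane → ℝ) (x₀ n : Plane) (r t : ℝ) : Set Plane :=
  {z ∈ Metric.closedBall x₀ r | hess m w z + hess m h z = hess m w x₀ + t • rankOne m n}

/-- `h` is a small perturbation of `w` supported in `B(x₀, r)` which, outside a set of relative
measure `ε`, splits the second derivative `A = hess m w x₀` into `A + x q` and `A - y q`. -/
structure IsLamination (m : ℝ) (w : Plane → ℝ) (x₀ n : Plane) (x y r ε : ℝ) (h : Plane → ℝ) :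
    Prop where
  smooth : Smooth h
  tsupport_subset : tsupport h ⊆ Metric.ball x₀ r
  abs_pd_zero_le : ∀ z, |pd 0 h z| ≤ ε
  norm_hess_le : ∀ z, ‖hess m h z‖ ≤ max |x| |y| * ‖rankOne m n‖ + ε
  measureReal_le : volume.real (Metric.closedBall x₀ r \
    (layer m w h x₀ n r x ∪ layer m w h x₀ n r (-y))) ≤ ε * volume.real (Metric.closedBall x₀ r)

section Lamination

variable {m : ℝ} {w h χ : Plane → ℝ} {x₀ n : Plane} {x y r s C ε : ℝ}

lemma layer_subset_closedBall {t : ℝ} : layer m w h x₀ n r t ⊆ Metric.closedBall x₀ r :=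
  Set.sep_subset _ _

lemma measurableSet_layer (hw : Smooth w) (hh : Smooth h) {t : ℝ} :
    MeasurableSet (layer m w h x₀ n r t) :=
  measurableSet_closedBall.inter
    (isClosed_eq ((continuous_hess hw).add (continuous_hess hh)) continuous_const).measurableSet

lemma disjoint_layer (hq : rankOne m n ≠ 0) {t t' : ℝ} (ht : t ≠ t') :
    Disjoint (layer m w h x₀ n r t) (layer m w h x₀ n r t') :=
  Set.disjoint_left.2 fun _ hz hz' =>
    ht (smul_left_injective ℝ hq (add_left_cancel (hz.2.symm.trans hz'.2)))

/-- The Taylor remainder of `w` at `x₀`, which makes the second derivatives of `w` constant, plus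
the plane wave with profile `g` in the direction `n`. -/
def corrector (w : Plane → ℝ) (x₀ n : Plane) (g : ℝ → ℝ) (z : Plane) : ℝ :=
  (taylor w x₀ z - w z) + g (inner ℝ n (z - x₀))

lemma smooth_corrector (hw : Smooth w) {g : ℝ → ℝ}
    (hg : ContDiff ℝ ((⊤ : ℕ∞) : WithTop ℕ∞) g) : Smooth (corrector w x₀ n g) :=
  ((smooth_taylor w x₀).sub hw).add (smooth_comp_inner n x₀ hg)

lemma hess_corrector (hw : Smooth w) {g : ℝ → ℝ}
    (hg : ContDiff ℝ ((⊤ : ℕ∞) : WithTop ℕ∞) g) (z : Plane) :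
    hess m (corrector w x₀ n g) z =
      hess m w x₀ - hess m w z + deriv (deriv g) (inner ℝ n (z - x₀)) • rankOne m n := by
  rw [← hess_taylor_sub hw, ← hess_comp_inner n x₀ hg]
  exact congrFun (hess_add ((smooth_taylor w x₀).sub hw) (smooth_comp_inner n x₀ hg)) z

lemma IsCutoff.hess_add_hess_mul_corrector (hχ : IsCutoff x₀ s r C χ) (hw : Smooth w)
    {g : ℝ → ℝ} (hg : ContDiff ℝ ((⊤ : ℕ∞) : WithTop ℕ∞) g) {z : Plane}
    (hz : z ∈ Metric.ball x₀ (s * r)) :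
    hess m w z + hess m (fun z => χ z * corrector w x₀ n g z) z =
      hess m w x₀ + deriv (deriv g) (inner ℝ n (z - x₀)) • rankOne m n := by
  rw [hχ.hess_mul_eq m hz, hess_corrector hw hg]
  abel

lemma IsCutoff.measureReal_sdiff_layer_le {δ : ℝ} (hχ : IsCutoff x₀ (1 - δ) r C χ)
    (hw : Smooth w) (hr : 0 ≤ r) (hδ0 : 0 ≤ δ) (hδ1 : δ < 1) (hε : 0 ≤ ε) {g : ℝ → ℝ}
    (hg : IsOscillation ((volume.restrict (Metric.closedBall x₀ r)).map
      fun z => inner ℝ n (z - x₀)) x y ε g)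
    (hh : h = fun z => χ z * corrector w x₀ n g z) :
    volume.real (Metric.closedBall x₀ r \ (layer m w h x₀ n r x ∪ layer m w h x₀ n r (-y))) ≤
      2 * δ * volume.real (Metric.closedBall x₀ r) + ε := by
  set Q := Metric.closedBall x₀ r
  set B := Metric.ball x₀ ((1 - δ) * r)
  set N := {t | deriv (deriv g) t ≠ x ∧ deriv (deriv g) t ≠ -y}
  let lin : Plane → ℝ := fun z => inner ℝ n (z - x₀)
  have hlin : Continuous lin := by fun_prop
  have hg2 : Continuous (deriv (deriv g)) :=
    (contDiff_infty_iff_deriv.1 (contDiff_infty_iff_deriv.1 hg.contDiff).2).2.continuous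
  have hN : MeasurableSet N := ((isOpen_ne_fun hg2 continuous_const).inter
    (isOpen_ne_fun hg2 continuous_const)).measurableSet
  have hQfin : volume Q ≠ ∞ := measure_closedBall_lt_top.ne
  have hcover : Q \ (layer m w h x₀ n r x ∪ layer m w h x₀ n r (-y)) ⊆
      (Q \ B) ∪ (Q ∩ lin ⁻¹' N) := by
    rintro z ⟨hzQ, hz⟩
    by_cases hzB : z ∈ B
    · have hval := hχ.hess_add_hess_mul_corrector (m := m) (n := n) hw hg.contDiff hzB
      rw [← hh] at hval
      exact Or.inr ⟨hzQ, fun hx => hz (Or.inl ⟨hzQ, by rw [hval, hx]⟩),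
        fun hy => hz (Or.inr ⟨hzQ, by rw [hval, hy]⟩)⟩
    · exact Or.inl ⟨hzQ, hzB⟩
  have hshell : volume.real (Q \ B) ≤ 2 * δ * volume.real Q := by
    have hball := one_sub_finrank_mul_measureReal_closedBall_le volume x₀ r hδ1
    have hsub : B ⊆ Q := (Metric.ball_subset_ball (mul_le_of_le_one_left hr (by linarith))).trans
      Metric.ball_subset_closedBall
    rw [finrank_euclideanSpace_fin, Nat.cast_ofNat] at hball
    rw [measureReal_sdiff hsub measurableSet_ball]
    linarith
  have htransition : volume.real (Q ∩ lin ⁻¹' N) ≤ ε := by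
    have hmap := hg.measure_le
    rw [Measure.map_apply hlin.measurable hN, Measure.restrict_apply (hlin.measurable hN),
      Set.inter_comm] at hmap
    exact ENNReal.toReal_le_of_le_ofReal hε hmap
  calc _ ≤ volume.real ((Q \ B) ∪ (Q ∩ lin ⁻¹' N)) := measureReal_mono hcover
        (measure_ne_top_of_subset (Set.union_subset Set.sdiff_subset Set.inter_subset_left) hQfin)
    _ ≤ _ := (measureReal_union_le _ _).trans (add_le_add hshell htransition)

lemma IsOscillation.mono {ν : Measure ℝ} {δ : ℝ} {g : ℝ → ℝ} (hg : IsOscillation ν x y δ g)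
    (h : δ ≤ ε) : IsOscillation ν x y ε g :=
  ⟨hg.contDiff, fun t ht => (hg.abs_le t ht).trans h, fun t ht => (hg.abs_deriv_le t ht).trans h,
    hg.abs_deriv_deriv_le, hg.measure_le.trans (ENNReal.ofReal_le_ofReal h)⟩

lemma IsCutoff.isLamination {δ ε₀ : ℝ} (hχ : IsCutoff x₀ (1 - δ) r C χ) (hw : Smooth w)
    (hr : 0 < r) (hr1 : r ≤ 1) (hδ0 : 0 ≤ δ) (hδ1 : δ < 1) (hδ : δ ≤ ε / 4) (hC : 0 ≤ C)
    (hε₀ : 0 ≤ ε₀) (hεε₀ : 12 * ((1 + |m|) * ((1 + C) * ε₀)) ≤ ε)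
    (hhess : ∀ z ∈ Metric.closedBall x₀ r, ‖hess m w x₀ - hess m w z‖ ≤ ε / 2) {g : ℝ → ℝ}
    (hg : IsOscillation ((volume.restrict (Metric.closedBall x₀ r)).map
      fun z => inner ℝ n (z - x₀)) x y (ε / 2 * volume.real (Metric.closedBall x₀ r)) g)
    (hflat : IsFlatOn (corrector w x₀ n g) x₀ r (2 * ε₀)) :
    IsLamination m w x₀ n x y r ε fun z => χ z * corrector w x₀ n g z := by
  have hk : Smooth (corrector w x₀ n g) := smooth_corrector hw hg.contDiff
  have hsupp : tsupport (fun z => χ z * corrector w x₀ n g z) ⊆ Metric.ball x₀ r :=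
    tsupport_mul_subset_left.trans hχ.tsupport_subset
  have hm : (1 + C) * ε₀ ≤ (1 + |m|) * ((1 + C) * ε₀) :=
    le_mul_of_one_le_left (by positivity) (le_add_of_nonneg_right (abs_nonneg m))
  have hmC : (1 + |m|) * (C * ε₀) ≤ (1 + |m|) * ((1 + C) * ε₀) := by gcongr; linarith
  refine ⟨hχ.smooth.mul hk, hsupp, fun z => ?_, fun z => ?_, ?_⟩
  · by_cases hz : z ∈ Metric.ball x₀ r
    · calc _ ≤ (C + 1) * (2 * ε₀) * r := hχ.abs_pd_mul_le hr hk hflat hz 0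
        _ ≤ (C + 1) * (2 * ε₀) * 1 := by gcongr
        _ ≤ ε := by linarith
    · rw [pd_eq_zero_of_notMem fun hz' => hz (hsupp hz'), abs_zero]
      linarith
  · by_cases hz : z ∈ Metric.ball x₀ r
    · have hwave : ‖hess m (corrector w x₀ n g) z‖ ≤ ε / 2 + max |x| |y| * ‖rankOne m n‖ := by
        rw [hess_corrector hw hg.contDiff]
        refine (norm_add_le _ _).trans
          (add_le_add (hhess z (Metric.ball_subset_closedBall hz)) ?_)
        rw [norm_smul]
        exact mul_le_mul_of_nonneg_right (hg.abs_deriv_deriv_le _) (norm_nonneg _)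
      linarith [hχ.norm_hess_mul_le hr hk hflat hz hwave]
    · rw [hess_eq_zero_of_notMem fun hz' => hz (hsupp hz'), norm_zero]
      have : 0 ≤ max |x| |y| * ‖rankOne m n‖ := by positivity
      linarith
  · have hV : 0 ≤ volume.real (Metric.closedBall x₀ r) := measureReal_nonneg
    have hε : 0 ≤ ε / 2 := by linarith
    refine (hχ.measureReal_sdiff_layer_le hw hr.le hδ0 hδ1 (by positivity) hg rfl).trans ?_
    linarith [mul_le_mul_of_nonneg_right hδ hV]

lemma eventually_exists_isLamination (hw : Smooth w) (m : ℝ) (x₀ n : Plane) (hxy : 0 < x * y)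
    (hε : 0 < ε) : ∀ᶠ r in 𝓝[>] (0 : ℝ), ∃ h : Plane → ℝ, IsLamination m w x₀ n x y r ε h := by
  set δ := min (ε / 4) (1 / 2)
  have hδ0 : 0 < δ := by positivity
  have hδ1 : δ < 1 := (min_le_right _ _).trans_lt (by norm_num)
  obtain ⟨C, hC, hcut⟩ := exists_isCutoff (s := 1 - δ) (by linarith) (by linarith)
  set ε₀ := ε / (12 * ((1 + |m|) * (1 + C)))
  have hε₀ : 0 < ε₀ := by positivity
  have hεε₀ : 12 * ((1 + |m|) * ((1 + C) * ε₀)) = ε := by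
    rw [← mul_assoc _ _ ε₀, ← mul_assoc 12]
    exact mul_div_cancel₀ _ (by positivity)
  filter_upwards [eventually_isFlatOn_taylor_sub hw x₀ hε₀,
    eventually_norm_hess_sub_le hw m x₀ (half_pos hε),
    Ioo_mem_nhdsGT (show (0 : ℝ) < 1 / (1 + ‖n‖) by positivity)] with r hflat hhess hr
  obtain ⟨hr0, hr1⟩ := hr
  rw [lt_div_iff₀ (by positivity)] at hr1
  have hrn : 0 ≤ r * ‖n‖ := by positivity
  obtain ⟨χ, hχ⟩ := hcut x₀ r hr0
  have hV : 0 < volume.real (Metric.closedBall x₀ r) := ENNReal.toReal_pos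
    (Metric.measure_closedBall_pos volume x₀ hr0).ne' measure_closedBall_lt_top.ne
  have hfinite : IsFiniteMeasure (volume.restrict (Metric.closedBall x₀ r)) :=
    isFiniteMeasure_restrict.2 measure_closedBall_lt_top.ne
  obtain ⟨g, hg⟩ := exists_isOscillation ((volume.restrict (Metric.closedBall x₀ r)).map
    fun z => inner ℝ n (z - x₀)) hxy
    (show 0 < min (ε₀ * r ^ 2) (ε / 2 * volume.real (Metric.closedBall x₀ r)) by positivity)
  have hwave : IsFlatOn (fun z => g (inner ℝ n (z - x₀))) x₀ r ε₀ :=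
    (hg.mono (min_le_left _ _)).isFlatOn_comp_inner n x₀ hε₀.le hr0.le (by linarith)
  refine ⟨_, hχ.isLamination hw hr0 (by linarith) hδ0.le hδ1 (min_le_left _ _) hC hε₀.le hεε₀.le
    hhess (hg.mono (min_le_right _ _)) ?_⟩
  rw [two_mul]
  exact hflat.add ((smooth_taylor w x₀).sub hw) (smooth_comp_inner n x₀ hg.contDiff) hwave

lemma IsLamination.mono {η : ℝ} (hh : IsLamination m w x₀ n x y r ε h) (hε : ε ≤ η) :
    IsLamination m w x₀ n x y r η h :=
  ⟨hh.smooth, hh.tsupport_subset, fun z => (hh.abs_pd_zero_le z).trans hε,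
    fun z => (hh.norm_hess_le z).trans (by linarith), hh.measureReal_le.trans (by gcongr)⟩

/-- The mean of `hess m h` over the ball vanishes, and this fixes the volume fractions. -/
lemma IsLamination.measureReal_layer_ge (hh : IsLamination m w x₀ n x y r ε h) (hw : Smooth w)
    (hxy : 0 < x * y) (hq : rankOne m n ≠ 0) (hε : 0 ≤ ε) {L : ℝ}
    (hL : max |x| |y| * ‖rankOne m n‖ + ε ≤ L)
    (hhess : ∀ z ∈ Metric.closedBall x₀ r, ‖hess m w x₀ - hess m w z‖ ≤ ε) :
    (y / (x + y) - (ε + (ε + L * ε) / (‖rankOne m n‖ * |x + y|))) *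
        volume.real (Metric.closedBall x₀ r) ≤ volume.real (layer m w h x₀ n r x) ∧
      (x / (x + y) - (ε + (ε + L * ε) / (‖rankOne m n‖ * |x + y|))) *
        volume.real (Metric.closedBall x₀ r) ≤ volume.real (layer m w h x₀ n r (-y)) := by
  have hbound : ∀ z ∈ Metric.closedBall x₀ r, ‖hess m h z‖ ≤ L := fun z _ =>
    (hh.norm_hess_le z).trans hL
  have hL0 : 0 ≤ L := le_trans (by positivity) hL
  have hsub : ∀ z ∉ Metric.closedBall x₀ r, hess m h z = 0 := fun z hz =>
    hess_eq_zero_of_notMem fun hz' => hz (Metric.ball_subset_closedBall (hh.tsupport_subset hz'))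
  have hcomp : HasCompactSupport h :=
    HasCompactSupport.of_support_subset_isCompact (isCompact_closedBall x₀ r)
      ((subset_tsupport h).trans (hh.tsupport_subset.trans Metric.ball_subset_closedBall))
  have hint : IntegrableOn (hess m h) (Metric.closedBall x₀ r) :=
    (continuous_hess hh.smooth).continuousOn.integrableOn_compact (isCompact_closedBall x₀ r)
  have hmean : ∫ z in Metric.closedBall x₀ r, hess m h z = 0 := by
    rw [setIntegral_eq_integral_of_forall_compl_eq_zero hsub, integral_hess_eq_zero hh.smooth hcomp]
  have hlayer (t : ℝ) : ∀ z ∈ layer m w h x₀ n r t, ‖hess m h z - t • rankOne m n‖ ≤ ε := by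
    rintro z ⟨hzQ, hz⟩
    have hval : hess m h z - t • rankOne m n = hess m w x₀ - hess m w z := by
      rw [sub_eq_sub_iff_add_eq_add, ← hz, add_comm]
    exact hval ▸ hhess z hzQ
  have hplus := hlayer x
  have hminus := hlayer (-y)
  have hd : Disjoint (layer m w h x₀ n r x) (layer m w h x₀ n r (-y)) :=
    disjoint_layer hq fun h => add_ne_zero_of_mul_pos hxy (by linarith)
  have hmeas (t : ℝ) := measurableSet_layer (m := m) (x₀ := x₀) (n := n) (r := r) (t := t) hw
    hh.smooth
  constructor
  · refine fraction_le_of_setIntegral_eq_zero measurableSet_closedBall (hmeas x) (hmeas (-y))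
      layer_subset_closedBall layer_subset_closedBall hd measure_closedBall_lt_top.ne hint hmean
      hxy hq hε hL0 hplus ?_ hbound hh.measureReal_le
    simpa only [neg_smul, sub_neg_eq_add] using hminus
  · rw [add_comm x y, ← norm_neg (rankOne m n)]
    refine fraction_le_of_setIntegral_eq_zero measurableSet_closedBall (hmeas (-y)) (hmeas x)
      layer_subset_closedBall layer_subset_closedBall hd.symm measure_closedBall_lt_top.ne hint
      hmean (by linarith) (neg_ne_zero.2 hq) hε hL0 ?_ ?_ hbound ?_
    · simpa only [neg_smul, smul_neg] using hminus
    · simpa only [smul_neg, ← sub_eq_add_neg] using hplus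
    · rw [Set.union_comm]
      exact hh.measureReal_le

theorem eventually_exists_lamination_fractions (hw : Smooth w) (m : ℝ) (x₀ : Plane)
    (hq : rankOne m n ≠ 0) (hxy : 0 < x * y) {η : ℝ} (hη : 0 < η) :
    ∀ᶠ r in 𝓝[>] (0 : ℝ), ∃ h : Plane → ℝ, IsLamination m w x₀ n x y r η h ∧
      (y / (x + y) - η) * volume.real (Metric.closedBall x₀ r) ≤
        volume.real (layer m w h x₀ n r x) ∧
      (x / (x + y) - η) * volume.real (Metric.closedBall x₀ r) ≤
        volume.real (layer m w h x₀ n r (-y)) := by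
  set D := ‖rankOne m n‖ * |x + y|
  have hD : 0 < D := mul_pos (norm_pos_iff.2 hq) (abs_pos.2 (add_ne_zero_of_mul_pos hxy))
  set L := max |x| |y| * ‖rankOne m n‖ + 1
  set e := min (min η 1) (η / (1 + (1 + L) / D))
  have he : 0 < e := by positivity
  have heη : e ≤ η := (min_le_left _ _).trans (min_le_left _ _)
  have he1 : e ≤ 1 := (min_le_left _ _).trans (min_le_right _ _)
  have heD : e + (e + L * e) / D ≤ η := calc
    _ = e * (1 + (1 + L) / D) := by ring
    _ ≤ η := (le_div_iff₀ (by positivity)).1 (min_le_right _ _)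
  filter_upwards [eventually_exists_isLamination hw m x₀ n hxy he,
    eventually_norm_hess_sub_le hw m x₀ he] with r ⟨h, hh⟩ hhess
  obtain ⟨hplus, hminus⟩ := hh.measureReal_layer_ge hw hxy hq he.le
    (show _ ≤ L by simpa only [L, add_le_add_iff_left] using he1) hhess
  have hfrac {θ V : ℝ}
      (h : (θ - (e + (e + L * e) / D)) * volume.real (Metric.closedBall x₀ r) ≤ V) :
      (θ - η) * volume.real (Metric.closedBall x₀ r) ≤ V :=
    (mul_le_mul_of_nonneg_right (by linarith) measureReal_nonneg).trans h
  exact ⟨h, hh.mono heη, hfrac hplus, hfrac hminus⟩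

end Lamination

section Staircase

/-- The second derivatives `A` of `w` at which `∇(∂₀w)` and its flux `(-m ∂₁∂₁w, m ∂₀∂₁w)` are
related by one of the two phases: the second one, or the first one with vanishing `∂₀∂₁w`. -/
def phaseSet (K : ℝ) : Set (ℝ × ℝ × ℝ) :=
  {A | A.2.2 = -(K * A.1) ∨ (K * A.2.2 = -A.1 ∧ A.2.1 = 0)}

/-- The two lines of diagonal matrices along which the staircase laminate climbs. -/
def stairSet (ρ : ℝ) : Set (ℝ × ℝ × ℝ) :=
  {A | A.2.1 = 0 ∧ (A.2.2 = ρ * A.1 ∨ A.1 = ρ * A.2.2)}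

/-- The volume fraction that stays on the staircase when the norm is multiplied by `ρ`. -/
def keep (K ρ : ℝ) : ℝ := (K + ρ) / (ρ * (K * ρ + 1))

open Classical in
/-- The factor in `cost`. Its values are chosen so that a matrix off the staircase pays for the
splittings that put it there. -/
def costWeight (K m ρ p : ℝ) (A : ℝ × ℝ × ℝ) : ℝ :=
  if A ∈ stairSet ρ then 1 else if A.2.1 = 0 then (keep K ρ)⁻¹ else
    (2 + m) ^ p / (keep K ρ * (keep K ρ * ρ ^ p))

/-- A functional which dominates `‖A‖ ^ p` off `phaseSet K` and decreases on average along
suitable rank one splittings. -/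
def cost (K m ρ p : ℝ) : ℝ × ℝ × ℝ → ℝ :=
  (phaseSet K)ᶜ.indicator fun A => costWeight K m ρ p A * ‖A‖ ^ p

/-- A functional which increases on average along the same splittings as those of `cost`. -/
def gain (K ρ q : ℝ) : ℝ × ℝ × ℝ → ℝ :=
  (stairSet ρ \ phaseSet K).indicator fun A => ‖A‖ ^ q

lemma isClosed_phaseSet (K : ℝ) : IsClosed (phaseSet K) :=
  (isClosed_eq (by fun_prop) (by fun_prop)).union
    ((isClosed_eq (by fun_prop) (by fun_prop)).inter (isClosed_eq (by fun_prop) (by fun_prop)))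

lemma isClosed_stairSet (ρ : ℝ) : IsClosed (stairSet ρ) :=
  (isClosed_eq (by fun_prop) (by fun_prop)).inter
    ((isClosed_eq (by fun_prop) (by fun_prop)).union (isClosed_eq (by fun_prop) (by fun_prop)))

lemma zero_mem_phaseSet (K : ℝ) : (0 : ℝ × ℝ × ℝ) ∈ phaseSet K := by simp [phaseSet]

variable {K m ρ p q : ℝ}

lemma measurable_cost : Measurable (cost K m ρ p) := by
  classical
  refine Measurable.indicator (.mul ?_ (measurable_norm.pow_const p))
    (isClosed_phaseSet K).measurableSet.compl
  exact .ite (isClosed_stairSet ρ).measurableSet measurable_const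
    (.ite (isClosed_eq (by fun_prop) (by fun_prop)).measurableSet measurable_const
      measurable_const)

lemma measurable_gain : Measurable (gain K ρ q) :=
  (measurable_norm.pow_const q).indicator
    ((isClosed_stairSet ρ).measurableSet.diff (isClosed_phaseSet K).measurableSet)

lemma keep_pos (hK : 1 < K) (hρ : 1 < ρ) : 0 < keep K ρ := by unfold keep; positivity

lemma keep_lt_one (hK : 1 < K) (hρ : 1 < ρ) : keep K ρ < 1 := by
  rw [keep, div_lt_one (by positivity)]
  nlinarith [mul_pos (sub_pos.2 hK) (sub_pos.2 hρ), mul_pos (mul_pos (sub_pos.2 hρ) (sub_pos.2 hρ))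
    (sub_pos.2 hK)]

lemma cost_of_mem {A : ℝ × ℝ × ℝ} (hA : A ∈ phaseSet K) : cost K m ρ p A = 0 :=
  Set.indicator_of_notMem (by simpa using hA) _

lemma cost_of_notMem {A : ℝ × ℝ × ℝ} (hA : A ∉ phaseSet K) :
    cost K m ρ p A = costWeight K m ρ p A * ‖A‖ ^ p :=
  Set.indicator_of_mem hA _

lemma gain_of_mem {A : ℝ × ℝ × ℝ} (hA : A ∈ phaseSet K) : gain K ρ q A = 0 :=
  Set.indicator_of_notMem (fun h => h.2 hA) _

lemma gain_of_mem_stairSet {A : ℝ × ℝ × ℝ} (hA : A ∈ stairSet ρ) (hA' : A ∉ phaseSet K) :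
    gain K ρ q A = ‖A‖ ^ q :=
  Set.indicator_of_mem (show A ∈ stairSet ρ \ phaseSet K from ⟨hA, hA'⟩) _

lemma gain_of_notMem_stairSet {A : ℝ × ℝ × ℝ} (hA : A ∉ stairSet ρ) : gain K ρ q A = 0 :=
  Set.indicator_of_notMem (fun h => hA h.1) _

lemma gain_nonneg (A : ℝ × ℝ × ℝ) : 0 ≤ gain K ρ q A :=
  Set.indicator_nonneg (fun _ _ => by positivity) _

lemma gain_le_norm_rpow (A : ℝ × ℝ × ℝ) : gain K ρ q A ≤ ‖A‖ ^ q :=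
  Set.indicator_le_self' (fun _ _ => by positivity) _

lemma isTame_gain (hq : 0 ≤ q) : IsTame (gain K ρ q) :=
  isTame_of_abs_le measurable_gain (continuous_norm.rpow_const fun _ => Or.inr hq) fun A => by
    rw [abs_of_nonneg (gain_nonneg A)]
    exact gain_le_norm_rpow A

lemma norm_le_of_mem_stairSet (hρ : 1 < ρ) {A : ℝ × ℝ × ℝ} (hA : A ∈ stairSet ρ) :
    ‖A‖ ≤ ρ * |A.1| := by
  obtain ⟨a, b, d⟩ := A
  obtain ⟨rfl : b = 0, h : d = ρ * a ∨ a = ρ * d⟩ := hA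
  have ha : |a| ≤ ρ * |a| := le_mul_of_one_le_left (abs_nonneg a) hρ.le
  have hd : |d| ≤ ρ * |a| := by
    rcases h with rfl | rfl
    · exact (abs_mul ρ a).trans_le (by rw [abs_of_pos (one_pos.trans hρ)])
    · rw [abs_mul, abs_of_pos (one_pos.trans hρ)]
      nlinarith [mul_nonneg (mul_nonneg (sub_pos.2 hρ).le (by positivity : 0 ≤ ρ + 1))
        (abs_nonneg d)]
  simpa only [Prod.norm_mk, Real.norm_eq_abs, abs_zero] using
    max_le ha (max_le (by positivity) hd)

lemma gain_le (hρ : 1 < ρ) (hq : 0 ≤ q) (A : ℝ × ℝ × ℝ) : gain K ρ q A ≤ ρ ^ q * |A.1| ^ q := by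
  refine Set.indicator_apply_le' (fun hA => ?_) (fun _ => by positivity)
  rw [← Real.mul_rpow (by positivity) (abs_nonneg _)]
  exact Real.rpow_le_rpow (norm_nonneg _) (norm_le_of_mem_stairSet hρ hA.1) hq

section Weight

variable (hK : 1 < K) (hρ : 1 < ρ)
include hK hρ

lemma one_le_inv_keep : 1 ≤ (keep K ρ)⁻¹ :=
  (one_le_inv₀ (keep_pos hK hρ)).2 (keep_lt_one hK hρ).le

lemma costWeight_le_of_diagonal {A : ℝ × ℝ × ℝ} (hA : A.2.1 = 0) :
    costWeight K m ρ p A ≤ (keep K ρ)⁻¹ := by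
  unfold costWeight
  split_ifs
  exacts [one_le_inv_keep hK hρ, le_rfl]

lemma cost_le_of_diagonal {A : ℝ × ℝ × ℝ} (hA : A.2.1 = 0) :
    cost K m ρ p A ≤ (keep K ρ)⁻¹ * ‖A‖ ^ p := by
  have := keep_pos hK hρ
  refine Set.indicator_apply_le' (fun _ => ?_) (fun _ => by positivity)
  gcongr
  exact costWeight_le_of_diagonal hK hρ hA

lemma cost_nonneg (hm : 0 < m) (A : ℝ × ℝ × ℝ) : 0 ≤ cost K m ρ p A := by
  have := keep_pos hK hρ
  refine Set.indicator_nonneg (fun A _ => mul_nonneg ?_ (by positivity)) A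
  unfold costWeight
  split_ifs <;> positivity

variable (hm : 0 < m) (hp : 0 ≤ p) (hκ : keep K ρ * ρ ^ p < 1)
include hm hp hκ

lemma inv_keep_le : (keep K ρ)⁻¹ ≤ (2 + m) ^ p / (keep K ρ * (keep K ρ * ρ ^ p)) := by
  have hk := keep_pos hK hρ
  rw [← div_div, inv_eq_one_div, div_right_comm]
  gcongr
  rw [one_le_div (by positivity)]
  exact hκ.le.trans (Real.one_le_rpow (by linarith) hp)

lemma one_le_costWeight (A : ℝ × ℝ × ℝ) : 1 ≤ costWeight K m ρ p A := by
  have hinv := one_le_inv_keep hK hρ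
  unfold costWeight
  split_ifs
  exacts [le_rfl, hinv, hinv.trans (inv_keep_le hK hρ hm hp hκ)]

lemma costWeight_le (A : ℝ × ℝ × ℝ) :
    costWeight K m ρ p A ≤ (2 + m) ^ p / (keep K ρ * (keep K ρ * ρ ^ p)) := by
  have hle := inv_keep_le hK hρ hm hp hκ
  unfold costWeight
  split_ifs
  exacts [(one_le_inv_keep hK hρ).trans hle, hle, le_rfl]

lemma norm_rpow_le_cost {A : ℝ × ℝ × ℝ} (hA : A ∉ phaseSet K) : ‖A‖ ^ p ≤ cost K m ρ p A := by
  rw [cost_of_notMem hA]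
  exact le_mul_of_one_le_left (by positivity) (one_le_costWeight hK hρ hm hp hκ A)

lemma cost_le (A : ℝ × ℝ × ℝ) :
    cost K m ρ p A ≤ (2 + m) ^ p / (keep K ρ * (keep K ρ * ρ ^ p)) * ‖A‖ ^ p := by
  have hk := keep_pos hK hρ
  refine Set.indicator_apply_le' (fun _ => ?_) (fun _ => by positivity)
  gcongr
  exact costWeight_le hK hρ hm hp hκ A

lemma isTame_cost : IsTame (cost K m ρ p) :=
  isTame_of_abs_le measurable_cost
    (continuous_const.mul (continuous_norm.rpow_const fun _ => Or.inr hp)) fun A => by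
      rw [abs_of_nonneg (cost_nonneg hK hρ hm A)]
      exact cost_le hK hρ hm hp hκ A

end Weight

/-- `A` splits along a rank one line so that on average `cost` decreases by the factor `κ` and
`gain` increases by the factor `κ'`. -/
def Splits (m κ κ' C : ℝ) (cost gain : ℝ × ℝ × ℝ → ℝ) (A : ℝ × ℝ × ℝ) : Prop :=
  ∃ (n : Plane) (x y : ℝ), rankOne m n ≠ 0 ∧ 0 < x * y ∧
    max |x| |y| * ‖rankOne m n‖ ≤ C * ‖A‖ ∧
    y / (x + y) * cost (A + x • rankOne m n) + x / (x + y) * cost (A - y • rankOne m n) ≤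
      κ * cost A ∧
    κ' * gain A ≤
      y / (x + y) * gain (A + x • rankOne m n) + x / (x + y) * gain (A - y • rankOne m n)

lemma Splits.of_smul {κ κ' C : ℝ} {cost gain : ℝ × ℝ × ℝ → ℝ} {A v : ℝ × ℝ × ℝ} {n : Plane}
    {c s t : ℝ} (hn : rankOne m n = c • v) (hc : c ≠ 0) (hv : ‖v‖ = 1) (hst : 0 < s * t)
    (hs : |s| ≤ C * ‖A‖) (ht : |t| ≤ C * ‖A‖) (hcost₀ : cost (A + s • v) = 0)
    (hgain₀ : gain (A + s • v) = 0) (hcost : s / (s + t) * cost (A - t • v) ≤ κ * cost A)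
    (hgain : κ' * gain A ≤ s / (s + t) * gain (A - t • v)) :
    Splits m κ κ' C cost gain A := by
  have hsmul (z : ℝ) : (z / c) • rankOne m n = z • v := by rw [hn, smul_smul, div_mul_cancel₀ z hc]
  have hratio : s / c / (s / c + t / c) = s / (s + t) := by
    rw [← add_div, div_div_div_cancel_right₀ hc]
  refine ⟨n, s / c, t / c, ?_, ?_, ?_, ?_, ?_⟩
  · rw [hn]
    exact smul_ne_zero hc (norm_ne_zero_iff.1 (hv ▸ one_ne_zero))
  · rw [div_mul_div_comm]
    exact div_pos hst (mul_self_pos.2 hc)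
  · rw [hn, norm_smul, hv, mul_one, Real.norm_eq_abs, max_mul_of_nonneg _ _ (abs_nonneg c), abs_div,
      abs_div, div_mul_cancel₀ _ (abs_ne_zero.2 hc), div_mul_cancel₀ _ (abs_ne_zero.2 hc)]
    exact max_le hs ht
  · rwa [hsmul, hsmul, hcost₀, mul_zero, zero_add, hratio]
  · rwa [hsmul, hsmul, hgain₀, mul_zero, zero_add, hratio]

lemma swap_mem_phaseSet_iff {a d : ℝ} : (d, 0, a) ∈ phaseSet K ↔ (a, 0, d) ∈ phaseSet K := by
  simp only [phaseSet, Set.mem_ofPred_eq, and_true, eq_neg_iff_add_eq_zero]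
  rw [or_comm, add_comm a, add_comm (K * a)]

lemma swap_mem_stairSet_iff {a d : ℝ} : (d, 0, a) ∈ stairSet ρ ↔ (a, 0, d) ∈ stairSet ρ := by
  simp only [stairSet, Set.mem_ofPred_eq, true_and, or_comm]

lemma norm_swap (a d : ℝ) : ‖((d, 0, a) : ℝ × ℝ × ℝ)‖ = ‖((a, 0, d) : ℝ × ℝ × ℝ)‖ := by
  simp only [Prod.norm_mk, norm_zero, max_left_comm |d|, max_comm, Real.norm_eq_abs]

lemma norm_diagonal {a d : ℝ} (had : |a| ≤ |d|) : ‖((a, 0, d) : ℝ × ℝ × ℝ)‖ = |d| := by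
  rw [Prod.norm_mk, Prod.norm_mk, norm_zero, max_eq_right (norm_nonneg d)]
  exact max_eq_right had

lemma cost_swap (a d : ℝ) : cost K m ρ p (d, 0, a) = cost K m ρ p (a, 0, d) := by
  by_cases hA : (a, 0, d) ∈ phaseSet K
  · rw [cost_of_mem hA, cost_of_mem (swap_mem_phaseSet_iff.2 hA)]
  · rw [cost_of_notMem hA, cost_of_notMem (mt swap_mem_phaseSet_iff.1 hA), norm_swap a d]
    have hiff := swap_mem_stairSet_iff (ρ := ρ) (a := a) (d := d)
    unfold costWeight
    split_ifs <;> tauto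

lemma gain_swap (a d : ℝ) : gain K ρ q (d, 0, a) = gain K ρ q (a, 0, d) := by
  by_cases hA : (a, 0, d) ∈ phaseSet K
  · rw [gain_of_mem hA, gain_of_mem (swap_mem_phaseSet_iff.2 hA)]
  by_cases hA' : (a, 0, d) ∈ stairSet ρ
  · rw [gain_of_mem_stairSet hA' hA, ← norm_swap a d,
      gain_of_mem_stairSet (swap_mem_stairSet_iff.2 hA') (mt swap_mem_phaseSet_iff.1 hA)]
  · rw [gain_of_notMem_stairSet hA', gain_of_notMem_stairSet (mt swap_mem_stairSet_iff.1 hA')]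

section Diagonal

lemma ne_zero_of_notMem_phaseSet {a d : ℝ} (had : |a| ≤ |d|) (hA : (a, 0, d) ∉ phaseSet K) :
    d ≠ 0 := by
  rintro rfl
  obtain rfl := abs_nonpos_iff.1 (had.trans_eq abs_zero)
  exact hA (zero_mem_phaseSet K)

variable (hK : 1 < K) (hρ : 1 < ρ) {a d : ℝ}
include hK hρ

lemma climb_notMem_phaseSet (hd : d ≠ 0) : (ρ * d, 0, d) ∉ phaseSet K := by
  rintro (h | ⟨h, -⟩)
  · exact mul_ne_zero (by positivity : 1 + K * ρ ≠ 0) hd (by linear_combination h)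
  · exact mul_ne_zero (by positivity : K + ρ ≠ 0) hd (by linear_combination h)

omit hK in
lemma eq_mul_of_mem_stairSet (had : |a| ≤ |d|) (hd : d ≠ 0) (hA : (a, 0, d) ∈ stairSet ρ) :
    d = ρ * a := by
  obtain ⟨-, h | h⟩ := hA
  · exact h
  · rw [show a = ρ * d from h, abs_mul, abs_of_pos (one_pos.trans hρ)] at had
    exact absurd had (not_le.2 (lt_mul_of_one_lt_left (abs_pos.2 hd) hρ))

/-- One endpoint of the splitting is `(ρ * d, 0, d)`, the other one lies in `phaseSet K`. -/
lemma exists_increment (had : |a| ≤ |d|) (hA : (a, 0, d) ∉ phaseSet K) :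
    ∃ s, (a + s, 0, d) ∈ phaseSet K ∧ 0 < s * (a - ρ * d) ∧ |s| ≤ (1 + K) * |d| ∧
      ((a, 0, d) ∈ stairSet ρ → s / (s + (a - ρ * d)) = keep K ρ) := by
  have hd := ne_zero_of_notMem_phaseSet had hA
  by_cases hstair : (a, 0, d) ∈ stairSet ρ
  · obtain rfl := eq_mul_of_mem_stairSet hρ had hd hstair
    have ha : a ≠ 0 := right_ne_zero_of_mul hd
    refine ⟨-(ρ * a / K) - a, Or.inl ?_, ?_, ?_, fun _ => ?_⟩
    · simp only
      field_simp
      ring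
    · have hfac : (-(ρ * a / K) - a) * (a - ρ * (ρ * a)) = (ρ / K + 1) * (ρ ^ 2 - 1) * a ^ 2 := by
        ring
      have : 0 < ρ ^ 2 - 1 := sub_pos.2 (one_lt_pow₀ hρ two_ne_zero)
      rw [hfac]
      positivity
    · have hbound : |ρ * a / K| ≤ |ρ * a| := by
        rw [abs_div]
        exact div_le_self (abs_nonneg _) (hK.le.trans (le_abs_self K))
      calc |-(ρ * a / K) - a| ≤ |ρ * a / K| + |a| := by
            rw [← neg_add', abs_neg]; exact abs_add_le _ _
        _ ≤ |ρ * a| + |ρ * a| := add_le_add hbound had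
        _ ≤ (1 + K) * |ρ * a| := by nlinarith [abs_nonneg (ρ * a)]
    · have hsum : -(ρ * a / K) - a + (a - ρ * (ρ * a)) ≠ 0 := by
        have : -(ρ * a / K) - a + (a - ρ * (ρ * a)) = -((ρ / K + ρ ^ 2) * a) := by ring
        rw [this]
        exact neg_ne_zero.2 (mul_ne_zero (by positivity) ha)
      rw [keep, div_eq_div_iff hsum (by positivity)]
      field_simp
      ring
  · refine ⟨-(K * d) - a, Or.inr ⟨by ring, rfl⟩, ?_, ?_, fun h => absurd h hstair⟩
    · have hmul : |a * d| ≤ d * d := by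
        rw [abs_mul, ← abs_mul_abs_self d]
        gcongr
      have hleft : 0 < (K * d + a) * d := by
        nlinarith [neg_abs_le (a * d), mul_pos (sub_pos.2 hK) (mul_self_pos.2 hd)]
      have hright : 0 < (ρ * d - a) * d := by
        nlinarith [le_abs_self (a * d), mul_pos (sub_pos.2 hρ) (mul_self_pos.2 hd)]
      refine pos_of_mul_pos_left (b := d * d) ?_ (mul_self_nonneg d)
      calc 0 < (K * d + a) * d * ((ρ * d - a) * d) := mul_pos hleft hright
        _ = _ := by ring
    · calc |-(K * d) - a| ≤ |K * d| + |a| := by rw [← neg_add', abs_neg]; exact abs_add_le _ _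
        _ ≤ K * |d| + |d| := by rw [abs_mul, abs_of_pos (one_pos.trans hK)]; gcongr
        _ = (1 + K) * |d| := by ring

lemma average_climb_le (had : |a| ≤ |d|) (hA : (a, 0, d) ∉ phaseSet K)
    {s : ℝ} (hs : 0 < s * (a - ρ * d))
    (hkeep : (a, 0, d) ∈ stairSet ρ → s / (s + (a - ρ * d)) = keep K ρ) :
    s / (s + (a - ρ * d)) * cost K m ρ p (ρ * d, 0, d) ≤
        keep K ρ * ρ ^ p * cost K m ρ p (a, 0, d) ∧
      keep K ρ * ρ ^ q * gain K ρ q (a, 0, d) ≤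
        s / (s + (a - ρ * d)) * gain K ρ q (ρ * d, 0, d) := by
  have hd := ne_zero_of_notMem_phaseSet had hA
  have hclimb : (ρ * d, 0, d) ∈ stairSet ρ := ⟨rfl, Or.inr rfl⟩
  have hmem := climb_notMem_phaseSet hK hρ hd
  have hnorm := norm_diagonal had
  have hnorm' : ‖((ρ * d, 0, d) : ℝ × ℝ × ℝ)‖ = ρ * |d| := by
    have hρd : |ρ * d| = ρ * |d| := by rw [abs_mul, abs_of_pos (one_pos.trans hρ)]
    rw [← norm_swap, norm_diagonal, hρd]
    exact (le_mul_of_one_le_left (abs_nonneg d) hρ.le).trans_eq hρd.symm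
  rw [cost_of_notMem hmem, cost_of_notMem hA, gain_of_mem_stairSet hclimb hmem, hnorm, hnorm',
    Real.mul_rpow (by positivity) (abs_nonneg d), Real.mul_rpow (by positivity) (abs_nonneg d),
    costWeight, if_pos hclimb, one_mul]
  by_cases hstair : (a, 0, d) ∈ stairSet ρ
  · rw [gain_of_mem_stairSet hstair hA, hnorm, hkeep hstair, costWeight, if_pos hstair, one_mul,
      mul_assoc, mul_assoc]
    exact ⟨le_rfl, le_rfl⟩
  · have hweight : s / (s + (a - ρ * d)) ∈ Set.Ioo 0 1 := by
      rw [add_comm]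
      exact div_add_mem_Ioo_of_mul_pos (by rwa [mul_comm])
    rw [gain_of_notMem_stairSet hstair, mul_zero, costWeight, if_neg hstair, if_pos rfl]
    refine ⟨?_, mul_nonneg hweight.1.le (by positivity)⟩
    calc s / (s + (a - ρ * d)) * (ρ ^ p * |d| ^ p) ≤ ρ ^ p * |d| ^ p :=
          mul_le_of_le_one_left (by positivity) hweight.2.le
      _ = _ := by have := (keep_pos hK hρ).ne'; field_simp

lemma splits_diagonal_of_abs_le (hm : 0 < m) (had : |a| ≤ |d|) (hA : (a, 0, d) ∉ phaseSet K) :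
    Splits m (keep K ρ * ρ ^ p) (keep K ρ * ρ ^ q) ((1 + K) * (1 + m) + ρ) (cost K m ρ p)
        (gain K ρ q) (a, 0, d) ∧
      Splits m (keep K ρ * ρ ^ p) (keep K ρ * ρ ^ q) ((1 + K) * (1 + m) + ρ) (cost K m ρ p)
        (gain K ρ q) (d, 0, a) := by
  obtain ⟨s, hphase, hpos, hs, hkeep⟩ := exists_increment hK hρ had hA
  obtain ⟨hcost, hgain⟩ := average_climb_le (m := m) (p := p) (q := q) hK hρ had hA hpos hkeep
  have hC : 1 + K ≤ (1 + K) * (1 + m) + ρ := by nlinarith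
  have hsC : |s| ≤ ((1 + K) * (1 + m) + ρ) * |d| := hs.trans (by gcongr)
  have htC : |a - ρ * d| ≤ ((1 + K) * (1 + m) + ρ) * |d| := by
    calc |a - ρ * d| ≤ |a| + |ρ * d| := abs_sub _ _
      _ ≤ |d| + ρ * |d| := by rw [abs_mul, abs_of_pos (one_pos.trans hρ)]; gcongr
      _ = (1 + ρ) * |d| := by ring
      _ ≤ _ := by gcongr; nlinarith
  have hfst₁ : ((a, 0, d) : ℝ × ℝ × ℝ) + s • (1, 0, 0) = (a + s, 0, d) := by simp
  have hfst₂ : ((a, 0, d) : ℝ × ℝ × ℝ) - (a - ρ * d) • (1, 0, 0) = (ρ * d, 0, d) := by simp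
  have hsnd₁ : ((d, 0, a) : ℝ × ℝ × ℝ) + s • (0, 0, 1) = (d, 0, a + s) := by simp
  have hsnd₂ : ((d, 0, a) : ℝ × ℝ × ℝ) - (a - ρ * d) • (0, 0, 1) = (d, 0, ρ * d) := by simp
  have hphase' := swap_mem_phaseSet_iff.2 hphase
  rw [← norm_diagonal had] at hsC htC
  constructor
  · refine .of_smul (n := !₂[1, 0]) (c := 1) (v := (1, 0, 0)) (s := s) (t := a - ρ * d)
      (by simp [rankOne]) one_ne_zero (by simp) hpos hsC htC ?_ ?_ ?_ ?_
    · rw [hfst₁, cost_of_mem hphase]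
    · rw [hfst₁, gain_of_mem hphase]
    · rwa [hfst₂]
    · rwa [hfst₂]
  · rw [← norm_swap] at hsC htC
    refine .of_smul (n := !₂[0, 1]) (c := m) (v := (0, 0, 1)) (s := s) (t := a - ρ * d)
      (by simp [rankOne]) hm.ne' (by simp) hpos hsC htC ?_ ?_ ?_ ?_
    · rw [hsnd₁, cost_of_mem hphase']
    · rw [hsnd₁, gain_of_mem hphase']
    · rwa [hsnd₂, cost_swap (ρ * d) d, cost_swap a d]
    · rwa [hsnd₂, gain_swap (ρ * d) d, gain_swap a d]

end Diagonal

section OffDiagonal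

variable {a b d : ℝ}

lemma exists_increments_offDiagonal (hK : 1 < K) (hm : 0 < m) (hb : b ≠ 0)
    (hA : (a, b, d) ∉ phaseSet K) :
    ∃ s x y : ℝ, |s| = 1 ∧ 0 < x * y ∧ |x| ≤ (1 + K) * ‖(a, b, d)‖ ∧ |y| ≤ ‖(a, b, d)‖ ∧
      (a, b, d) + x • (1, s, m) ∈ phaseSet K ∧ ((a, b, d) - y • (1, s, m)).2.1 = 0 := by
  have hKm : 0 < K + m := by positivity
  have ha : |a| ≤ ‖(a, b, d)‖ := norm_fst_le (a, b, d)
  have hbd : ‖(b, d)‖ ≤ ‖(a, b, d)‖ := norm_snd_le (a, b, d)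
  have hx : -(d + K * a) / (K + m) ≠ 0 := by
    refine div_ne_zero (fun h => hA (Or.inl ?_)) hKm.ne'
    linear_combination -h
  obtain ⟨s, hs, hpos⟩ : ∃ s : ℝ, |s| = 1 ∧ 0 < -(d + K * a) / (K + m) * (s * b) := by
    rcases lt_or_gt_of_ne (mul_ne_zero hx hb) with h | h
    · exact ⟨-1, by simp, by linarith⟩
    · exact ⟨1, by simp, by linarith⟩
  have hss : s * s = 1 := by rw [← abs_mul_abs_self, hs, one_mul]
  refine ⟨s, _, s * b, hs, hpos, ?_, ?_, Or.inl ?_, ?_⟩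
  · rw [abs_div, abs_neg, abs_of_pos hKm]
    calc |d + K * a| / (K + m) ≤ |d + K * a| := div_le_self (abs_nonneg _) (by linarith)
      _ ≤ |d| + K * |a| := by
        rw [← abs_of_pos (one_pos.trans hK), ← abs_mul]
        exact (abs_add_le _ _).trans_eq (by rw [abs_of_pos (one_pos.trans hK)])
      _ ≤ ‖(a, b, d)‖ + K * ‖(a, b, d)‖ := by
        gcongr
        exact (norm_snd_le (b, d)).trans hbd
      _ = (1 + K) * ‖(a, b, d)‖ := by ring
  · rw [abs_mul, hs, one_mul]
    exact (norm_fst_le (b, d)).trans hbd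
  · simp only [Prod.smul_mk, Prod.mk_add_mk, smul_eq_mul]
    field_simp
    ring
  · simp only [Prod.smul_mk, Prod.mk_sub_mk, smul_eq_mul]
    linear_combination -b * hss

lemma splits_offDiagonal (hK : 1 < K) (hm : 0 < m) (hρ : 1 < ρ) (hp : 0 ≤ p) (hb : b ≠ 0)
    (hA : (a, b, d) ∉ phaseSet K) :
    Splits m (keep K ρ * ρ ^ p) (keep K ρ * ρ ^ q) ((1 + K) * (1 + m) + ρ) (cost K m ρ p)
      (gain K ρ q) (a, b, d) := by
  obtain ⟨s, x, y, hs, hxy, hx, hy, hphase, hdiag⟩ := exists_increments_offDiagonal hK hm hb hA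
  have hk := keep_pos hK hρ
  have hq : rankOne m !₂[1, s] = (1, s, m) := by
    have hsq : s ^ 2 = 1 := by rw [← sq_abs, hs, one_pow]
    simp [rankOne, hsq]
  have hnorm : ‖((1, s, m) : ℝ × ℝ × ℝ)‖ ≤ 1 + m := by
    simp only [Prod.norm_mk, Real.norm_eq_abs, hs, abs_one, abs_of_pos hm, sup_le_iff]
    exact ⟨by linarith, by linarith, by linarith⟩
  obtain ⟨hweight0, hweight1⟩ : x / (x + y) ∈ Set.Ioo 0 1 := by
    rw [add_comm]
    exact div_add_mem_Ioo_of_mul_pos (by rwa [mul_comm])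
  have hstair : (a, b, d) ∉ stairSet ρ := fun h => hb h.1
  have hle : ‖(a, b, d) - y • (1, s, m)‖ ≤ (2 + m) * ‖(a, b, d)‖ := by
    calc _ ≤ ‖(a, b, d)‖ + |y| * ‖((1, s, m) : ℝ × ℝ × ℝ)‖ :=
          (norm_sub_le _ _).trans_eq (by rw [norm_smul, Real.norm_eq_abs])
      _ ≤ ‖(a, b, d)‖ + ‖(a, b, d)‖ * (1 + m) := by gcongr
      _ = _ := by ring
  refine ⟨!₂[1, s], x, y, ?_, hxy, ?_, ?_, ?_⟩
  · simp [hq]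
  · rw [hq]
    calc _ ≤ (1 + K) * ‖(a, b, d)‖ * (1 + m) := by
          gcongr
          exact max_le hx (hy.trans (le_mul_of_one_le_left (norm_nonneg _) (by linarith)))
      _ ≤ ((1 + K) * (1 + m) + ρ) * ‖(a, b, d)‖ := by
          nlinarith [mul_nonneg (zero_le_one.trans hρ.le) (norm_nonneg (a, b, d))]
  · rw [hq, cost_of_mem hphase, mul_zero, zero_add]
    calc _ ≤ cost K m ρ p ((a, b, d) - y • (1, s, m)) :=
          mul_le_of_le_one_left (cost_nonneg hK hρ hm _) hweight1.le
      _ ≤ (keep K ρ)⁻¹ * ((2 + m) * ‖(a, b, d)‖) ^ p :=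
          (cost_le_of_diagonal hK hρ hdiag).trans (by gcongr)
      _ = _ := by
          rw [cost_of_notMem hA, costWeight, if_neg hstair, if_neg hb,
            Real.mul_rpow (by positivity) (norm_nonneg _)]
          field_simp
  · rw [gain_of_notMem_stairSet hstair, mul_zero]
    have hweight := div_add_mem_Ioo_of_mul_pos hxy
    exact add_nonneg (mul_nonneg hweight.1.le (gain_nonneg _))
      (mul_nonneg hweight0.le (gain_nonneg _))

end OffDiagonal

theorem splits_of_notMem_phaseSet (hK : 1 < K) (hm : 0 < m) (hρ : 1 < ρ) (hp : 0 ≤ p)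
    {A : ℝ × ℝ × ℝ} (hA : A ∉ phaseSet K) :
    Splits m (keep K ρ * ρ ^ p) (keep K ρ * ρ ^ q) ((1 + K) * (1 + m) + ρ) (cost K m ρ p)
      (gain K ρ q) A := by
  obtain ⟨a, b, d⟩ := A
  rcases eq_or_ne b 0 with rfl | hb
  · rcases le_total |a| |d| with had | hda
    · exact (splits_diagonal_of_abs_le hK hρ hm had hA).1
    · exact (splits_diagonal_of_abs_le hK hρ hm hda (mt swap_mem_phaseSet_iff.1 hA)).2
  · exact splits_offDiagonal hK hm hρ hp hb hA

/-- The logarithm of `keep K ρ * ρ ^ s`, the factor by which the average of `‖A‖ ^ s` over the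
staircase changes in one splitting. -/
def logKeep (K s ρ : ℝ) : ℝ := (s - 1) * Real.log ρ + Real.log (K + ρ) - Real.log (K * ρ + 1)

section Exponent

variable {s : ℝ}

lemma exp_logKeep (hK : 0 < K) (hρ : 0 < ρ) :
    Real.exp (logKeep K s ρ) = keep K ρ * ρ ^ s := by
  rw [logKeep, Real.exp_sub, Real.exp_add, Real.exp_log (by positivity),
    Real.exp_log (by positivity), mul_comm (s - 1), ← Real.rpow_def_of_pos hρ,
    Real.rpow_sub_one hρ.ne', keep]
  field_simp

lemma logKeep_one (K s : ℝ) : logKeep K s 1 = 0 := by simp [logKeep]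

/-- The critical exponent: `logKeep K s 1 = 0`, and the derivative at `ρ = 1` changes sign at
`s = 2 * K / (K + 1)`. -/
lemma hasDerivAt_logKeep (hK : 0 < K) (hρ : 0 < ρ) :
    HasDerivAt (logKeep K s) ((s - 2 * K / (K + 1)) / ρ +
      K * (K - 1) * (ρ - 1) ^ 2 / (ρ * (K + 1) * (K + ρ) * (K * ρ + 1))) ρ := by
  have hlog := (Real.hasDerivAt_log hρ.ne').const_mul (s - 1)
  have hadd := ((hasDerivAt_id ρ).const_add K).log (by positivity : K + ρ ≠ 0)
  have hmul := (((hasDerivAt_id ρ).const_mul K).add_const 1).log (by positivity : K * ρ + 1 ≠ 0)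
  refine ((hlog.add hadd).sub hmul).congr_deriv ?_
  simp only [id_eq]
  field_simp
  ring

lemma logKeep_pos (hK : 1 < K) (hρ : 1 < ρ) : 0 < logKeep K (2 * K / (K + 1)) ρ := by
  have hderiv {t : ℝ} (ht : 1 ≤ t) := hasDerivAt_logKeep (s := 2 * K / (K + 1))
    (zero_lt_one.trans hK) (zero_lt_one.trans_le ht)
  have hmono : StrictMonoOn (logKeep K (2 * K / (K + 1))) (Set.Ici 1) := by
    refine strictMonoOn_of_deriv_pos (convex_Ici 1)
      (fun t ht => (hderiv ht).continuousAt.continuousWithinAt) fun t ht => ?_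
    rw [interior_Ici] at ht
    have ht1 : 0 < t - 1 := sub_pos.2 ht
    have ht0 : 0 < t := by linarith
    have : 0 < K - 1 := sub_pos.2 hK
    rw [(hderiv (le_of_lt ht)).deriv, sub_self, zero_div, zero_add]
    positivity
  simpa only [logKeep_one] using hmono Set.self_mem_Ici hρ.le hρ

lemma exists_logKeep_neg (hK : 0 < K) (hs : s < 2 * K / (K + 1)) :
    ∃ ρ, 1 < ρ ∧ logKeep K s ρ < 0 := by
  have hslope := (hasDerivAt_iff_tendsto_slope.1 (hasDerivAt_logKeep (s := s) hK one_pos)).mono_left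
    (nhdsGT_le_nhdsNE 1)
  have hneg := hslope.eventually_lt_const (by simpa using hs : _ < (0 : ℝ))
  obtain ⟨ρ, hlt, hρ : 1 < ρ⟩ := (hneg.and self_mem_nhdsWithin).exists
  rw [slope_def_field, logKeep_one, sub_zero, div_lt_iff₀ (sub_pos.2 hρ), zero_mul] at hlt
  exact ⟨ρ, hρ, hlt⟩

lemma exists_keep_mul_rpow (hK : 1 < K) (hs : s < 2 * K / (K + 1)) :
    ∃ ρ, 1 < ρ ∧ keep K ρ * ρ ^ s < 1 ∧ 1 < keep K ρ * ρ ^ (2 * K / (K + 1)) := by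
  have hK0 := zero_lt_one.trans hK
  obtain ⟨ρ, hρ, hneg⟩ := exists_logKeep_neg hK0 hs
  refine ⟨ρ, hρ, ?_, ?_⟩
  · rw [← exp_logKeep hK0 (zero_lt_one.trans hρ)]
    exact Real.exp_lt_one_iff.2 hneg
  · rw [← exp_logKeep hK0 (zero_lt_one.trans hρ)]
    exact Real.one_lt_exp_iff.2 (logKeep_pos hK hρ)

end Exponent

end Staircase

/-- The functionals `cost` and `gain` improve by the factors `κ` and `κ'` under splittings of the
points off `S`, which is the set of second derivatives to be reached. -/
structure IsSplitScheme (m p κ κ' C : ℝ) (S : Set (ℝ × ℝ × ℝ)) (cost gain : ℝ × ℝ × ℝ → ℝ) :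
    Prop where
  tame_cost : IsTame cost
  tame_gain : IsTame gain
  cost_eq_zero : ∀ A ∈ S, cost A = 0
  gain_eq_zero : ∀ A ∈ S, gain A = 0
  norm_rpow_le_cost : ∀ A ∉ S, ‖A‖ ^ p ≤ cost A
  splits : ∀ A ∉ S, Splits m κ κ' C cost gain A

theorem isSplitScheme_staircase {K m ρ p q : ℝ} (hK : 1 < K) (hm : 0 < m) (hρ : 1 < ρ)
    (hp : 0 ≤ p) (hq : 0 ≤ q) (hκ : keep K ρ * ρ ^ p < 1) :
    IsSplitScheme m p (keep K ρ * ρ ^ p) (keep K ρ * ρ ^ q) ((1 + K) * (1 + m) + ρ) (phaseSet K)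
      (cost K m ρ p) (gain K ρ q) where
  tame_cost := isTame_cost hK hρ hm hp hκ
  tame_gain := isTame_gain hq
  cost_eq_zero _ := cost_of_mem
  gain_eq_zero _ := gain_of_mem
  norm_rpow_le_cost _ := norm_rpow_le_cost hK hρ hm hp hκ
  splits _ := splits_of_notMem_phaseSet hK hm hρ hp

section Packing

variable {α : Type*} [MeasurableSpace α] {μ : Measure α} {Ω : Set α} {ε : ℝ}

lemma exists_finset_measureReal_sdiff_le {ι : Type*} {t : Set ι} (ht : t.Countable)
    {B : ι → Set α} (hB : ∀ i ∈ t, MeasurableSet (B i)) (hΩ : MeasurableSet Ω) (hfin : μ Ω ≠ ∞)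
    (hcov : μ (Ω \ ⋃ i ∈ t, B i) = 0) (hε : 0 < ε) :
    ∃ u : Finset ι, ↑u ⊆ t ∧ μ.real (Ω \ ⋃ i ∈ u, B i) ≤ ε := by
  classical
  have : Countable t := ht.to_subtype
  let rest (v : Finset t) : Set α := Ω \ ⋃ i ∈ v, B i
  have hrest (v : Finset t) : NullMeasurableSet (rest v) μ :=
    (hΩ.diff (v.measurableSet_biUnion fun i _ => hB i i.2)).nullMeasurableSet
  have hanti : Antitone rest := fun v v' hv =>
    Set.sdiff_subset_sdiff_right (Set.biUnion_subset_biUnion_left hv)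
  have hinter : ⋂ v, rest v ⊆ Ω \ ⋃ i ∈ t, B i := fun x hx => by
    refine ⟨(Set.mem_iInter.1 hx ∅).1, fun hxt => ?_⟩
    obtain ⟨i, hi, hxi⟩ := Set.mem_iUnion₂.1 hxt
    exact (Set.mem_iInter.1 hx {⟨i, hi⟩}).2 (Set.mem_biUnion (Finset.mem_singleton_self _) hxi)
  have hlim := tendsto_measure_iInter_atTop hrest hanti
    ⟨∅, measure_ne_top_of_subset Set.sdiff_subset hfin⟩
  rw [measure_mono_null hinter hcov] at hlim
  obtain ⟨v, hv⟩ := (hlim.eventually_lt_const (ENNReal.ofReal_pos.2 hε)).exists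
  refine ⟨v.map (Function.Embedding.subtype _), fun i hi => ?_, ?_⟩
  · obtain ⟨j, -, rfl⟩ := Finset.mem_map.1 hi
    exact j.2
  · simp only [Finset.mem_map, Set.iUnion_exists, Set.biUnion_and', Set.iUnion_iUnion_eq_right]
    exact ENNReal.toReal_le_of_le_ofReal hε.le hv.le

lemma setIntegral_eq_sum_add {E ι : Type*} [NormedAddCommGroup E] [NormedSpace ℝ E]
    (hΩ : MeasurableSet Ω) {f : α → E}
    (hf : IntegrableOn f Ω μ) {t : Finset ι} {Q : ι → Set α}
    (hQ : ∀ i ∈ t, MeasurableSet (Q i)) (hQΩ : ∀ i ∈ t, Q i ⊆ Ω)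
    (hd : (t : Set ι).PairwiseDisjoint Q) :
    ∫ z in Ω, f z ∂μ = ∑ i ∈ t, (∫ z in Q i, f z ∂μ) + ∫ z in Ω \ ⋃ i ∈ t, Q i, f z ∂μ := by
  have hm : MeasurableSet (⋃ i ∈ t, Q i) := t.measurableSet_biUnion hQ
  have hsub : (⋃ i ∈ t, Q i) ⊆ Ω := Set.iUnion₂_subset hQΩ
  rw [← integral_biUnion_finset t hQ hd fun i hi => hf.mono_set (hQΩ i hi),
    ← setIntegral_union Set.disjoint_sdiff_right (hΩ.diff hm) (hf.mono_set hsub)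
      (hf.mono_set Set.sdiff_subset), Set.union_sdiff_cancel hsub]

lemma setIntegral_le_of_pieces {ι : Type*} (hΩ : MeasurableSet Ω) (hfin : μ Ω ≠ ∞) {f : α → ℝ}
    (hf : IntegrableOn f Ω μ) {t : Finset ι} {Q : ι → Set α} (hQ : ∀ i ∈ t, MeasurableSet (Q i))
    (hQΩ : ∀ i ∈ t, Q i ⊆ Ω) (hd : (t : Set ι).PairwiseDisjoint Q) {η b : ℝ} (hη : 0 ≤ η)
    (hfQ : ∀ i ∈ t, ∫ z in Q i, f z ∂μ ≤ η * μ.real (Q i))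
    (hfb : ∀ z ∈ Ω \ ⋃ i ∈ t, Q i, |f z| ≤ b) :
    ∫ z in Ω, f z ∂μ ≤ η * μ.real Ω + b * μ.real (Ω \ ⋃ i ∈ t, Q i) := by
  rw [setIntegral_eq_sum_add hΩ hf hQ hQΩ hd]
  refine add_le_add ?_ ((Real.le_norm_self _).trans (norm_setIntegral_le_of_norm_le_const
    (measure_ne_top_of_subset Set.sdiff_subset hfin).lt_top hfb))
  calc ∑ i ∈ t, ∫ z in Q i, f z ∂μ ≤ ∑ i ∈ t, η * μ.real (Q i) := Finset.sum_le_sum hfQ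
    _ = η * μ.real (⋃ i ∈ t, Q i) := by
      rw [← Finset.mul_sum, measureReal_biUnion_finset hd hQ fun i hi =>
        measure_ne_top_of_subset (hQΩ i hi) hfin]
    _ ≤ η * μ.real Ω :=
      mul_le_mul_of_nonneg_left (measureReal_mono (Set.iUnion₂_subset hQΩ) hfin) hη

variable [MetricSpace α] [SecondCountableTopology α] [HasBesicovitchCovering α]

lemma exists_finset_closedBall_packing [OpensMeasurableSpace α] [SFinite μ] (hΩ : IsOpen Ω)
    (hfin : μ Ω ≠ ∞) {good : α → ℝ → Prop} (hgood : ∀ᵐ x ∂μ, ∀ᶠ r in 𝓝[>] 0, good x r)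
    (hε : 0 < ε) :
    ∃ (t : Finset α) (r : α → ℝ), (∀ x ∈ t, good x (r x)) ∧
      (∀ x ∈ t, Metric.closedBall x (r x) ⊆ Ω) ∧
      (t : Set α).PairwiseDisjoint (fun x => Metric.closedBall x (r x)) ∧
      μ.real (Ω \ ⋃ x ∈ t, Metric.closedBall x (r x)) ≤ ε := by
  let admissible (x : α) : Set ℝ := {r | Metric.closedBall x r ⊆ Ω ∧ good x r}
  let centers : Set α := {x | x ∈ Ω ∧ ∀ᶠ r in 𝓝[>] 0, good x r}
  have hsmall : ∀ x ∈ centers, ∀ δ > 0, (admissible x ∩ Set.Ioo 0 δ).Nonempty :=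
    fun x hx δ hδ => by
    have hsub : ∀ᶠ r in 𝓝[>] 0, Metric.closedBall x r ⊆ Ω :=
      (eventually_closedBall_subset (hΩ.mem_nhds hx.1)).filter_mono nhdsWithin_le_nhds
    exact ((hsub.and hx.2).and (Ioo_mem_nhdsGT hδ)).exists
  obtain ⟨t, r, htc, -, hr, hcov, hdisj⟩ :=
    Besicovitch.exists_disjoint_closedBall_covering_ae μ admissible centers hsmall (fun _ => 1)
      fun _ _ => one_pos
  have hnull : μ (Ω \ ⋃ x ∈ t, Metric.closedBall x (r x)) = 0 := by
    refine measure_mono_null (fun x hx => ?_) (measure_union_null hcov hgood)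
    by_cases hxg : ∀ᶠ r in 𝓝[>] 0, good x r
    · exact Or.inl ⟨⟨hx.1, hxg⟩, hx.2⟩
    · exact Or.inr hxg
  obtain ⟨u, hut, hu⟩ := exists_finset_measureReal_sdiff_le htc
    (fun x _ => measurableSet_closedBall) hΩ.measurableSet hfin hnull hε
  exact ⟨u, r, fun x hx => (hr x (hut hx)).1.2, fun x hx => (hr x (hut hx)).1.1,
    hdisj.subset hut, hu⟩

lemma ae_eventually_norm_setIntegral_sub_le [BorelSpace α] [IsLocallyFiniteMeasure μ] {E : Type*}
    [NormedAddCommGroup E] [NormedSpace ℝ E] [CompleteSpace E] {f : α → E}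
    (hf : LocallyIntegrable f μ) :
    ∀ᵐ x ∂μ, ∀ η > 0, ∀ᶠ r in 𝓝[>] (0 : ℝ),
      ‖(∫ z in Metric.closedBall x r, f z ∂μ) - μ.real (Metric.closedBall x r) • f x‖ ≤
        η * μ.real (Metric.closedBall x r) := by
  filter_upwards [(Besicovitch.vitaliFamily μ).ae_tendsto_average hf] with x hx η hη
  have hfinite : ∀ᶠ r in 𝓝[>] (0 : ℝ), μ (Metric.closedBall x r) < ∞ := by
    obtain ⟨s, hs, hμs⟩ := μ.finiteAt_nhds x
    filter_upwards [(eventually_closedBall_subset hs).filter_mono nhdsWithin_le_nhds] with r hr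
    exact (measure_mono hr).trans_lt hμs
  filter_upwards [Metric.tendsto_nhds.1 (hx.comp (Besicovitch.tendsto_filterAt μ x)) η hη, hfinite]
    with r hr hμr
  rw [← measure_smul_setAverage f hμr.ne, ← smul_sub, norm_smul, Real.norm_of_nonneg
    measureReal_nonneg, mul_comm]
  exact mul_le_mul_of_nonneg_right (dist_eq_norm (E := E) _ _ ▸ hr.le) measureReal_nonneg

end Packing

section Patch

variable {ι : Type*} {t : Finset ι} {Q : ι → Set Plane} {h : ι → Plane → ℝ} {z : Plane}

lemma sum_eq_of_mem_of_pairwiseDisjoint {E : Type*} [AddCommMonoid E] (D : (Plane → ℝ) → Plane → E)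
    (hD : ∀ f, ∀ x ∉ tsupport f, D f x = 0) (hd : (t : Set ι).PairwiseDisjoint Q)
    (hhQ : ∀ i ∈ t, tsupport (h i) ⊆ Q i) {i : ι} (hi : i ∈ t) (hz : z ∈ Q i) :
    ∑ j ∈ t, D (h j) z = D (h i) z :=
  Finset.sum_eq_single_of_mem i hi fun j hj hji => hD _ _ fun hzj =>
    Set.disjoint_left.1 (hd hj hi hji) (hhQ j hj hzj) hz

lemma sum_eq_zero_of_notMem_biUnion {E : Type*} [AddCommMonoid E] (D : (Plane → ℝ) → Plane → E)
    (hD : ∀ f, ∀ x ∉ tsupport f, D f x = 0) (hhQ : ∀ i ∈ t, tsupport (h i) ⊆ Q i)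
    (hz : z ∉ ⋃ i ∈ t, Q i) : ∑ j ∈ t, D (h j) z = 0 :=
  Finset.sum_eq_zero fun _ hj => hD _ _ fun hzj => hz (Set.mem_biUnion hj (hhQ _ hj hzj))

/-- A perturbation `h` of `w`, supported in a small ball, after which the integrals over that ball
of the functionals `F i` of the old second derivatives and their increments are at most `c i`, up
to a small error. -/
structure IsLocalStep (m : ℝ) (F : ι → (ℝ × ℝ × ℝ) × (ℝ × ℝ × ℝ) → ℝ) (w : Plane → ℝ) (x₀ : Plane)
    (r η : ℝ) (c : ι → ℝ) (h : Plane → ℝ) : Prop where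
  smooth : Smooth h
  tsupport_subset : tsupport h ⊆ Metric.ball x₀ r
  abs_pd_zero_le : ∀ z, |pd 0 h z| ≤ η
  setIntegral_le : ∀ i, ∫ z in Metric.closedBall x₀ r, F i (hess m w z, hess m h z) ≤
    c i + η * volume.real (Metric.closedBall x₀ r)

lemma IsLocalStep.isTestFunction {m : ℝ} {F : ι → (ℝ × ℝ × ℝ) × (ℝ × ℝ × ℝ) → ℝ} {w : Plane → ℝ}
    {x₀ : Plane} {r η : ℝ} {c : ι → ℝ} {h : Plane → ℝ} (hh : IsLocalStep m F w x₀ r η c h)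
    {Ω : Set Plane} (hΩ : Metric.closedBall x₀ r ⊆ Ω) : IsTestFunction Ω h :=
  have hsub : tsupport h ⊆ Metric.closedBall x₀ r :=
    hh.tsupport_subset.trans Metric.ball_subset_closedBall
  ⟨hh.smooth, (isCompact_closedBall x₀ r).of_isClosed_subset (isClosed_tsupport h) hsub,
    hsub.trans hΩ⟩

end Patch

section Gluing

variable {ι : Type*} {m : ℝ} {F : ι → (ℝ × ℝ × ℝ) × (ℝ × ℝ × ℝ) → ℝ} {G : ι → ℝ × ℝ × ℝ → ℝ}
  {w : Plane → ℝ} {Ω : Set Plane} {t : Finset Plane} {r : Plane → ℝ} {h : Plane → Plane → ℝ}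
  {η b : ℝ}

lemma abs_pd_zero_sum_le (hη : 0 ≤ η)
    (hd : (t : Set Plane).PairwiseDisjoint fun x => Metric.closedBall x (r x))
    {c : Plane → ι → ℝ} (hh : ∀ x ∈ t, IsLocalStep m F w x (r x) η (c x) (h x)) (z : Plane) :
    |pd 0 (fun y => ∑ x ∈ t, h x y) z| ≤ η := by
  have hsub : ∀ x ∈ t, tsupport (h x) ⊆ Metric.closedBall x (r x) := fun x hx =>
    (hh x hx).tsupport_subset.trans Metric.ball_subset_closedBall
  have hpd : ∀ f : Plane → ℝ, ∀ x ∉ tsupport f, pd 0 f x = 0 := fun _ _ hx =>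
    pd_eq_zero_of_notMem hx 0
  rw [congrFun (pd_sum t (fun x hx => (hh x hx).smooth.differentiable) 0) z]
  by_cases hz : z ∈ ⋃ x ∈ t, Metric.closedBall x (r x)
  · obtain ⟨x, hx, hzx⟩ := Set.mem_iUnion₂.1 hz
    rw [sum_eq_of_mem_of_pairwiseDisjoint (pd 0) hpd hd hsub hx hzx]
    exact (hh x hx).abs_pd_zero_le z
  · rw [sum_eq_zero_of_notMem_biUnion (pd 0) hpd hsub hz, abs_zero]
    exact hη

lemma setIntegral_sum_le (hΩ : MeasurableSet Ω) (hΩb : Bornology.IsBounded Ω) (hw : Smooth w)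
    (hη : 0 ≤ η) {i : ι} (hF : IsTame (F i)) (hG : IsTame (G i))
    (hd : (t : Set Plane).PairwiseDisjoint fun x => Metric.closedBall x (r x))
    (htΩ : ∀ x ∈ t, Metric.closedBall x (r x) ⊆ Ω)
    (hh : ∀ x ∈ t, IsLocalStep m F w x (r x) η
      (fun i => ∫ z in Metric.closedBall x (r x), G i (hess m w z)) (h x))
    (hb : ∀ z ∈ Ω, |F i (hess m w z, 0) - G i (hess m w z)| ≤ b) :
    ∫ z in Ω, F i (hess m w z, hess m (fun y => ∑ x ∈ t, h x y) z) ≤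
      (∫ z in Ω, G i (hess m w z)) + η * volume.real Ω +
        b * volume.real (Ω \ ⋃ x ∈ t, Metric.closedBall x (r x)) := by
  set H : Plane → ℝ := fun y => ∑ x ∈ t, h x y
  set Q : Plane → Set Plane := fun x => Metric.closedBall x (r x)
  have hsub : ∀ x ∈ t, tsupport (h x) ⊆ Q x := fun x hx =>
    (hh x hx).tsupport_subset.trans Metric.ball_subset_closedBall
  have hHess : hess m H = fun z => ∑ x ∈ t, hess m (h x) z :=
    hess_sum t fun x hx => (hh x hx).smooth
  have hzero : ∀ f : Plane → ℝ, ∀ x ∉ tsupport f, hess m f x = 0 := fun _ _ =>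
    hess_eq_zero_of_notMem
  have hFint : IntegrableOn (fun z => F i (hess m w z, hess m H z)) Ω :=
    (hF.comp ((continuous_hess hw).prodMk (continuous_hess
      (ContDiff.sum fun x hx => (hh x hx).smooth)))).integrableOn_isBounded hΩb
  have hGint : IntegrableOn (fun z => G i (hess m w z)) Ω :=
    (hG.comp (continuous_hess hw)).integrableOn_isBounded hΩb
  rw [add_assoc, ← sub_le_iff_le_add', ← integral_sub hFint hGint]
  refine setIntegral_le_of_pieces hΩ hΩb.measure_lt_top.ne (hFint.sub hGint)
    (fun _ _ => measurableSet_closedBall) htΩ hd hη (fun x hx => ?_) fun z hz => ?_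
  · rw [integral_sub' (hFint.mono_set (htΩ x hx)) (hGint.mono_set (htΩ x hx)), sub_le_iff_le_add',
      setIntegral_congr_fun measurableSet_closedBall fun z hz => by
        rw [congrFun hHess z, sum_eq_of_mem_of_pairwiseDisjoint (hess m) hzero hd hsub hx hz]]
    exact (hh x hx).setIntegral_le i
  · rw [Pi.sub_apply, congrFun hHess z, sum_eq_zero_of_notMem_biUnion (hess m) hzero hsub hz.2]
    exact hb z hz.1

theorem exists_isTestFunction_setIntegral_le [Finite ι] (hΩ : IsOpen Ω)
    (hΩb : Bornology.IsBounded Ω) (hw : Smooth w) (hF : ∀ i, IsTame (F i))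
    (hG : ∀ i, IsTame (G i))
    (hloc : ∀ η > 0, ∀ᵐ x, ∀ᶠ r in 𝓝[>] 0, ∃ h, IsLocalStep m F w x r η
      (fun i => ∫ z in Metric.closedBall x r, G i (hess m w z)) h) (hη : 0 < η) :
    ∃ h, IsTestFunction Ω h ∧ (∀ z, |pd 0 h z| ≤ η) ∧ ∀ i,
      ∫ z in Ω, F i (hess m w z, hess m h z) ≤ (∫ z in Ω, G i (hess m w z)) + η := by
  have htame (i : ι) : IsTame fun z => F i (hess m w z, 0) - G i (hess m w z) :=
    ((hF i).comp ((continuous_hess hw).prodMk continuous_const)).sub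
      ((hG i).comp (continuous_hess hw))
  obtain ⟨b, hb0, hb⟩ := exists_forall_abs_le htame hΩb.isCompact_closure
  set δ := η / (1 + volume.real Ω + b)
  have hδ : 0 < δ := div_pos hη (by positivity)
  have hδη : δ + δ * volume.real Ω + b * δ = η := by simp only [δ]; field_simp
  have hbδ : 0 ≤ b * δ := by positivity
  obtain ⟨t, r, hgood, htΩ, hd, hrest⟩ :=
    exists_finset_closedBall_packing hΩ hΩb.measure_lt_top.ne (hloc δ hδ) hδ
  choose! h hh using hgood
  refine ⟨fun y => ∑ x ∈ t, h x y, .sum t fun x hx => (hh x hx).isTestFunction (htΩ x hx),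
    fun z => ?_, fun i => ?_⟩
  · have : 0 ≤ δ * volume.real Ω := by positivity
    exact (abs_pd_zero_sum_le hδ.le hd hh z).trans (by linarith)
  · refine (setIntegral_sum_le hΩ.measurableSet hΩb hw hδ.le (hF i) (hG i) hd htΩ hh
      fun z hz => hb i z (subset_closure hz)).trans ?_
    linarith [mul_le_mul_of_nonneg_left hrest hb0]

end Gluing

section LocalStep

variable {m : ℝ} {w : Plane → ℝ} {x₀ n : Plane} {x y δ : ℝ}

lemma eventually_norm_le_norm_add_one {α E : Type*} [PseudoMetricSpace α] [SeminormedAddCommGroup E]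
    {g : α → E} (hg : Continuous g) (x : α) :
    ∀ᶠ r in 𝓝[>] (0 : ℝ), ∀ z ∈ Metric.closedBall x r, ‖g z‖ ≤ ‖g x‖ + 1 :=
  (eventually_closedBall_subset (hg.norm.continuousAt.eventually_le_const
    (lt_add_one ‖g x‖))).filter_mono nhdsWithin_le_nhds

lemma eventually_exists_lamination_average {ι : Type*} [Finite ι] {f : ι → ℝ × ℝ × ℝ → ℝ}
    (hf : ∀ i, IsTame (f i)) (hw : Smooth w) (hq : rankOne m n ≠ 0) (hxy : 0 < x * y)
    (hδ : 0 < δ) :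
    ∀ᶠ r in 𝓝[>] (0 : ℝ), ∃ h, IsLamination m w x₀ n x y r δ h ∧ ∀ i,
      |(∫ z in Metric.closedBall x₀ r, f i (hess m w z + hess m h z)) -
          (y / (x + y) * f i (hess m w x₀ + x • rankOne m n) +
            x / (x + y) * f i (hess m w x₀ - y • rankOne m n)) *
            volume.real (Metric.closedBall x₀ r)| ≤ δ * volume.real (Metric.closedBall x₀ r) := by
  set A := hess m w x₀
  set q := rankOne m n
  set L := ‖A‖ + 1 + (max |x| |y| * ‖q‖ + δ)
  obtain ⟨b, hb0, hb⟩ := exists_forall_abs_le hf (isCompact_closedBall 0 L)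
  simp only [mem_closedBall_zero_iff] at hb
  have hL {t : ℝ} (ht : |t| ≤ max |x| |y|) : ‖A + t • q‖ ≤ L := by
    refine (norm_add_le _ _).trans (add_le_add (by linarith) ?_)
    rw [norm_smul, Real.norm_eq_abs]
    exact (mul_le_mul_of_nonneg_right ht (norm_nonneg q)).trans (by linarith)
  set η := min δ (δ / (4 * b + 1))
  have hη : 0 < η := by positivity
  have hηb : 4 * η * b ≤ δ := by
    have : η * (4 * b + 1) ≤ δ := (le_div_iff₀ (by positivity)).1 (min_le_right _ _)
    linarith
  filter_upwards [eventually_exists_lamination_fractions hw m x₀ hq hxy hη,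
    eventually_norm_le_norm_add_one (continuous_hess (m := m) hw) x₀] with r ⟨h, hh, hx, hy⟩ hr
  refine ⟨h, hh.mono (min_le_left _ _), fun i => ?_⟩
  have hsum : IsTame fun z => f i (hess m w z + hess m h z) :=
    (hf i).comp ((continuous_hess hw).add (continuous_hess hh.smooth))
  have hbound : ∀ z ∈ Metric.closedBall x₀ r, |f i (hess m w z + hess m h z)| ≤ b := fun z hz =>
    hb i _ ((norm_add_le _ _).trans (add_le_add (hr z hz)
      ((hh.mono (min_le_left _ _)).norm_hess_le z)))
  have hmean := abs_setIntegral_sub_average_le measurableSet_closedBall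
    (measurableSet_layer hw hh.smooth) (measurableSet_layer hw hh.smooth) layer_subset_closedBall
    layer_subset_closedBall (disjoint_layer hq fun h' => add_ne_zero_of_mul_pos hxy (by linarith))
    measure_closedBall_lt_top.ne (hsum.integrableOn_isCompact (isCompact_closedBall x₀ r))
    (fun z hz => congrArg (f i) hz.2) (fun z hz => congrArg (f i) hz.2) hbound
    (hb i _ (hL (le_max_left _ _))) (hb i _ (hL ((abs_neg y).trans_le (le_max_right _ _))))
    (by rw [← add_div, add_comm y x, div_self (add_ne_zero_of_mul_pos hxy)]) hx hy
  rw [neg_smul, ← sub_eq_add_neg] at hmean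
  exact hmean.trans (mul_le_mul_of_nonneg_right hηb measureReal_nonneg)

end LocalStep

section Step

/-- The quantities controlled along a perturbation, as functions of the second derivative `P.1`
before it and its increment `P.2`. The gain enters with a minus sign so that all of them are to be
bounded from above. -/
def outcome (p : ℝ) (cost gain : ℝ × ℝ × ℝ → ℝ) : Fin 3 → (ℝ × ℝ × ℝ) × (ℝ × ℝ × ℝ) → ℝ :=
  ![fun P => cost (P.1 + P.2), fun P => -gain (P.1 + P.2), fun P => ‖P.2‖ ^ p]

/-- The average bounds on `outcome` that a splitting provides. -/
def budget (κ κ' C p : ℝ) (cost gain : ℝ × ℝ × ℝ → ℝ) : Fin 3 → ℝ × ℝ × ℝ → ℝ :=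
  ![fun A => κ * cost A, fun A => -(κ' * gain A), fun A => C ^ p * cost A]

variable {m p κ κ' C : ℝ} {S : Set (ℝ × ℝ × ℝ)} {cost gain : ℝ × ℝ × ℝ → ℝ}
  {w : Plane → ℝ} {x₀ : Plane} {η : ℝ}

lemma IsSplitScheme.isTame_outcome (hS : IsSplitScheme m p κ κ' C S cost gain) (hp : 0 ≤ p) :
    ∀ i, IsTame (outcome p cost gain i) :=
  have hadd : Continuous fun P : (ℝ × ℝ × ℝ) × (ℝ × ℝ × ℝ) => P.1 + P.2 :=
    continuous_fst.add continuous_snd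
  Fin.cons (hS.tame_cost.comp hadd) <| Fin.cons (hS.tame_gain.comp hadd).neg <| Fin.cons
    (isTame_of_continuous (continuous_snd.norm.rpow_const fun _ => Or.inr hp)) finZeroElim

lemma IsSplitScheme.isTame_budget (hS : IsSplitScheme m p κ κ' C S cost gain) :
    ∀ i, IsTame (budget κ κ' C p cost gain i) :=
  Fin.cons (hS.tame_cost.const_mul κ) <| Fin.cons (hS.tame_gain.const_mul κ').neg <|
    Fin.cons (hS.tame_cost.const_mul _) finZeroElim

lemma exists_add_rpow_le {a : ℝ} (hp : 0 ≤ p) (hη : 0 < η) :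
    ∃ δ, 0 < δ ∧ δ ≤ η ∧ (a + δ) ^ p ≤ a ^ p + η := by
  have hcont : Continuous fun δ => (a + δ) ^ p :=
    (continuous_const_add a).rpow_const fun _ => Or.inr hp
  have hlim : ∀ᶠ δ in 𝓝[>] (0 : ℝ), (a + δ) ^ p < a ^ p + η :=
    (hcont.tendsto' 0 (a ^ p) (by rw [add_zero])).eventually_lt_const (lt_add_of_pos_right _ hη)
      |>.filter_mono nhdsWithin_le_nhds
  obtain ⟨δ, hδ, hδη⟩ := (hlim.and (Ioc_mem_nhdsGT hη)).exists
  exact ⟨δ, hδη.1, hδη.2, hδ.le⟩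

lemma IsLocalStep.mono {ι : Type*} {F : ι → (ℝ × ℝ × ℝ) × (ℝ × ℝ × ℝ) → ℝ} {r δ : ℝ}
    {c c' : ι → ℝ} {h : Plane → ℝ} (hh : IsLocalStep m F w x₀ r δ c h) (hδ : δ ≤ η)
    (hc : ∀ i, c i + δ * volume.real (Metric.closedBall x₀ r) ≤
      c' i + η * volume.real (Metric.closedBall x₀ r)) : IsLocalStep m F w x₀ r η c' h where
  smooth := hh.smooth
  tsupport_subset := hh.tsupport_subset
  abs_pd_zero_le z := (hh.abs_pd_zero_le z).trans hδ
  setIntegral_le i := (hh.setIntegral_le i).trans (hc i)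

lemma IsSplitScheme.eventually_exists_isLocalStep_of_notMem
    (hS : IsSplitScheme m p κ κ' C S cost gain) (hp : 0 ≤ p) (hC : 0 ≤ C) (hw : Smooth w)
    (hA : hess m w x₀ ∉ S) (hη : 0 < η) :
    ∀ᶠ r in 𝓝[>] 0, ∃ h, IsLocalStep m (outcome p cost gain) w x₀ r η
      (fun i => budget κ κ' C p cost gain i (hess m w x₀) *
        volume.real (Metric.closedBall x₀ r)) h := by
  obtain ⟨n, x, y, hq, hxy, hmax, hcost, hgain⟩ := hS.splits _ hA
  obtain ⟨δ, hδ, hδη, hpow⟩ := exists_add_rpow_le (a := C * ‖hess m w x₀‖) hp hη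
  have htame : ∀ i, IsTame (![cost, gain] i) :=
    Fin.cons hS.tame_cost <| Fin.cons hS.tame_gain finZeroElim
  filter_upwards [eventually_exists_lamination_average (x₀ := x₀) htame hw hq hxy hδ] with r hr
  obtain ⟨h, hh, havg⟩ := hr
  set V := volume.real (Metric.closedBall x₀ r)
  have hV : 0 ≤ V := measureReal_nonneg
  have hδV : δ * V ≤ η * V := mul_le_mul_of_nonneg_right hδη hV
  have hcost' := havg 0
  have hgain' := havg 1
  simp only [Matrix.cons_val] at hcost' hgain'
  refine ⟨h, hh.smooth, hh.tsupport_subset, fun z => (hh.abs_pd_zero_le z).trans hδη,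
    Fin.cons ?_ <| Fin.cons ?_ <| Fin.cons ?_ finZeroElim⟩
  · change ∫ z in Metric.closedBall x₀ r, cost (hess m w z + hess m h z) ≤ κ * cost _ * V + η * V
    linarith [(abs_le.1 hcost').2, mul_le_mul_of_nonneg_right hcost hV]
  · change ∫ z in Metric.closedBall x₀ r, -gain (hess m w z + hess m h z) ≤
      -(κ' * gain _) * V + η * V
    rw [integral_neg]
    linarith [(abs_le.1 hgain').1, mul_le_mul_of_nonneg_right hgain hV]
  · have hbound (z : Plane) : ‖‖hess m h z‖ ^ p‖ ≤ C ^ p * cost (hess m w x₀) + η := by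
      rw [Real.norm_of_nonneg (by positivity)]
      calc ‖hess m h z‖ ^ p ≤ (C * ‖hess m w x₀‖ + δ) ^ p := by
            gcongr; exact (hh.norm_hess_le z).trans (by linarith)
        _ ≤ C ^ p * ‖hess m w x₀‖ ^ p + η := by rwa [← Real.mul_rpow hC (norm_nonneg _)]
        _ ≤ C ^ p * cost (hess m w x₀) + η := by gcongr; exact hS.norm_rpow_le_cost _ hA
    change ∫ z in Metric.closedBall x₀ r, ‖hess m h z‖ ^ p ≤ C ^ p * cost _ * V + η * V
    rw [← add_mul]
    exact (le_abs_self _).trans (norm_setIntegral_le_of_norm_le_const measure_closedBall_lt_top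
      fun z _ => hbound z)

lemma IsSplitScheme.ae_eventually_exists_isLocalStep
    (hS : IsSplitScheme m p κ κ' C S cost gain) (hp : 0 < p) (hC : 0 ≤ C) (hw : Smooth w)
    (hη : 0 < η) :
    ∀ᵐ x₀, ∀ᶠ r in 𝓝[>] 0, ∃ h, IsLocalStep m (outcome p cost gain) w x₀ r η
      (fun i => ∫ z in Metric.closedBall x₀ r, budget κ κ' C p cost gain i (hess m w z)) h := by
  have hη2 : 0 < η / 2 := half_pos hη
  have hhess : Continuous (hess m w) := continuous_hess hw
  have hF := ae_all_iff.2 fun i => ae_eventually_norm_setIntegral_sub_le (μ := volume)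
    ((hS.isTame_outcome hp.le i).comp (hhess.prodMk continuous_const) : IsTame fun z =>
      outcome p cost gain i (hess m w z, 0)).locallyIntegrable
  have hG := ae_all_iff.2 fun i => ae_eventually_norm_setIntegral_sub_le (μ := volume)
    ((hS.isTame_budget i).comp hhess).locallyIntegrable
  filter_upwards [hF, hG] with x₀ hFx hGx
  have hstep : ∀ᶠ r in 𝓝[>] 0, ∃ h, IsLocalStep m (outcome p cost gain) w x₀ r (η / 2)
      (fun i => budget κ κ' C p cost gain i (hess m w x₀) *
        volume.real (Metric.closedBall x₀ r)) h := by
    by_cases hA : hess m w x₀ ∈ S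
    · have hF0 : ∀ i, outcome p cost gain i (hess m w x₀, 0) = 0 := by
        simp [Fin.forall_fin_succ, outcome, hS.cost_eq_zero _ hA, hS.gain_eq_zero _ hA, hp.ne']
      have hG0 : ∀ i, budget κ κ' C p cost gain i (hess m w x₀) = 0 := by
        simp [Fin.forall_fin_succ, budget, hS.cost_eq_zero _ hA, hS.gain_eq_zero _ hA]
      filter_upwards [eventually_all.2 fun i => hFx i _ hη2] with r hr
      refine ⟨fun _ => 0, contDiff_const, ?_, fun z => ?_, fun i => ?_⟩
      · simp [tsupport]
      · rw [pd_const, abs_zero]; exact hη2.le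
      · have hr := hr i
        rw [hF0, smul_zero, sub_zero] at hr
        rw [hG0, zero_mul, zero_add]
        simpa only [hess_const] using (le_abs_self _).trans hr
    · exact hS.eventually_exists_isLocalStep_of_notMem hp.le hC hw hA hη2
  filter_upwards [hstep, eventually_all.2 fun i => hGx i _ hη2] with r ⟨h, hh⟩ hr
  refine ⟨h, hh.mono (by linarith) fun i => ?_⟩
  linarith [(abs_le.1 (hr i)).1, mul_comm (budget κ κ' C p cost gain i (hess m w x₀))
    (volume.real (Metric.closedBall x₀ r)), smul_eq_mul (volume.real (Metric.closedBall x₀ r))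
    (budget κ κ' C p cost gain i (hess m w x₀))]

end Step

section Recursion

lemma exists_seq_of_forall_pos {α : Type*} {R : α → ℝ → α → Prop} {b : α → ℝ} (hb : ∀ a, 0 < b a)
    (hR : ∀ a, ∀ η > 0, ∃ a', R a η a') (a₀ : α) :
    ∃ (a : ℕ → α) (ε : ℕ → ℝ), a 0 = a₀ ∧ (∀ k, 0 < ε k) ∧ (∀ k, ε k ≤ b (a k)) ∧
      (∀ k, ε (k + 1) ≤ ε k / 2) ∧ ∀ k, R (a k) (ε k) (a (k + 1)) := by
  choose! f hf using hR
  set s : ℕ → α × ℝ := fun k => Nat.rec (a₀, b a₀)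
    (fun _ s => (f s.1 s.2, min (s.2 / 2) (b (f s.1 s.2)))) k
  have hpos (k : ℕ) : 0 < (s k).2 := by
    induction k with
    | zero => exact hb a₀
    | succ k ih => exact lt_min (half_pos ih) (hb _)
  refine ⟨fun k => (s k).1, fun k => (s k).2, rfl, hpos, fun k => ?_, fun k => min_le_left _ _,
    fun k => hf _ _ (hpos k)⟩
  cases k with
  | zero => exact le_rfl
  | succ k => exact min_le_right _ _

variable {c ε : ℕ → ℝ} {κ : ℝ}

lemma add_four_mul_le_geometric (hc₀ : ∀ k, 0 ≤ c k) (hε₀ : ∀ k, 0 ≤ ε k)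
    (hε : ∀ k, ε (k + 1) ≤ ε k / 2) (hc : ∀ k, c (k + 1) ≤ κ * c k + ε k) (k : ℕ) :
    c k + 4 * ε k ≤ max κ (3 / 4) ^ k * (c 0 + 4 * ε 0) := by
  have hr : 0 ≤ max κ (3 / 4) := by positivity
  refine le_geom (u := fun k => c k + 4 * ε k) hr k fun j _ => ?_
  calc c (j + 1) + 4 * ε (j + 1) ≤ κ * c j + 3 / 4 * (4 * ε j) := by linarith [hc j, hε j]
    _ ≤ max κ (3 / 4) * c j + max κ (3 / 4) * (4 * ε j) := by
        gcongr
        · exact hc₀ j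
        · exact le_max_left _ _
        · exact mul_nonneg zero_le_four (hε₀ j)
        · exact le_max_right _ _
    _ = max κ (3 / 4) * (c j + 4 * ε j) := by ring

lemma tendsto_atTop_of_mul_sub_le (hκ : 1 < κ) (hε₀ : ∀ k, 0 ≤ ε k)
    (hε : ∀ k, ε (k + 1) ≤ ε k / 2) (hc₀ : 2 * ε 0 < c 0)
    (hc : ∀ k, κ * c k - ε k ≤ c (k + 1)) : Tendsto c atTop atTop := by
  have hgeom : Tendsto (fun k => c k - 2 * ε k) atTop atTop :=
    tendsto_atTop_of_geom_le (sub_pos.2 hc₀) hκ fun k => by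
      linarith [hc k, hε k, mul_le_mul_of_nonneg_right hκ.le (hε₀ k)]
  exact tendsto_atTop_mono (fun k => by linarith [hε₀ k]) hgeom

lemma abs_sub_le_two_mul {a : ℕ → ℝ} (hε₀ : ∀ k, 0 ≤ ε k) (hε : ∀ k, ε (k + 1) ≤ ε k / 2)
    (ha : ∀ k, |a (k + 1) - a k| ≤ ε k) {k j : ℕ} (hkj : k ≤ j) : |a j - a k| ≤ 2 * ε k := by
  suffices h : |a j - a k| ≤ 2 * ε k - 2 * ε j by linarith [hε₀ j]
  induction j, hkj using Nat.le_induction with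
  | base => simp
  | succ j _ ih => linarith [abs_sub_le (a (j + 1)) (a j) (a k), ha j, hε j]

end Recursion

section BoundedSets

variable {α E : Type*} [PseudoMetricSpace α] [ProperSpace α] [MeasurableSpace α]
  [OpensMeasurableSpace α] {μ : Measure α} [NormedAddCommGroup E] {s : Set α} {f : α → E}

lemma exists_ae_restrict_norm_le (hs : Bornology.IsBounded s) (hf : Continuous f) :
    ∃ c, ∀ᵐ x ∂μ.restrict s, ‖f x‖ ≤ c := by
  obtain ⟨c, hc⟩ := hs.isCompact_closure.exists_bound_of_continuousOn hf.continuousOn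
  exact ⟨c, ae_restrict_of_ae_restrict_of_subset subset_closure
    (ae_restrict_of_forall_mem isClosed_closure.measurableSet hc)⟩

lemma memLp_restrict_of_continuous [SecondCountableTopologyEither α E]
    [IsFiniteMeasureOnCompacts μ] (hs : Bornology.IsBounded s) (hf : Continuous f) (p : ℝ≥0∞) :
    MemLp f p (μ.restrict s) := by
  have : IsFiniteMeasure (μ.restrict s) := isFiniteMeasure_restrict.2 hs.measure_lt_top.ne
  obtain ⟨c, hc⟩ := exists_ae_restrict_norm_le (μ := μ) hs hf
  exact .of_bound hf.aestronglyMeasurable c hc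

lemma integrableOn_of_continuous [SecondCountableTopologyEither α E]
    [IsFiniteMeasureOnCompacts μ] (hs : Bornology.IsBounded s) (hf : Continuous f) :
    IntegrableOn f s μ :=
  memLp_one_iff_integrable.1 (memLp_restrict_of_continuous hs hf 1)

end BoundedSets

section Iteration

variable {Ω : Set Plane} {m p q κ κ' C : ℝ} {S : Set (ℝ × ℝ × ℝ)} {cost gain : ℝ × ℝ × ℝ → ℝ}

/-- One step of the iteration: `w'` is a perturbation of `w` inside `Ω` which improves the average
cost and gain, up to an error `η`. -/
structure IsStep (Ω : Set Plane) (m p κ κ' C : ℝ) (cost gain : ℝ × ℝ × ℝ → ℝ) (w : Plane → ℝ)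
    (η : ℝ) (w' : Plane → ℝ) : Prop where
  isTestFunction_sub : IsTestFunction Ω fun x => w' x - w x
  abs_pd_zero_sub_le : ∀ x, |pd 0 w' x - pd 0 w x| ≤ η
  setIntegral_cost_le :
    ∫ x in Ω, cost (hess m w' x) ≤ κ * (∫ x in Ω, cost (hess m w x)) + η
  le_setIntegral_gain :
    κ' * (∫ x in Ω, gain (hess m w x)) - η ≤ ∫ x in Ω, gain (hess m w' x)
  setIntegral_norm_rpow_le :
    ∫ x in Ω, ‖hess m w' x - hess m w x‖ ^ p ≤ C ^ p * (∫ x in Ω, cost (hess m w x)) + η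

theorem IsSplitScheme.exists_isStep (hS : IsSplitScheme m p κ κ' C S cost gain) (hp : 0 < p)
    (hC : 0 ≤ C) (hΩ : IsOpen Ω) (hΩb : Bornology.IsBounded Ω) {w : Plane → ℝ} (hw : Smooth w)
    {η : ℝ} (hη : 0 < η) : ∃ w', Smooth w' ∧ IsStep Ω m p κ κ' C cost gain w η w' := by
  obtain ⟨h, hh, hpd, hint⟩ := exists_isTestFunction_setIntegral_le hΩ hΩb hw
    (hS.isTame_outcome hp.le) hS.isTame_budget
    (fun _ hη => hS.ae_eventually_exists_isLocalStep hp hC hw hη) hη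
  have hhess : ∀ x, hess m (fun x => w x + h x) x = hess m w x + hess m h x :=
    congrFun (hess_add hw hh.1)
  have hpd_add : ∀ x, pd 0 (fun x => w x + h x) x = pd 0 w x + pd 0 h x :=
    congrFun (pd_add hw.differentiable (Smooth.differentiable hh.1) 0)
  have hcost := hint 0
  have hgain := hint 1
  have hpow := hint 2
  simp only [outcome, budget, Matrix.cons_val, integral_const_mul, integral_neg] at hcost hgain hpow
  refine ⟨fun x => w x + h x, hw.add hh.1, ?_, fun x => ?_, ?_, ?_, ?_⟩
  · simpa only [add_sub_cancel_left] using hh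
  · rw [hpd_add, add_sub_cancel_left]; exact hpd x
  · simpa only [hhess] using hcost
  · simp only [hhess]; linarith
  · simpa only [hhess, add_sub_cancel_left] using hpow

/-- A sequence `w` of successive perturbations, with errors `ε` that are halved in every step. -/
structure IsIteration (Ω : Set Plane) (m p κ κ' C : ℝ) (cost gain : ℝ × ℝ × ℝ → ℝ)
    (w : ℕ → Plane → ℝ) (ε : ℕ → ℝ) : Prop where
  smooth : ∀ k, Smooth (w k)
  pos : ∀ k, 0 < ε k
  le_half : ∀ k, ε (k + 1) ≤ ε k / 2
  isStep : ∀ k, IsStep Ω m p κ κ' C cost gain (w k) (ε k) (w (k + 1))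

theorem IsSplitScheme.exists_isIteration (hS : IsSplitScheme m p κ κ' C S cost gain) (hp : 0 < p)
    (hC : 0 ≤ C) (hΩ : IsOpen Ω) (hΩb : Bornology.IsBounded Ω) {w₀ : Plane → ℝ} (hw₀ : Smooth w₀)
    {b : (Plane → ℝ) → ℝ} (hb : ∀ w, 0 < b w) :
    ∃ w ε, w 0 = w₀ ∧ IsIteration Ω m p κ κ' C cost gain w ε ∧ ∀ k, ε k ≤ b (w k) := by
  obtain ⟨w, ε, hw, hpos, hle, hhalf, hstep⟩ := exists_seq_of_forall_pos
    (R := fun (w : {w // Smooth w}) η w' => IsStep Ω m p κ κ' C cost gain w η w')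
    (fun w => hb w) (fun w η hη =>
      let ⟨w', hw', h⟩ := hS.exists_isStep hp hC hΩ hΩb w.2 hη
      ⟨⟨w', hw'⟩, h⟩) ⟨w₀, hw₀⟩
  exact ⟨fun k => w k, ε, congrArg Subtype.val hw, ⟨fun k => (w k).2, hpos, hhalf, hstep⟩, hle⟩

lemma IsSplitScheme.cost_nonneg (hS : IsSplitScheme m p κ κ' C S cost gain) (A : ℝ × ℝ × ℝ) :
    0 ≤ cost A := by
  by_cases hA : A ∈ S
  · exact (hS.cost_eq_zero A hA).ge
  · exact (Real.rpow_nonneg (norm_nonneg A) p).trans (hS.norm_rpow_le_cost A hA)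

lemma IsSplitScheme.infDist_rpow_le_cost (hS : IsSplitScheme m p κ κ' C S cost gain) (hp : 0 < p)
    (h0 : 0 ∈ S) (A : ℝ × ℝ × ℝ) : Metric.infDist A S ^ p ≤ cost A := by
  by_cases hA : A ∈ S
  · rw [Metric.infDist_zero_of_mem hA, Real.zero_rpow hp.ne', hS.cost_eq_zero A hA]
  · refine (Real.rpow_le_rpow Metric.infDist_nonneg ?_ hp.le).trans (hS.norm_rpow_le_cost A hA)
    exact (Metric.infDist_le_dist_of_mem h0).trans_eq (dist_zero_right A)

/-- Smooth functions, equal to `w 0` near the boundary of `Ω`, whose second derivatives converge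
geometrically in `L^p` and approach `S`, while the `L^q` energy of `∂₀∂₀w` blows up. -/
structure IsApproximation (Ω : Set Plane) (m p q : ℝ) (S : Set (ℝ × ℝ × ℝ)) (w : ℕ → Plane → ℝ)
    (δ : ℕ → ℝ) : Prop where
  smooth : ∀ k, Smooth (w k)
  isTestFunction_sub : ∀ k j, k ≤ j → IsTestFunction Ω fun x => w j x - w k x
  abs_pd_zero_sub_le : ∀ k j, k ≤ j → ∀ x, |pd 0 (w j) x - pd 0 (w k) x| ≤ δ k
  tendsto_zero : Tendsto δ atTop (𝓝 0)
  exists_geometric : ∃ B r, 0 ≤ B ∧ 0 < r ∧ r < 1 ∧ ∀ k,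
    ∫ x in Ω, ‖hess m (w (k + 1)) x - hess m (w k) x‖ ^ p ≤ B * r ^ k ∧
    ∫ x in Ω, Metric.infDist (hess m (w k) x) S ^ p ≤ B * r ^ k
  tendsto_energy : Tendsto (fun k => ∫ x in Ω, |pd 0 (pd 0 (w k)) x| ^ q) atTop atTop

namespace IsIteration

variable {w : ℕ → Plane → ℝ} {ε : ℕ → ℝ}

lemma isTestFunction_sub (h : IsIteration Ω m p κ κ' C cost gain w ε) {k j : ℕ} (hkj : k ≤ j) :
    IsTestFunction Ω fun x => w j x - w k x := by
  induction j, hkj using Nat.le_induction with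
  | base => simpa only [sub_self] using IsTestFunction.zero Ω
  | succ j _ ih => simpa only [sub_add_sub_cancel] using (h.isStep j).isTestFunction_sub.add ih

lemma tendsto_zero (h : IsIteration Ω m p κ κ' C cost gain w ε) : Tendsto ε atTop (𝓝 0) :=
  squeeze_zero (fun k => (h.pos k).le)
    (fun k => le_geom one_half_pos.le k fun j _ => (h.le_half j).trans_eq (by ring)) <| by
      simpa using (tendsto_pow_atTop_nhds_zero_of_lt_one one_half_pos.le one_half_lt_one).mul_const
        (ε 0)

lemma exists_geometric (h : IsIteration Ω m p κ κ' C cost gain w ε)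
    (hS : IsSplitScheme m p κ κ' C S cost gain) (hC : 0 ≤ C) (hκ : κ < 1) :
    ∃ B r, 0 ≤ B ∧ 0 < r ∧ r < 1 ∧ ∀ k,
      ∫ x in Ω, ‖hess m (w (k + 1)) x - hess m (w k) x‖ ^ p ≤ B * r ^ k ∧
      ∫ x in Ω, cost (hess m (w k) x) ≤ B * r ^ k := by
  set c : ℕ → ℝ := fun k => ∫ x in Ω, cost (hess m (w k) x)
  have hc (k : ℕ) : 0 ≤ c k := integral_nonneg fun x => hS.cost_nonneg _
  set r := max κ (3 / 4)
  set s := c 0 + 4 * ε 0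
  have hs : 0 ≤ s := add_nonneg (hc 0) (mul_nonneg zero_le_four (h.pos 0).le)
  have hr : 0 < r := by positivity
  have hCp : 0 ≤ C ^ p := by positivity
  refine ⟨(C ^ p + 1) * s, r, by positivity, hr, max_lt hκ (by norm_num), fun k => ?_⟩
  have hgeom : c k + 4 * ε k ≤ r ^ k * s := add_four_mul_le_geometric hc
    (fun k => (h.pos k).le) h.le_half (fun k => (h.isStep k).setIntegral_cost_le) k
  have hck : c k ≤ r ^ k * s := by linarith [h.pos k]
  have : 0 ≤ C ^ p * (r ^ k * s) := by positivity
  exact ⟨by linarith [(h.isStep k).setIntegral_norm_rpow_le, hc k, h.pos k,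
    mul_le_mul_of_nonneg_left hck hCp], by linarith⟩

theorem isApproximation (h : IsIteration Ω m p κ κ' C cost gain w ε)
    (hS : IsSplitScheme m p κ κ' C S cost gain) (hΩb : Bornology.IsBounded Ω) (h0 : 0 ∈ S)
    (hp : 0 < p) (hq : 0 ≤ q) (hC : 0 ≤ C) (hκ : κ < 1) (hκ' : 1 < κ')
    (hε : 2 * ε 0 < ∫ x in Ω, gain (hess m (w 0) x)) {b : ℝ} (hb : 0 < b)
    (hgain : ∀ A, gain A ≤ b * |A.1| ^ q) :
    IsApproximation Ω m p q S w fun k => 2 * ε k where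
  smooth := h.smooth
  isTestFunction_sub _ _ := h.isTestFunction_sub
  abs_pd_zero_sub_le _ _ hkj x := abs_sub_le_two_mul (fun k => (h.pos k).le) h.le_half
    (a := fun k => pd 0 (w k) x) (fun k => (h.isStep k).abs_pd_zero_sub_le x) hkj
  tendsto_zero := by simpa using h.tendsto_zero.const_mul 2
  exists_geometric := by
    obtain ⟨B, r, hB, hr, hr1, hBr⟩ := h.exists_geometric hS hC hκ
    refine ⟨B, r, hB, hr, hr1, fun k => ⟨(hBr k).1, le_trans ?_ (hBr k).2⟩⟩
    exact integral_mono_of_nonneg (.of_forall fun x => Real.rpow_nonneg Metric.infDist_nonneg p)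
      ((hS.tame_cost.comp (continuous_hess (h.smooth k))).integrableOn_isBounded hΩb)
      (.of_forall fun x => hS.infDist_rpow_le_cost hp h0 _)
  tendsto_energy := by
    refine (tendsto_const_mul_atTop_of_pos hb).1 (tendsto_atTop_mono (fun k => ?_)
      (tendsto_atTop_of_mul_sub_le hκ' (fun k => (h.pos k).le) h.le_half hε
        fun k => (h.isStep k).le_setIntegral_gain))
    have hcont : Continuous fun x => b * |pd 0 (pd 0 (w k)) x| ^ q := continuous_const.mul
      ((((h.smooth k).pd 0).pd 0).continuous.abs.rpow_const fun _ => Or.inr hq)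
    rw [← integral_const_mul]
    exact integral_mono
      ((hS.tame_gain.comp (continuous_hess (h.smooth k))).integrableOn_isBounded hΩb)
      (integrableOn_of_continuous hΩb hcont) fun x => hgain _

end IsIteration

end Iteration

section Staircase

variable {Ω : Set Plane} {K m p : ℝ}

theorem exists_isApproximation (hK : 1 < K) (hm : 0 < m) (hp : 0 < p) (hpq : p < 2 * K / (K + 1))
    (hΩ : IsOpen Ω) (hΩb : Bornology.IsBounded Ω) (hΩn : Ω.Nonempty) {b : (Plane → ℝ) → ℝ}
    (hb : ∀ w, 0 < b w) :
    ∃ w δ, IsApproximation Ω m p (2 * K / (K + 1)) (phaseSet K) w δ ∧ (∀ k, δ k ≤ b (w k)) ∧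
      (∀ x, pd 0 (w 0) x = x 0) := by
  set q := 2 * K / (K + 1)
  have hq : 0 ≤ q := by positivity
  obtain ⟨ρ, hρ, hκ, hκ'⟩ := exists_keep_mul_rpow hK hpq
  have hS := isSplitScheme_staircase hK hm hρ hp.le hq hκ
  set w₀ := quad 0 0 0 0 1 0 (ρ / m)
  have hw₀ : Smooth w₀ := smooth_quad _ _ _ _ _ _ _
  have hhess (x : Plane) : hess m w₀ x = (1, 0, ρ) := by
    rw [hess_quad, mul_div_cancel₀ _ hm.ne']
  have hphase : ((1, 0, ρ) : ℝ × ℝ × ℝ) ∉ phaseSet K := by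
    simpa only [swap_mem_phaseSet_iff, mul_one] using climb_notMem_phaseSet hK hρ one_ne_zero
  have hgain : 0 < ∫ x in Ω, gain K ρ q (hess m w₀ x) := by
    simp only [hhess, gain_of_mem_stairSet (ρ := ρ) (q := q) ⟨rfl, Or.inl (mul_one ρ).symm⟩ hphase,
      setIntegral_const, smul_eq_mul]
    have hne : ((1, 0, ρ) : ℝ × ℝ × ℝ) ≠ 0 := fun h => one_ne_zero (congrArg Prod.fst h)
    have hvol : 0 < volume.real Ω :=
      ENNReal.toReal_pos (hΩ.measure_pos volume hΩn).ne' hΩb.measure_lt_top.ne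
    positivity
  set g := ∫ x in Ω, gain K ρ q (hess m w₀ x)
  obtain ⟨w, ε, hw, h, hle⟩ := hS.exists_isIteration hp (by positivity) hΩ hΩb hw₀
    (b := fun w => min (g / 3) (b w / 2)) fun w => lt_min (by positivity) (half_pos (hb w))
  have hε : 2 * ε 0 < ∫ x in Ω, gain K ρ q (hess m (w 0) x) := by
    rw [hw]
    linarith [(hle 0).trans (min_le_left _ _)]
  refine ⟨w, fun k => 2 * ε k, h.isApproximation hS hΩb (zero_mem_phaseSet K) hp hq (by positivity)
    hκ hκ' hε (by positivity) (gain_le hρ hq), fun k => ?_, fun x => ?_⟩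
  · linarith [(hle k).trans (min_le_right _ _)]
  · rw [hw, pd_zero_quad]
    simp [quad]

end Staircase

section LpLimits

variable {α E F G : Type*} [MeasurableSpace α] {μ : Measure α} [NormedAddCommGroup E]
  [NormedAddCommGroup F] [NormedAddCommGroup G]

lemma eLpNorm_le_of_integral_rpow_le {p : ℝ} (hp : 0 < p) {f : α → E}
    (hf : MemLp f (ENNReal.ofReal p) μ) {c : ℝ} (h : ∫ x, ‖f x‖ ^ p ∂μ ≤ c) :
    eLpNorm f (ENNReal.ofReal p) μ ≤ ENNReal.ofReal (c ^ p⁻¹) := by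
  rw [hf.eLpNorm_eq_integral_rpow_norm (ENNReal.ofReal_pos.2 hp).ne' ENNReal.ofReal_ne_top,
    ENNReal.toReal_ofReal hp.le]
  gcongr

lemma mul_pow_rpow {B r : ℝ} (hB : 0 ≤ B) (hr : 0 ≤ r) (k : ℕ) (s : ℝ) :
    (B * r ^ k) ^ s = B ^ s * (r ^ s) ^ k := by
  rw [Real.mul_rpow hB (pow_nonneg hr k), Real.rpow_pow_comm hr]

theorem exists_tendsto_eLpNorm_of_geometric [CompleteSpace E] {p : ℝ} (hp : 1 ≤ p) {f : ℕ → α → E}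
    (hf : ∀ k, MemLp (f k) (ENNReal.ofReal p) μ) {B r : ℝ} (hB : 0 ≤ B) (hr₀ : 0 ≤ r) (hr : r < 1)
    (h : ∀ k, ∫ x, ‖f (k + 1) x - f k x‖ ^ p ∂μ ≤ B * r ^ k) :
    ∃ F : α → E, MemLp F (ENNReal.ofReal p) μ ∧
      Tendsto (fun k => eLpNorm (f k - F) (ENNReal.ofReal p) μ) atTop (𝓝 0) := by
  have : Fact (1 ≤ ENNReal.ofReal p) := ⟨ENNReal.one_le_ofReal.2 hp⟩
  have hp₀ : 0 < p := zero_lt_one.trans_le hp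
  have hcauchy : CauchySeq fun k => (hf k).toLp (f k) := by
    refine cauchySeq_of_le_geometric (r ^ p⁻¹) (B ^ p⁻¹)
      (Real.rpow_lt_one hr₀ hr (inv_pos.2 hp₀)) fun k => ?_
    rw [dist_comm, Lp.dist_def, eLpNorm_congr_ae ((hf (k + 1)).coeFn_toLp.sub (hf k).coeFn_toLp),
      ← mul_pow_rpow hB hr₀]
    exact ENNReal.toReal_le_of_le_ofReal (by positivity)
      (eLpNorm_le_of_integral_rpow_le hp₀ ((hf (k + 1)).sub (hf k)) (h k))
  obtain ⟨F, hF⟩ := cauchySeq_tendsto_of_complete hcauchy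
  refine ⟨F, Lp.memLp F, (Lp.tendsto_Lp_iff_tendsto_eLpNorm'' f hf F (Lp.memLp F)).1 ?_⟩
  rwa [Lp.toLp_coeFn]

lemma tendsto_eLpNorm_zero_of_le_mul {f : ℕ → α → E} {g : ℕ → α → F} {p : ℝ≥0∞} {c : ℝ}
    (hf : Tendsto (fun k => eLpNorm (f k) p μ) atTop (𝓝 0))
    (h : ∀ k, ∀ᵐ x ∂μ, ‖g k x‖ ≤ c * ‖f k x‖) :
    Tendsto (fun k => eLpNorm (g k) p μ) atTop (𝓝 0) := by
  refine tendsto_of_tendsto_of_tendsto_of_le_of_le tendsto_const_nhds ?_ (fun _ => zero_le)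
    fun k => eLpNorm_le_mul_eLpNorm_of_ae_le_mul (h k) p
  simpa using ENNReal.Tendsto.const_mul hf (a := ENNReal.ofReal c) (Or.inr ENNReal.ofReal_ne_top)

lemma tendsto_eLpNorm_zero_of_norm_le [IsFiniteMeasure μ] {f : ℕ → α → E} {δ : ℕ → ℝ}
    (hδ : Tendsto δ atTop (𝓝 0)) (h : ∀ k x, ‖f k x‖ ≤ δ k) :
    Tendsto (fun k => eLpNorm (f k) 1 μ) atTop (𝓝 0) := by
  refine tendsto_of_tendsto_of_tendsto_of_le_of_le tendsto_const_nhds ?_ (fun _ => zero_le)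
    fun k => eLpNorm_le_of_ae_bound (.of_forall (h k))
  simpa using ENNReal.Tendsto.const_mul (ENNReal.tendsto_ofReal hδ)
    (a := μ Set.univ ^ (1 : ℝ≥0∞).toReal⁻¹) (Or.inr (by simp))

lemma tendsto_eLpNorm_one [IsFiniteMeasure μ] {p : ℝ≥0∞} (hp : 1 ≤ p) {f : ℕ → α → E}
    (hf : ∀ k, AEStronglyMeasurable (f k) μ)
    (h : Tendsto (fun k => eLpNorm (f k) p μ) atTop (𝓝 0)) :
    Tendsto (fun k => eLpNorm (f k) 1 μ) atTop (𝓝 0) := by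
  rcases eq_zero_or_neZero μ with rfl | hμ
  · simp
  refine tendsto_of_tendsto_of_tendsto_of_le_of_le tendsto_const_nhds ?_ (fun _ => zero_le)
    fun k => eLpNorm_le_eLpNorm_mul_rpow_measure_univ hp (hf k)
  simpa using ENNReal.Tendsto.mul_const h
    (b := μ Set.univ ^ (1 / (1 : ℝ≥0∞).toReal - 1 / p.toReal))
    (Or.inr (ENNReal.rpow_ne_top_of_ne_zero (by simpa using hμ.ne) (measure_ne_top _ _)))

lemma lintegral_rpow_norm_eq_top {f : α → E} {q : ℝ} (hq : 0 < q)
    (hf : AEStronglyMeasurable f μ) (hmem : ¬MemLp f (ENNReal.ofReal q) μ) :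
    ∫⁻ x, ENNReal.ofReal (‖f x‖ ^ q) ∂μ = ⊤ := by
  by_contra hne
  refine hmem
    ((integrable_norm_rpow_iff hf (ENNReal.ofReal_pos.2 hq).ne' ENNReal.ofReal_ne_top).1 ?_)
  rw [ENNReal.toReal_ofReal hq.le]
  exact (lintegral_ofReal_ne_top_iff_integrable
    (hf.norm.aemeasurable.pow_const q).aestronglyMeasurable
    (.of_forall fun x => Real.rpow_nonneg (norm_nonneg _) q)).1 hne

lemma tendsto_integral_bilin [NormedSpace ℝ E] [NormedSpace ℝ F] [NormedSpace ℝ G]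
    (L : E →L[ℝ] F →L[ℝ] G) {f : ℕ → α → E} {f' : α → E} (hf : ∀ k, Integrable (f k) μ)
    (hf' : Integrable f' μ) (h : Tendsto (fun k => eLpNorm (f k - f') 1 μ) atTop (𝓝 0))
    {g : α → F} (hg : AEStronglyMeasurable g μ) {c : ℝ} (hc : ∀ᵐ x ∂μ, ‖g x‖ ≤ c) :
    Tendsto (fun k => ∫ x, L (f k x) (g x) ∂μ) atTop (𝓝 (∫ x, L (f' x) (g x) ∂μ)) := by
  have hint {f : α → E} (hf : Integrable f μ) : Integrable (fun x => L (f x) (g x)) μ :=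
    L.integrable_of_bilin_of_bdd_right c hf hg hc
  refine tendsto_integral_of_L1' _ (hint hf').1 (.of_forall fun k => hint (hf k))
    (tendsto_eLpNorm_zero_of_le_mul (c := ‖L‖ * c) h fun k => ?_)
  filter_upwards [hc] with x hx
  calc ‖L (f k x) (g x) - L (f' x) (g x)‖ = ‖L (f k x - f' x) (g x)‖ := by
        rw [map_sub, sub_apply]
    _ ≤ ‖L‖ * ‖f k x - f' x‖ * c := (L.le_opNorm₂ _ _).trans (by gcongr)
    _ = ‖L‖ * c * ‖(f k - f') x‖ := by rw [Pi.sub_apply]; ring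

theorem ae_mem_of_tendsto_eLpNorm {p : ℝ≥0∞} (hp : 1 ≤ p) {S : Set E} (hS : IsClosed S)
    (hSn : S.Nonempty) {f : ℕ → α → E} {f' : α → E} (hf : ∀ k, AEStronglyMeasurable (f k) μ)
    (hf' : AEStronglyMeasurable f' μ) (h : Tendsto (fun k => eLpNorm (f k - f') p μ) atTop (𝓝 0))
    (hdist : Tendsto (fun k => eLpNorm (fun x => Metric.infDist (f k x) S) p μ) atTop (𝓝 0)) :
    ∀ᵐ x ∂μ, f' x ∈ S := by
  set d : E → ℝ := fun a => Metric.infDist a S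
  have hd : Continuous d := Metric.continuous_infDist_pt S
  have hd' : AEStronglyMeasurable (d ∘ f') μ := hd.comp_aestronglyMeasurable hf'
  have hle (k : ℕ) : eLpNorm (d ∘ f') p μ ≤
      eLpNorm (f k - f') p μ + eLpNorm (fun x => d (f k x)) p μ := by
    have hdk : AEStronglyMeasurable (d ∘ f k) μ := hd.comp_aestronglyMeasurable (hf k)
    rw [← sub_add_cancel (d ∘ f') (d ∘ f k)]
    refine (eLpNorm_add_le (hd'.sub hdk) hdk hp).trans
      (add_le_add_left (eLpNorm_mono fun x => ?_) _)
    rw [Pi.sub_apply, Pi.sub_apply, ← dist_eq_norm, ← dist_eq_norm, dist_comm (f k x)]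
    exact (Metric.lipschitz_infDist_pt S).dist_le_mul _ _ |>.trans_eq (one_mul _)
  have hzero : eLpNorm (d ∘ f') p μ = 0 :=
    le_antisymm (ge_of_tendsto' (by simpa using h.add hdist) hle) zero_le
  filter_upwards [(eLpNorm_eq_zero_iff hd' (zero_lt_one.trans_le hp).ne').1 hzero] with x hx
  exact (hS.mem_iff_infDist_zero hSn).2 hx

omit [MeasurableSpace α] in
lemma exists_continuous_abs_sub_le [TopologicalSpace α] {v : ℕ → α → ℝ}
    (hv : ∀ k, Continuous (v k)) {δ : ℕ → ℝ} (hδ : Tendsto δ atTop (𝓝 0))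
    (h : ∀ k j, k ≤ j → ∀ x, |v j x - v k x| ≤ δ k) :
    ∃ u, Continuous u ∧ ∀ k x, |v k x - u x| ≤ δ k := by
  have hcauchy (x : α) : CauchySeq fun k => v k x :=
    cauchySeq_of_le_tendsto_0' δ (fun k j hkj => by
      rw [dist_comm]; exact h k j hkj x) hδ
  choose u hu using fun x => cauchySeq_tendsto_of_complete (hcauchy x)
  have hle (k : ℕ) (x : α) : |v k x - u x| ≤ δ k := by
    rw [abs_sub_comm]
    exact le_of_tendsto ((hu x).sub_const _).abs
      ((eventually_ge_atTop k).mono fun j hkj => h k j hkj x)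
  refine ⟨u, TendstoUniformly.continuous (F := v) (p := atTop) ?_ (.of_forall hv), hle⟩
  refine Metric.tendstoUniformly_iff.2 fun ε hε => ?_
  filter_upwards [hδ.eventually_lt_const hε] with k hk x
  rw [dist_comm]
  exact (hle k x).trans_lt hk

end LpLimits

lemma memWeakLp_of_memLp {Ω : Set Plane} {p : ℝ} (hp : 0 < p) {f : Plane → Plane}
    (hf : MemLp f (ENNReal.ofReal p) (volume.restrict Ω)) : MemWeakLp Ω p f := by
  refine ⟨hf.1, ENNReal.rpow_lt_top_of_nonneg (by positivity) (ne_top_of_le_ne_top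
    (ENNReal.rpow_ne_top_of_nonneg hp.le hf.2.ne) (iSup_le fun t => ?_))⟩
  have hmarkov := mul_meas_ge_le_pow_eLpNorm' (volume.restrict Ω)
    (ENNReal.ofReal_pos.2 hp).ne' ENNReal.ofReal_ne_top hf.1 (ENNReal.ofReal t)
  rw [ENNReal.toReal_ofReal hp.le, ENNReal.ofReal_rpow_of_pos t.2] at hmarkov
  refine le_trans ?_ hmarkov
  gcongr with x
  intro hx
  rw [← ofReal_norm]
  exact ENNReal.ofReal_le_ofReal hx.le

section WeakGradients

variable {Ω : Set Plane} {v φ : Plane → ℝ}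

lemma continuous_gradient (hv : Smooth v) : Continuous (gradient v) :=
  (InnerProductSpace.toDual ℝ Plane).symm.continuous.comp (hv.continuous_fderiv (by simp))

lemma hasCompactSupport_gradient (hφ : HasCompactSupport φ) : HasCompactSupport (gradient φ) :=
  (hφ.fderiv ℝ).comp_left (map_zero _)

lemma setIntegral_eq_integral_of_tsupport_subset {f : Plane → ℝ} (hf : tsupport f ⊆ Ω) :
    ∫ x in Ω, f x = ∫ x, f x :=
  setIntegral_eq_integral_of_forall_compl_eq_zero fun _ hx =>
    image_eq_zero_of_notMem_tsupport fun h => hx (hf h)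

lemma setIntegral_mul_pd (hv : Smooth v) (hφ : IsTestFunction Ω φ) (i : Fin 2) :
    ∫ x in Ω, v x * pd i φ x = -∫ x in Ω, pd i v x * φ x := by
  rw [setIntegral_eq_integral_of_tsupport_subset (tsupport_mul_subset_right.trans (hφ.pd i).2.2),
    setIntegral_eq_integral_of_tsupport_subset (tsupport_mul_subset_right.trans hφ.2.2),
    integral_mul_pd (hv.of_le (by simp)) (hφ.1.of_le (by simp)) hφ.2.1]

lemma setIntegral_smul_gradient (hv : Smooth v) (hφ : IsTestFunction Ω φ) :
    ∫ x in Ω, v x • gradient φ x = -∫ x in Ω, φ x • gradient v x := by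
  have hint_left : IntegrableOn (fun x => v x • gradient φ x) Ω :=
    ((hv.continuous.smul (continuous_gradient hφ.1)).integrable_of_hasCompactSupport
      (hasCompactSupport_gradient hφ.2.1).smul_left).integrableOn
  have hint_right : IntegrableOn (fun x => φ x • gradient v x) Ω :=
    ((hφ.1.continuous.smul (continuous_gradient hv)).integrable_of_hasCompactSupport
      hφ.2.1.smul_right).integrableOn
  ext i
  have hleft := (EuclideanSpace.proj i : Plane →L[ℝ] ℝ).integral_comp_comm hint_left
  have hright := (EuclideanSpace.proj i : Plane →L[ℝ] ℝ).integral_comp_comm hint_right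
  simp only [PiLp.proj_apply, PiLp.smul_apply, gradient_apply, smul_eq_mul] at hleft hright
  rw [PiLp.neg_apply, ← hleft, ← hright, setIntegral_mul_pd hv hφ]
  simp only [mul_comm]

theorem hasWeakGradient_of_tendsto (hΩb : Bornology.IsBounded Ω) {v : ℕ → Plane → ℝ}
    {u : Plane → ℝ} {g : Plane → Plane} (hv : ∀ k, Smooth (v k)) (hu : IntegrableOn u Ω)
    (hg : IntegrableOn g Ω)
    (hvu : Tendsto (fun k => eLpNorm (v k - u) 1 (volume.restrict Ω)) atTop (𝓝 0))
    (hvg : Tendsto (fun k => eLpNorm (gradient (v k) - g) 1 (volume.restrict Ω)) atTop (𝓝 0)) :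
    HasWeakGradient Ω u g := by
  refine ⟨hu.locallyIntegrableOn, hg.locallyIntegrableOn, fun φ hφ => ?_⟩
  have hφ' := continuous_gradient hφ.1
  obtain ⟨c, hc⟩ := exists_ae_restrict_norm_le (μ := volume) hΩb hφ.1.continuous
  obtain ⟨c', hc'⟩ := exists_ae_restrict_norm_le (μ := volume) hΩb hφ'
  have hlim := tendsto_integral_bilin (ContinuousLinearMap.lsmul ℝ ℝ)
    (fun k => integrableOn_of_continuous hΩb (hv k).continuous) hu hvu hφ'.aestronglyMeasurable hc'
  have hlim' := tendsto_integral_bilin (ContinuousLinearMap.lsmul ℝ ℝ).flip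
    (fun k => integrableOn_of_continuous hΩb (continuous_gradient (hv k))) hg hvg
    hφ.1.continuous.aestronglyMeasurable hc
  simp only [ContinuousLinearMap.flip_apply, ContinuousLinearMap.lsmul_apply] at hlim hlim'
  simp only [fun k => setIntegral_smul_gradient (hv k) hφ] at hlim
  exact tendsto_nhds_unique hlim hlim'.neg

theorem memW11Zero_of_tendsto (hΩb : Bornology.IsBounded Ω) {φ : ℕ → Plane → ℝ} {u : Plane → ℝ}
    {g : Plane → Plane} (hφ : ∀ k, IsTestFunction Ω (φ k)) (hu : IntegrableOn u Ω)
    (hg : IntegrableOn g Ω)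
    (hφu : Tendsto (fun k => eLpNorm (φ k - u) 1 (volume.restrict Ω)) atTop (𝓝 0))
    (hφg : Tendsto (fun k => eLpNorm (gradient (φ k) - g) 1 (volume.restrict Ω)) atTop (𝓝 0)) :
    MemW11Zero Ω u := by
  have hgrad := hasWeakGradient_of_tendsto hΩb (fun k => (hφ k).1) hu hg hφu hφg
  refine ⟨⟨?_, g, hgrad, ?_⟩, g, hgrad, φ, hφ, ?_, ?_⟩
  · rwa [ENNReal.ofReal_one, memLp_one_iff_integrable]
  · rwa [ENNReal.ofReal_one, memLp_one_iff_integrable]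
  · exact hφu.congr fun k => eLpNorm_sub_comm (φ k) u 1 _
  · exact hφg.congr fun k => eLpNorm_sub_comm (gradient (φ k)) g 1 _

end WeakGradients

section LowerSemicontinuity

variable {Ω : Set Plane} {δ : ℝ} {i : Fin 2}

lemma neg_mul_le_setIntegral_mul_pd (hΩb : Bornology.IsBounded Ω) {g ψ : Plane → ℝ}
    (hg : Smooth g) (hψ : IsTestFunction Ω ψ) (hδ : ∀ x, |ψ x| ≤ δ) :
    -(δ * ∫ x in Ω, |pd i g x|) ≤ ∫ x in Ω, g x * pd i ψ x := by
  rw [setIntegral_mul_pd hg hψ, neg_le_neg_iff, ← integral_const_mul]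
  refine (Real.le_norm_self _).trans (norm_integral_le_of_norm_le
    ((integrableOn_of_continuous hΩb (hg.pd i).continuous.abs).const_mul δ)
    (.of_forall fun x => ?_))
  rw [norm_mul, mul_comm, Real.norm_eq_abs, Real.norm_eq_abs]
  exact mul_le_mul_of_nonneg_right (hδ x) (abs_nonneg _)

lemma tangent_le_of_convexOn {φ : ℝ → ℝ} (hφ : ConvexOn ℝ Set.univ φ) {a : ℝ}
    (ha : DifferentiableAt ℝ φ a) (b : ℝ) : φ a + (b - a) * deriv φ a ≤ φ b := by
  rcases lt_trichotomy a b with hab | rfl | hab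
  · have hslope := hφ.deriv_le_slope (Set.mem_univ a) (Set.mem_univ b) hab ha
    rw [slope_def_field, le_div_iff₀ (sub_pos.2 hab)] at hslope
    linarith
  · simp
  · have hslope := hφ.slope_le_deriv (Set.mem_univ b) (Set.mem_univ a) hab ha
    rw [slope_def_field, div_le_iff₀ (sub_pos.2 hab)] at hslope
    linarith

theorem setIntegral_comp_le_of_tendsto (hΩb : Bornology.IsBounded Ω) {φ : ℝ → ℝ}
    (hφ : ConvexOn ℝ Set.univ φ) (hφs : ContDiff ℝ ((⊤ : ℕ∞) : WithTop ℕ∞) φ) {v a : Plane → ℝ}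
    (hv : Smooth v) {ψ : ℕ → Plane → ℝ} (hψ : ∀ j, IsTestFunction Ω (ψ j))
    (hδ : ∀ j x, |ψ j x| ≤ δ) (ha : IntegrableOn a Ω) (hφa : IntegrableOn (fun x => φ (a x)) Ω)
    (hlim : Tendsto (fun j => eLpNorm (pd i (ψ j) - (a - pd i v)) 1 (volume.restrict Ω))
      atTop (𝓝 0)) :
    ∫ x in Ω, φ (pd i v x) ≤
      (∫ x in Ω, φ (a x)) + δ * ∫ x in Ω, |pd i (fun x => deriv φ (pd i v x)) x| := by
  have hvi : Continuous (pd i v) := (hv.pd i).continuous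
  have hslope : Smooth fun x => deriv φ (pd i v x) :=
    ((contDiff_infty_iff_deriv.1 hφs).2).comp (hv.pd i)
  obtain ⟨c, hc⟩ := exists_ae_restrict_norm_le (μ := volume) hΩb hslope.continuous
  have hint : IntegrableOn (a - pd i v) Ω := ha.sub (integrableOn_of_continuous hΩb hvi)
  have hpairing : -(δ * ∫ x in Ω, |pd i (fun x => deriv φ (pd i v x)) x|) ≤
      ∫ x in Ω, (a x - pd i v x) * deriv φ (pd i v x) := by
    refine ge_of_tendsto' (tendsto_integral_bilin (ContinuousLinearMap.mul ℝ ℝ)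
      (fun j => integrableOn_of_continuous hΩb ((hψ j).pd i).1.continuous) hint hlim
      hslope.continuous.aestronglyMeasurable hc) fun j => ?_
    simp only [ContinuousLinearMap.mul_apply', mul_comm (pd i (ψ j) _)]
    exact neg_mul_le_setIntegral_mul_pd hΩb hslope (hψ j) (hδ j)
  have hφv : IntegrableOn (fun x => φ (pd i v x)) Ω :=
    integrableOn_of_continuous hΩb (hφs.continuous.comp hvi)
  have hprod : IntegrableOn (fun x => (a x - pd i v x) * deriv φ (pd i v x)) Ω :=
    Integrable.mul_bdd hint hslope.continuous.aestronglyMeasurable hc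
  have htangent := integral_mono (hφv.add hprod) hφa fun x =>
    tangent_le_of_convexOn hφ (hφs.differentiable (by simp) (pd i v x)) (a x)
  rw [integral_add' hφv hprod] at htangent
  linarith

end LowerSemicontinuity

/-- A smooth convex substitute for `|t| ^ q`. -/
def energyDensity (q t : ℝ) : ℝ := (1 + t ^ 2) ^ (q / 2)

/-- The norm in `L¹(Ω)` of `∂₀(φ'(∂₀∂₀w))`, where `φ = energyDensity q`. It bounds the energy that
is lost when `∂₀w` is perturbed by a test function, relative to the size of that function. -/
def slopeVariation (Ω : Set Plane) (q : ℝ) (w : Plane → ℝ) : ℝ :=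
  ∫ x in Ω, |pd 0 (fun x => deriv (energyDensity q) (pd 0 (pd 0 w) x)) x|

lemma slopeVariation_nonneg (Ω : Set Plane) (q : ℝ) (w : Plane → ℝ) : 0 ≤ slopeVariation Ω q w :=
  integral_nonneg fun _ => abs_nonneg _

lemma contDiff_energyDensity (q : ℝ) :
    ContDiff ℝ ((⊤ : ℕ∞) : WithTop ℕ∞) (energyDensity q) :=
  ContDiff.rpow_const_of_ne (by fun_prop) fun t => by positivity

lemma energyDensity_eq (q t : ℝ) : energyDensity q t = ‖(1 : ℂ) + t * Complex.I‖ ^ q := by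
  have h := Complex.norm_add_mul_I 1 t
  rw [Complex.ofReal_one, one_pow] at h
  rw [h, Real.sqrt_eq_rpow, ← Real.rpow_mul (by positivity), one_div_mul_eq_div, energyDensity]

lemma convexOn_energyDensity {q : ℝ} (hq : 1 ≤ q) : ConvexOn ℝ Set.univ (energyDensity q) := by
  have hnorm : ConvexOn ℝ Set.univ fun t : ℝ => ‖(1 : ℂ) + t * Complex.I‖ := by
    refine (convexOn_univ_norm.comp_affineMap (AffineMap.lineMap 1 (1 + Complex.I))).congr
      fun t _ => ?_
    simp [AffineMap.lineMap_apply, add_comm]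
  have hsub : (fun t : ℝ => ‖(1 : ℂ) + t * Complex.I‖) '' Set.univ ⊆ Set.Ici 0 := by
    rintro _ ⟨t, -, rfl⟩
    exact norm_nonneg _
  have hcont : Continuous fun t : ℝ => ‖(1 : ℂ) + t * Complex.I‖ := by fun_prop
  have himage : Convex ℝ ((fun t : ℝ => ‖(1 : ℂ) + t * Complex.I‖) '' Set.univ) :=
    (isPreconnected_univ.image _ hcont.continuousOn).ordConnected.convex
  refine (((convexOn_rpow hq).subset hsub himage).comp hnorm
    ((Real.monotoneOn_rpow_Ici_of_exponent_nonneg (zero_le_one.trans hq)).mono hsub)).congr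
    fun t _ => (energyDensity_eq q t).symm

lemma abs_rpow_le_energyDensity {q : ℝ} (hq : 0 ≤ q) (t : ℝ) : |t| ^ q ≤ energyDensity q t := by
  rw [energyDensity_eq]
  refine Real.rpow_le_rpow (abs_nonneg t) ?_ hq
  simpa using Complex.abs_im_le_norm (1 + t * Complex.I)

lemma integrable_energyDensity {α : Type*} [MeasurableSpace α] {μ : Measure α} [IsFiniteMeasure μ]
    {q : ℝ} (hq : 0 ≤ q) {f : α → ℝ} (hf : MemLp f (ENNReal.ofReal q) μ) :
    Integrable (fun x => energyDensity q (f x)) μ := by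
  have hmem : MemLp (fun x => (1 : ℂ) + f x * Complex.I) (ENNReal.ofReal q) μ :=
    MemLp.add (f := fun _ => (1 : ℂ)) (memLp_const 1) (hf.ofReal.mul_const Complex.I)
  simpa only [energyDensity_eq, ENNReal.toReal_ofReal hq] using hmem.integrable_norm_rpow'

namespace IsApproximation

variable {Ω : Set Plane} {m p q : ℝ} {S : Set (ℝ × ℝ × ℝ)} {w : ℕ → Plane → ℝ} {δ : ℕ → ℝ}

lemma isTestFunction_pd_zero_sub (h : IsApproximation Ω m p q S w δ) {k j : ℕ} (hkj : k ≤ j) :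
    IsTestFunction Ω fun x => pd 0 (w j) x - pd 0 (w k) x := by
  rw [← pd_sub (h.smooth j).differentiable (h.smooth k).differentiable]
  exact (h.isTestFunction_sub k j hkj).pd 0

theorem setIntegral_energyDensity_le (h : IsApproximation Ω m p q S w δ)
    (hΩb : Bornology.IsBounded Ω) (hq : 1 ≤ q) {a : Plane → ℝ} (ha : IntegrableOn a Ω)
    (hφa : IntegrableOn (fun x => energyDensity q (a x)) Ω)
    (hlim : Tendsto (fun j => eLpNorm (pd 0 (pd 0 (w j)) - a) 1 (volume.restrict Ω)) atTop (𝓝 0))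
    (k : ℕ) :
    ∫ x in Ω, energyDensity q (pd 0 (pd 0 (w k)) x) ≤
      (∫ x in Ω, energyDensity q (a x)) + δ k * slopeVariation Ω q (w k) := by
  refine setIntegral_comp_le_of_tendsto hΩb (convexOn_energyDensity hq) (contDiff_energyDensity q)
    ((h.smooth k).pd 0) (fun j => h.isTestFunction_pd_zero_sub (Nat.le_add_left k j))
    (fun j => h.abs_pd_zero_sub_le k _ (Nat.le_add_left k j)) ha hφa ?_
  refine (hlim.comp (tendsto_add_atTop_nat k)).congr fun j => ?_
  rw [pd_sub ((h.smooth _).pd 0).differentiable ((h.smooth k).pd 0).differentiable,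
    Function.comp_apply, ← sub_sub_sub_cancel_right _ a]
  rfl

theorem not_memLp (h : IsApproximation Ω m p q S w δ) (hΩb : Bornology.IsBounded Ω) (hq : 1 ≤ q)
    (hδ : ∀ k, δ k * slopeVariation Ω q (w k) ≤ 1) {a : Plane → ℝ} (ha : IntegrableOn a Ω)
    (hlim : Tendsto (fun j => eLpNorm (pd 0 (pd 0 (w j)) - a) 1 (volume.restrict Ω))
      atTop (𝓝 0)) :
    ¬MemLp a (ENNReal.ofReal q) (volume.restrict Ω) := fun hmem => by
  have hq₀ : 0 ≤ q := zero_le_one.trans hq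
  have : IsFiniteMeasure (volume.restrict Ω) := isFiniteMeasure_restrict.2 hΩb.measure_lt_top.ne
  have hbound (k : ℕ) : ∫ x in Ω, |pd 0 (pd 0 (w k)) x| ^ q ≤
      (∫ x in Ω, energyDensity q (a x)) + 1 := by
    have hcont : Continuous (pd 0 (pd 0 (w k))) := (((h.smooth k).pd 0).pd 0).continuous
    calc ∫ x in Ω, |pd 0 (pd 0 (w k)) x| ^ q
        ≤ ∫ x in Ω, energyDensity q (pd 0 (pd 0 (w k)) x) :=
          integral_mono (integrableOn_of_continuous hΩb (hcont.abs.rpow_const fun _ => .inr hq₀))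
            (integrableOn_of_continuous hΩb ((contDiff_energyDensity q).continuous.comp hcont))
            fun x => abs_rpow_le_energyDensity hq₀ _
      _ ≤ _ := h.setIntegral_energyDensity_le hΩb hq ha (integrable_energyDensity hq₀ hmem) hlim k
      _ ≤ _ := by gcongr; exact hδ k
  obtain ⟨k, hk⟩ := (h.tendsto_energy.eventually_gt_atTop _).exists
  exact (hbound k).not_gt hk

end IsApproximation

section GradientAndFlux

/-- The gradient of `∂₀w` as a function of `hess m w`. -/
def gradPart : (ℝ × ℝ × ℝ) →L[ℝ] Plane :=
  LinearMap.toContinuousLinearMap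
    { toFun := fun A => !₂[A.1, A.2.1]
      map_add' := fun A B => by ext i; fin_cases i <;> simp
      map_smul' := fun c A => by ext i; fin_cases i <;> simp }

/-- The divergence free field `(-m ∂₁∂₁w, m ∂₀∂₁w)` as a function of `hess m w`. -/
def fluxPart (m : ℝ) : (ℝ × ℝ × ℝ) →L[ℝ] Plane :=
  LinearMap.toContinuousLinearMap
    { toFun := fun A => !₂[-A.2.2, m * A.2.1]
      map_add' := fun A B => by ext i; fin_cases i <;> simp <;> ring
      map_smul' := fun c A => by ext i; fin_cases i <;> simp; ring }

lemma gradPart_apply (A : ℝ × ℝ × ℝ) : gradPart A = !₂[A.1, A.2.1] := rfl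

lemma fluxPart_apply (m : ℝ) (A : ℝ × ℝ × ℝ) : fluxPart m A = !₂[-A.2.2, m * A.2.1] := rfl

lemma gradient_pd_zero (m : ℝ) (w : Plane → ℝ) (x : Plane) :
    gradient (pd 0 w) x = gradPart (hess m w x) := by
  ext i
  rw [gradient_apply]
  fin_cases i <;> simp [gradPart_apply, hess]

lemma abs_fst_le_norm_gradPart (A : ℝ × ℝ × ℝ) : |A.1| ≤ ‖gradPart A‖ := by
  simpa [gradPart_apply] using abs_apply_le_norm (gradPart A) 0

open Classical in
/-- The phase that maps `gradPart A` to `fluxPart S₂ A`, for `A` in `phaseSet K`. -/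
def phaseCoeff (K s₁ S₂ : ℝ) (A : ℝ × ℝ × ℝ) : Matrix (Fin 2) (Fin 2) ℝ :=
  if A.2.2 = -(K * A.1) then Matrix.diagonal ![K, S₂] else Matrix.diagonal ![1 / K, s₁]

variable {K S₂ : ℝ} (s₁ : ℝ)

lemma measurable_phaseCoeff (i j : Fin 2) : Measurable fun A => phaseCoeff K s₁ S₂ A i j := by
  simp only [phaseCoeff, apply_ite (fun M : Matrix (Fin 2) (Fin 2) ℝ => M i j)]
  exact .ite (measurableSet_eq_fun (by fun_prop) (by fun_prop)) measurable_const measurable_const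

lemma isTwoPhase_phaseCoeff {Ω : Set Plane} {F : Plane → ℝ × ℝ × ℝ}
    (hF : AEMeasurable F (volume.restrict Ω)) :
    IsTwoPhase Ω (Matrix.diagonal ![1 / K, s₁]) (Matrix.diagonal ![K, S₂])
      fun x => phaseCoeff K s₁ S₂ (F x) :=
  ⟨fun i j => (measurable_phaseCoeff s₁ i j).comp_aemeasurable hF,
    .of_forall fun _ => (ite_eq_or_eq _ _ _).symm⟩

lemma toEuclideanLin_phaseCoeff_gradPart (hK : K ≠ 0) {A : ℝ × ℝ × ℝ} (hA : A ∈ phaseSet K) :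
    Matrix.toEuclideanLin (phaseCoeff K s₁ S₂ A) (gradPart A) = fluxPart S₂ A := by
  unfold phaseCoeff
  split_ifs with h
  · ext i
    fin_cases i <;> simp [Matrix.toLpLin_apply, gradPart_apply, fluxPart_apply, h]
  · obtain ⟨hfst, hoff⟩ := hA.resolve_left h
    have hfst' : A.1 = -(K * A.2.2) := by rw [hfst, neg_neg]
    ext i
    fin_cases i
    · simp [Matrix.toLpLin_apply, gradPart_apply, fluxPart_apply, hfst', hK]
    · simp [Matrix.toLpLin_apply, gradPart_apply, fluxPart_apply, hoff]

lemma setIntegral_inner_fluxPart_hess {Ω : Set Plane} {w φ : Plane → ℝ} (m : ℝ) (hw : Smooth w)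
    (hφ : IsTestFunction Ω φ) :
    ∫ x in Ω, inner ℝ (fluxPart m (hess m w x)) (gradient φ x) = 0 := by
  have hinner (x : Plane) : inner ℝ (fluxPart m (hess m w x)) (gradient φ x) =
      m * (pd 0 (pd 1 w) x * pd 1 φ x - pd 1 (pd 1 w) x * pd 0 φ x) := by
    rw [PiLp.inner_apply, Fin.sum_univ_two, gradient_apply, gradient_apply, pd_comm hw 0 1]
    simp [fluxPart_apply, hess]
    ring
  have hint (i j : Fin 2) : IntegrableOn (fun x => pd i (pd 1 w) x * pd j φ x) Ω :=
    ((((hw.pd 1).pd i).continuous.mul (hφ.pd j).1.continuous).integrable_of_hasCompactSupport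
      (hφ.pd j).2.1.mul_left).integrableOn
  have hparts (i j : Fin 2) : ∫ x in Ω, pd i (pd 1 w) x * pd j φ x =
      -∫ x in Ω, pd 1 w x * pd i (pd j φ) x := by
    rw [setIntegral_mul_pd (hw.pd 1) (hφ.pd j), neg_neg]
  simp only [hinner]
  rw [integral_const_mul, integral_sub (hint 0 1) (hint 1 0), hparts, hparts, pd_comm hφ.1 0 1,
    sub_self, mul_zero]

end GradientAndFlux

namespace IsApproximation

variable {Ω : Set Plane} {m p q : ℝ} {S : Set (ℝ × ℝ × ℝ)} {w : ℕ → Plane → ℝ} {δ : ℕ → ℝ}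
  {F : Plane → ℝ × ℝ × ℝ} {u : Plane → ℝ}

theorem exists_limit_hess (h : IsApproximation Ω m p q S w δ) (hΩb : Bornology.IsBounded Ω)
    (hp : 1 ≤ p) (hS : IsClosed S) (hSn : S.Nonempty) :
    ∃ F : Plane → ℝ × ℝ × ℝ, MemLp F (ENNReal.ofReal p) (volume.restrict Ω) ∧
      (∀ᵐ x ∂volume.restrict Ω, F x ∈ S) ∧
      Tendsto (fun k => eLpNorm (hess m (w k) - F) 1 (volume.restrict Ω)) atTop (𝓝 0) := by
  have hp₀ : 0 < p := zero_lt_one.trans_le hp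
  have hp₁ : 1 ≤ ENNReal.ofReal p := ENNReal.one_le_ofReal.2 hp
  have : IsFiniteMeasure (volume.restrict Ω) := isFiniteMeasure_restrict.2 hΩb.measure_lt_top.ne
  have hcont (k : ℕ) : Continuous (hess m (w k)) := continuous_hess (h.smooth k)
  obtain ⟨B, r, hB, hr₀, hr, hgeom⟩ := h.exists_geometric
  obtain ⟨F, hF, hlim⟩ := exists_tendsto_eLpNorm_of_geometric hp
    (fun k => memLp_restrict_of_continuous hΩb (hcont k) _) hB hr₀.le hr fun k => (hgeom k).1
  have hdist : Tendsto (fun k => eLpNorm (fun x => Metric.infDist (hess m (w k) x) S)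
      (ENNReal.ofReal p) (volume.restrict Ω)) atTop (𝓝 0) := by
    have hpow : Tendsto (fun k => ENNReal.ofReal ((B * r ^ k) ^ p⁻¹)) atTop (𝓝 0) := by
      simp only [mul_pow_rpow hB hr₀.le]
      simpa using ENNReal.tendsto_ofReal ((tendsto_pow_atTop_nhds_zero_of_lt_one
        (by positivity) (Real.rpow_lt_one hr₀.le hr (inv_pos.2 hp₀))).const_mul (B ^ p⁻¹))
    refine tendsto_of_tendsto_of_tendsto_of_le_of_le tendsto_const_nhds hpow (fun _ => zero_le)
      fun k => eLpNorm_le_of_integral_rpow_le hp₀ (memLp_restrict_of_continuous hΩb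
        ((Metric.continuous_infDist_pt S).comp (hcont k)) _) ?_
    simpa only [Function.comp_apply, Real.norm_of_nonneg Metric.infDist_nonneg] using (hgeom k).2
  exact ⟨F, hF, ae_mem_of_tendsto_eLpNorm hp₁ hS hSn (fun k => (hcont k).aestronglyMeasurable)
      hF.1 hlim hdist,
    tendsto_eLpNorm_one hp₁ (fun k => (hcont k).aestronglyMeasurable.sub hF.1) hlim⟩

lemma tendsto_pd_zero_pd_zero
    (hlim : Tendsto (fun k => eLpNorm (hess m (w k) - F) 1 (volume.restrict Ω)) atTop (𝓝 0)) :
    Tendsto (fun k => eLpNorm (pd 0 (pd 0 (w k)) - fun x => (F x).1) 1 (volume.restrict Ω))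
      atTop (𝓝 0) :=
  tendsto_eLpNorm_zero_of_le_mul (c := 1) hlim fun k => .of_forall fun x => by
    rw [one_mul]
    exact norm_fst_le (hess m (w k) x - F x)

lemma tendsto_gradient
    (hlim : Tendsto (fun k => eLpNorm (hess m (w k) - F) 1 (volume.restrict Ω)) atTop (𝓝 0)) :
    Tendsto (fun k => eLpNorm (gradient (pd 0 (w k)) - fun x => gradPart (F x)) 1
      (volume.restrict Ω)) atTop (𝓝 0) :=
  tendsto_eLpNorm_zero_of_le_mul (c := ‖gradPart‖) hlim fun k => .of_forall fun x => by
    rw [Pi.sub_apply, gradient_pd_zero m, ← map_sub]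
    exact gradPart.le_opNorm _

theorem exists_limit_pd_zero (h : IsApproximation Ω m p q S w δ) (hΩb : Bornology.IsBounded Ω) :
    ∃ u : Plane → ℝ, Continuous u ∧
      Tendsto (fun k => eLpNorm (pd 0 (w k) - u) 1 (volume.restrict Ω)) atTop (𝓝 0) := by
  have : IsFiniteMeasure (volume.restrict Ω) := isFiniteMeasure_restrict.2 hΩb.measure_lt_top.ne
  obtain ⟨u, hu, hle⟩ := exists_continuous_abs_sub_le (fun k => ((h.smooth k).pd 0).continuous)
    h.tendsto_zero h.abs_pd_zero_sub_le
  exact ⟨u, hu, tendsto_eLpNorm_zero_of_norm_le h.tendsto_zero hle⟩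

lemma hasWeakGradient_limit (h : IsApproximation Ω m p q S w δ) (hΩb : Bornology.IsBounded Ω)
    (hu : IntegrableOn u Ω) (hF : IntegrableOn F Ω)
    (hlim : Tendsto (fun k => eLpNorm (hess m (w k) - F) 1 (volume.restrict Ω)) atTop (𝓝 0))
    (hlim_u : Tendsto (fun k => eLpNorm (pd 0 (w k) - u) 1 (volume.restrict Ω)) atTop (𝓝 0)) :
    HasWeakGradient Ω u fun x => gradPart (F x) :=
  hasWeakGradient_of_tendsto hΩb (fun k => (h.smooth k).pd 0) hu (gradPart.integrable_comp hF)
    hlim_u (tendsto_gradient hlim)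

theorem memW11Zero_limit_sub (h : IsApproximation Ω m p q S w δ) (hΩb : Bornology.IsBounded Ω)
    (hu : IntegrableOn u Ω) (hF : IntegrableOn F Ω)
    (hlim : Tendsto (fun k => eLpNorm (hess m (w k) - F) 1 (volume.restrict Ω)) atTop (𝓝 0))
    (hlim_u : Tendsto (fun k => eLpNorm (pd 0 (w k) - u) 1 (volume.restrict Ω)) atTop (𝓝 0)) :
    MemW11Zero Ω (u - pd 0 (w 0)) := by
  have hsmooth (k : ℕ) : Smooth (pd 0 (w k)) := (h.smooth k).pd 0
  refine memW11Zero_of_tendsto hΩb (φ := fun k => pd 0 (w k) - pd 0 (w 0))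
    (g := (fun x => gradPart (F x)) - gradient (pd 0 (w 0)))
    (fun k => h.isTestFunction_pd_zero_sub k.zero_le)
    (hu.sub (integrableOn_of_continuous hΩb (hsmooth 0).continuous))
    ((gradPart.integrable_comp hF).sub
      (integrableOn_of_continuous hΩb (continuous_gradient (hsmooth 0)))) ?_ ?_
  · simpa only [sub_sub_sub_cancel_right] using hlim_u
  · simpa only [gradient_sub (hsmooth _).differentiable (hsmooth 0).differentiable,
      sub_sub_sub_cancel_right] using tendsto_gradient hlim

theorem setIntegral_inner_fluxPart_limit (h : IsApproximation Ω m p q S w δ)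
    (hΩb : Bornology.IsBounded Ω) (hF : IntegrableOn F Ω)
    (hlim : Tendsto (fun k => eLpNorm (hess m (w k) - F) 1 (volume.restrict Ω)) atTop (𝓝 0))
    {φ : Plane → ℝ} (hφ : IsTestFunction Ω φ) :
    IntegrableOn (fun x => inner ℝ (fluxPart m (F x)) (gradient φ x)) Ω ∧
      ∫ x in Ω, inner ℝ (fluxPart m (F x)) (gradient φ x) = 0 := by
  have hgrad := continuous_gradient hφ.1
  obtain ⟨c, hc⟩ := exists_ae_restrict_norm_le (μ := volume) hΩb hgrad
  let L : (ℝ × ℝ × ℝ) →L[ℝ] Plane →L[ℝ] ℝ := (innerSL ℝ : Plane →L[ℝ] Plane →L[ℝ] ℝ) ∘L fluxPart m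
  have hint := tendsto_integral_bilin L
    (fun k => integrableOn_of_continuous hΩb (continuous_hess (h.smooth k))) hF hlim
    hgrad.aestronglyMeasurable hc
  have hzero (k : ℕ) : ∫ x in Ω, L (hess m (w k) x) (gradient φ x) = 0 :=
    setIntegral_inner_fluxPart_hess m (h.smooth k) hφ
  simp only [hzero] at hint
  exact ⟨L.integrable_of_bilin_of_bdd_right c hF hgrad.aestronglyMeasurable hc,
    tendsto_nhds_unique hint tendsto_const_nhds⟩

end IsApproximation

theorem exists_solution {Ω : Set Plane} (hΩ : IsOpen Ω) (hΩb : Bornology.IsBounded Ω)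
    (hΩn : Ω.Nonempty) {K s₁ S₂ p : ℝ} (hK : 1 < K) (hS₂ : 0 < S₂) (hp : 1 ≤ p)
    (hpq : p < 2 * K / (K + 1)) :
    ∃ σ u Du, IsTwoPhase Ω (Matrix.diagonal ![1 / K, s₁]) (Matrix.diagonal ![K, S₂]) σ ∧
      Continuous u ∧ HasWeakGradient Ω u Du ∧ MemLp Du (ENNReal.ofReal p) (volume.restrict Ω) ∧
      (∀ φ, IsTestFunction Ω φ →
        IntegrableOn (fun x => inner ℝ (Matrix.toEuclideanLin (σ x) (Du x)) (gradient φ x)) Ω ∧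
        ∫ x in Ω, inner ℝ (Matrix.toEuclideanLin (σ x) (Du x)) (gradient φ x) = 0) ∧
      MemW11Zero Ω (fun x => u x - x 0) ∧
      ¬MemLp Du (ENNReal.ofReal (2 * K / (K + 1))) (volume.restrict Ω) := by
  have : IsFiniteMeasure (volume.restrict Ω) := isFiniteMeasure_restrict.2 hΩb.measure_lt_top.ne
  set q := 2 * K / (K + 1)
  have hq : 1 ≤ q := hp.trans hpq.le
  have hvar (w : Plane → ℝ) : 0 ≤ slopeVariation Ω q w := slopeVariation_nonneg Ω q w
  obtain ⟨w, δ, h, hδ, hw₀⟩ := exists_isApproximation hK hS₂ (zero_lt_one.trans_le hp) hpq hΩ hΩb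
    hΩn (b := fun w => (1 + slopeVariation Ω q w)⁻¹) fun w => inv_pos.2 (by linarith [hvar w])
  obtain ⟨F, hFp, hFphase, hlim⟩ := h.exists_limit_hess hΩb hp (isClosed_phaseSet K)
    ⟨0, zero_mem_phaseSet K⟩
  obtain ⟨u, hu, hlim_u⟩ := h.exists_limit_pd_zero hΩb
  have hF : IntegrableOn F Ω := hFp.integrable (ENNReal.one_le_ofReal.2 hp)
  have hu' : IntegrableOn u Ω := integrableOn_of_continuous hΩb hu
  have hflux : ∀ᵐ x ∂volume.restrict Ω, fluxPart S₂ (F x) =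
      Matrix.toEuclideanLin (phaseCoeff K s₁ S₂ (F x)) (gradPart (F x)) :=
    hFphase.mono fun x hx =>
      (toEuclideanLin_phaseCoeff_gradPart s₁ (zero_lt_one.trans hK).ne' hx).symm
  refine ⟨fun x => phaseCoeff K s₁ S₂ (F x), u, fun x => gradPart (F x),
    isTwoPhase_phaseCoeff s₁ hFp.1.aemeasurable, hu, h.hasWeakGradient_limit hΩb hu' hF hlim hlim_u,
    gradPart.comp_memLp' hFp, fun φ hφ => ?_, ?_, fun hmem => ?_⟩
  · have hinner : (fun x => inner ℝ (fluxPart S₂ (F x)) (gradient φ x)) =ᵐ[volume.restrict Ω] _ :=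
      hflux.mono fun x hx => congrArg (inner ℝ · (gradient φ x)) hx
    obtain ⟨hint, hzero⟩ := h.setIntegral_inner_fluxPart_limit hΩb hF hlim hφ
    exact ⟨hint.congr hinner, (integral_congr_ae hinner).symm.trans hzero⟩
  · simpa only [Pi.sub_def, hw₀] using h.memW11Zero_limit_sub hΩb hu' hF hlim hlim_u
  · refine h.not_memLp hΩb hq (fun k => ?_) hF.fst (IsApproximation.tendsto_pd_zero_pd_zero hlim)
      (hmem.of_le hFp.1.fst (.of_forall fun x => abs_fst_le_norm_gradPart (F x)))
    calc δ k * slopeVariation Ω q (w k)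
        ≤ (1 + slopeVariation Ω q (w k))⁻¹ * slopeVariation Ω q (w k) := by
          gcongr
          exacts [hvar _, hδ k]
      _ ≤ 1 := by
          rw [inv_mul_le_one₀ (by linarith [hvar (w k)])]
          linarith

end TwoPhase

end

theorem theorem1p2_general (Ω : Set TwoPhase.Plane) (hΩo : IsOpen Ω) (hΩb : Bornology.IsBounded Ω)
    (hΩn : Ω.Nonempty) (K s₁ S₂ : ℝ) (hK : 1 < K) (hS₂ : 0 < S₂) :
    ∃ (σ : ℕ → TwoPhase.Plane → Matrix (Fin 2) (Fin 2) ℝ) (p : ℕ → ℝ)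
      (u : ℕ → TwoPhase.Plane → ℝ) (Du : ℕ → TwoPhase.Plane → TwoPhase.Plane),
      (∀ n, TwoPhase.IsTwoPhase Ω (Matrix.diagonal ![1 / K, s₁]) (Matrix.diagonal ![K, S₂])
        (σ n)) ∧
      (∀ n, p n ∈ Set.Icc 1 (2 * K / (K + 1))) ∧
      (∀ n, TwoPhase.MemW1 Ω 1 (u n)) ∧
      (∀ n, TwoPhase.HasWeakGradient Ω (u n) (Du n)) ∧
      (∀ n, TwoPhase.IsDistributionalSolution Ω (σ n) (u n)) ∧
      (∀ n, TwoPhase.MemW11Zero Ω (fun x => u n x - x 0)) ∧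
      (∀ n, TwoPhase.MemWeakLp Ω (p n) (Du n)) ∧
      Filter.Tendsto p Filter.atTop (nhds (2 * K / (K + 1))) ∧
      (∀ n, ¬ MeasureTheory.MemLp (Du n) (ENNReal.ofReal (2 * K / (K + 1)))
        (MeasureTheory.volume.restrict Ω)) ∧
      (∀ n, ∀ q : ℝ, 1 ≤ q → q < p n → TwoPhase.MemW1 Ω q (u n)) ∧
      (∀ n, ∫⁻ x in Ω, ENNReal.ofReal (‖Du n x‖ ^ (2 * K / (K + 1))) = ⊤) := by
  set q := 2 * K / (K + 1)
  have hq : 1 < q := by rw [one_lt_div] <;> linarith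
  obtain ⟨p, -, hp, hlim⟩ := exists_seq_strictMono_tendsto' hq
  choose σ u Du hσ hu hgrad hDu hdiv hbdry hnot using fun n =>
    TwoPhase.exists_solution (s₁ := s₁) hΩo hΩb hΩn hK hS₂ (hp n).1.le (hp n).2
  have hW1 (n : ℕ) {r : ℝ} (hr : r ≤ p n) : TwoPhase.MemW1 Ω r (u n) :=
    have : IsFiniteMeasure (volume.restrict Ω) := isFiniteMeasure_restrict.2 hΩb.measure_lt_top.ne
    ⟨TwoPhase.memLp_restrict_of_continuous hΩb (hu n) _, Du n, hgrad n,
      (hDu n).mono_exponent (ENNReal.ofReal_le_ofReal hr)⟩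
  have hW11 (n : ℕ) : TwoPhase.MemW1 Ω 1 (u n) := hW1 n (hp n).1.le
  exact ⟨σ, p, u, Du, hσ, fun n => Set.Ioo_subset_Icc_self (hp n), hW11, hgrad,
    fun n => ⟨hW11 n, Du n, hgrad n, hdiv n⟩, hbdry,
    fun n => TwoPhase.memWeakLp_of_memLp (zero_lt_one.trans (hp n).1) (hDu n), hlim, hnot,
    fun n _ _ hr => hW1 n hr.le,
    fun n => TwoPhase.lintegral_rpow_norm_eq_top (zero_lt_one.trans hq) (hDu n).1 (hnot n)⟩

theorem theorem1p2 (Ω : Set TwoPhase.Plane) (hΩo : IsOpen Ω) (hΩb : Bornology.IsBounded Ω)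
    (hΩn : Ω.Nonempty) (K S₁ S₂ : ℝ) (hK : 1 < K)
    (hS₁ : S₁ ∈ Set.Icc (1 / K) K) (hS₂ : S₂ ∈ Set.Icc (1 / K) K) :
    ∃ (σ : ℕ → TwoPhase.Plane → Matrix (Fin 2) (Fin 2) ℝ) (p : ℕ → ℝ)
      (u : ℕ → TwoPhase.Plane → ℝ) (Du : ℕ → TwoPhase.Plane → TwoPhase.Plane),
      (∀ n, TwoPhase.IsTwoPhase Ω (Matrix.diagonal ![1 / K, 1 / S₁]) (Matrix.diagonal ![K, S₂])
        (σ n)) ∧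
      (∀ n, p n ∈ Set.Icc 1 (2 * K / (K + 1))) ∧
      (∀ n, TwoPhase.MemW1 Ω 1 (u n)) ∧
      (∀ n, TwoPhase.HasWeakGradient Ω (u n) (Du n)) ∧
      (∀ n, TwoPhase.IsDistributionalSolution Ω (σ n) (u n)) ∧
      (∀ n, TwoPhase.MemW11Zero Ω (fun x => u n x - x 0)) ∧
      (∀ n, TwoPhase.MemWeakLp Ω (p n) (Du n)) ∧
      Filter.Tendsto p Filter.atTop (nhds (2 * K / (K + 1))) ∧
      (∀ n, ¬ MeasureTheory.MemLp (Du n) (ENNReal.ofReal (2 * K / (K + 1)))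
        (MeasureTheory.volume.restrict Ω)) ∧
      (∀ n, ∀ q : ℝ, 1 ≤ q → q < p n → TwoPhase.MemW1 Ω q (u n)) ∧
      (∀ n, ∫⁻ x in Ω, ENNReal.ofReal (‖Du n x‖ ^ (2 * K / (K + 1))) = ⊤) :=
  theorem1p2_general Ω hΩo hΩb hΩn K (1 / S₁) S₂ hK
    ((one_div_pos.2 (zero_lt_one.trans hK)).trans_le hS₂.1)
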